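/- For an undirected graph $G=(V,E)$ on $n$ vertices and integers $k\ge 1$, $r,s\ge 0$, consider the following randomized algorithm Hamiltonian$(G,k,r,s)$. A simple path of length $k$ is a path with $k$ edges and $k+1$ distinct vertices. For every $v_0\in V$, repeat $T=\Big\lfloor 2^{k+1}/\big(\binom{r}{k-r-s+1}\binom{k-r}{s}\big)\Big\rfloor$ times: 1. Choose a uniformly random partition $V=V_1\cup V_2$ with $v_0\in V_1$. Let $E_2$ be the set of edges with both ends in $V_2$. 2. Call a walk $v_0,v_1,\dots,v_k$ in $G$ (repetitions allowed) $(r,s)$-legitimate if exactly $r$ of the indices $0\le i\le k$ have $v_i\in V_1$, exactly $s$ of the indices $0\le i<k$ have $\{v_i,v_{i+1}\}\in E_2$, and there is no $i$ with $v_{i+2}=v_i\in V_2$ and $v_{i+1}\in V_1$. Build by dynamic programming (over the length, the two counts and the last two vertices) an arithmetic circuit for the polynomial $f(x,y,z)=\sum_p \prod_{e\in E(p)}x_e\prod_{v\in V(p)\cap V_1}y_v\prod_{e\in E(p)\cap E_2}z_e$, where $p$ ranges over the $(r,s)$-legitimate walks of length $k$ starting at $v_0$, and $V(p)$ and $E(p)$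 are multisets. 3. Test whether $\phi f=\sum_{S\subseteq[s]}\sum_{R\subseteq[r]} f\big(x,\sum_{i\in R}y^{(i)},\sum_{j\in S}z^{(j)}\big)\not\equiv 0$ by evaluating $\phi f$ at one uniformly random point over the field $\mathbb F_{2^m}$, where $m$ is the least integer with $2^m>4(2k+1)$. If the value is nonzero, answer YES and halt. If the algorithm has not halted after all $v_0\in V$ and all repetitions, it answers NO. Call $(k,r,s)$ admissible if $\binom{r}{k-r-s+1}\neq0$ and $\binom{k-r}{s}\ne 0$ (with $\binom{a}{b}=0$ for $b<0$ and $\binom{-1}{0}=1$); these are the parameters for which $T$ is defined. (If $(k,r,s)$ is not admissible, the loop is run with some fixed finite number of repetitions, possibly zero.) Then: (i) There are constants $C,c$ such that for every $G$ and every admissible $(k,r,s)$ with $1\le k\le n$, every execution of Hamiltonian$(G,k,r,s)$ takes at most $$C\cdot\frac{2^{r+s+k}\,n^{c}}{\binom{r}{k-r-s+1}\binom{k-r}{s}}$$ steps (bit operations of a randomized random access machine that accesses $G$ through its adjacency matrix). (ii) If $(k,r,s)$ is admissible with $k\geq 1$ and $G$ contains a simple path of length $k$, then the answer is YES with probability at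 least $1/2$. (iii) If $k\ge1$ and $G$ contains no simple path of length $k$, then the answer is NO with probability $1$. (iv) Running the algorithm with $r=\lfloor 0.5k\rfloor$ and $s=\lfloor0.208k\rfloor$ solves the undirected $k$-path problem in time $O^*(1.657^k)$. More precisely, consider the algorithm that answers NO if $k\ge n$, and otherwise runs Hamiltonian$(G,k,r,s)$ with these $r,s$ if $k\ge 10$ and with $r=k+1$, $s=0$ if $k<10$. For all $k\geq 1$ and all $G$ it takes at most $C'(n+1)^{c'}\,1.657^k$ steps in every execution, for constants $C',c'$. It answers YES with probability at least $1/2$ if $G$ contains a simple path of length $k$, and NO with probability $1$ otherwise. -/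

import Mathlib

namespace KPath

/-! ## Machine model

A randomized program is a tree of elementary instructions.  The input graph (vertex set `Fin n`) can
only be inspected by the instruction `adj`, random bits are only obtained by `coin` and `rand`, and
all arithmetic on integers and on elements of the field `F` is done by instructions.  Operands are
fetched from memory, and the result is stored, as part of an instruction.  What the programs below do
between two instructions is only to branch on a bit or on a loop index and to form addresses. -/

inductive ArithOp
  | add | sub | mul | div | lt

def ArithOp.eval : ArithOp → ℕ → ℕ → ℕ
  | .add, a, b => a + b
  | .sub, a, b => a - b
  | .mul, a, b => a * b
  | .div, a, b => a / b
  | .lt, a, b => if a < b then 1 else 0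

/-- The elementary instructions, indexed by the type of the value that they produce. -/
inductive Instr (n : ℕ) (F : Type) : Type → Type
  /-- bookkeeping of control flow: one loop iteration, one memory write, one emitted gate -/
  | tick : Instr n F Unit
  /-- set up the arithmetic of the field -/
  | setup : Instr n F Unit
  /-- toss a fair coin -/
  | coin : Instr n F Bool
  /-- draw a uniformly random field element -/
  | rand : Instr n F F
  /-- look up an entry of the adjacency matrix -/
  | adj (u v : Fin n) : Instr n F Bool
  /-- integer arithmetic -/
  | arith (op : ArithOp) (a b : ℕ) : Instr n F ℕ
  /-- field arithmetic -/
  | fadd (a b : F) : Instr n F F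
  | fmul (a b : F) : Instr n F F
  | fzero (a : F) : Instr n F Bool

/-- Cost of an instruction in bit operations, when a field element is stored in `m` bits (as a
polynomial over the two-element field modulo an irreducible one of degree `m`).
Integer and field arithmetic is charged at schoolbook rates.  `setup` is charged for finding an
irreducible polynomial of degree `m` by trial division of each of the `2 ^ m` candidates by each of
at most `2 ^ m` polynomials of smaller degree. -/
def Instr.cost {n : ℕ} {F β : Type} (m : ℕ) : Instr n F β → ℕ
  | .tick => 1
  | .setup => 4 ^ m * (m + 1) ^ 2
  | .coin => 1
  | .rand => m + 1
  | .adj _ _ => 1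
  | .arith _ a b => (Nat.size a + 1) * (Nat.size b + 1)
  | .fadd _ _ => m + 1
  | .fmul _ _ => (m + 1) ^ 2
  | .fzero _ => m + 1

/-- Randomized programs that return a value of type `α`. -/
inductive Prog (n : ℕ) (F : Type) (α : Type) : Type 1
  | ret (a : α) : Prog n F α
  | step {β : Type} (i : Instr n F β) (k : β → Prog n F α) : Prog n F α

namespace Prog

variable {n : ℕ} {F α β ι σ : Type}

def bind (p : Prog n F α) (f : α → Prog n F β) : Prog n F β :=
  match p with
  | .ret a => f a
  | .step i k => .step i fun b => (k b).bind f

instance instMonad : Monad (Prog n F) where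
  pure := Prog.ret
  bind := Prog.bind

/-- The program that consists of a single instruction. -/
def exec (i : Instr n F β) : Prog n F β := .step i .ret

/-- `for i in l do a ← f a i`, then return `a`. -/
def fold (l : List ι) (a : σ) (f : σ → ι → Prog n F σ) : Prog n F σ :=
  match l with
  | [] => pure a
  | i :: l => do
      exec .tick
      let a' ← f a i
      fold l a' f

/-- Concatenate the lists produced by `f i`, for `i` in `l`. -/
def collect (l : List ι) (f : ι → Prog n F (List β)) : Prog n F (List β) :=
  match l with
  | [] => pure []
  | i :: l => do
      exec .tick
      let b ← f i
      let bs ← collect l f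
      pure (b ++ bs)

/-- Fill an array: the entry at `i` is produced by `f i`, for `i` in `l`; other entries are `d`. -/
def tabulate [DecidableEq ι] (d : β) (l : List ι) (f : ι → Prog n F β) : Prog n F (ι → β) :=
  match l with
  | [] => pure fun _ => d
  | i :: l => do
      exec .tick
      let b ← f i
      let t ← tabulate d l f
      pure (Function.update t i b)

/-- `for i in l do (if f i then answer YES and halt)`; afterwards answer NO. -/
def anyOf (l : List ι) (f : ι → Prog n F Bool) : Prog n F Bool :=
  match l with
  | [] => pure false
  | i :: l => do
      exec .tick
      let b ← f i
      if b then pure true else anyOf l f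

end Prog

/-- The (random) effect of an instruction, for the input graph `G` and the field with `2 ^ m`
elements. -/
noncomputable def Instr.sem {n m : ℕ} (G : SimpleGraph (Fin n)) {β : Type} :
    Instr n (GaloisField 2 m) β → PMF β
  | .tick => PMF.pure ()
  | .setup => PMF.pure ()
  | .coin => PMF.uniformOfFintype Bool
  | .rand => letI := Fintype.ofFinite (GaloisField 2 m); PMF.uniformOfFintype (GaloisField 2 m)
  | .adj u v => open Classical in PMF.pure (decide (G.Adj u v))
  | .arith op a b => PMF.pure (op.eval a b)
  | .fadd a b => PMF.pure (a + b)
  | .fmul a b => PMF.pure (a * b)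
  | .fzero a => open Classical in PMF.pure (decide (a = 0))

/-- Joint distribution of the returned value and of the running time (the total cost of the executed
instructions) of a program on the input graph `G`. -/
noncomputable def Prog.run {n m : ℕ} (G : SimpleGraph (Fin n)) {α : Type} :
    Prog n (GaloisField 2 m) α → PMF (α × ℕ)
  | .ret a => PMF.pure (a, 0)
  | .step i k => (i.sem G).bind fun b => ((k b).run G).map fun o => (o.1, i.cost m + o.2)

/-! ## Arithmetic circuits -/

/-- The variables `x_e`, `y_v`, `z_e`.  (Only those `x_e` with `e` an edge, those `y_v` with `v ∈ V₁`
and those `z_e` with `e` an edge inside `V₂` will occur in a circuit.) -/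
inductive Var (n : ℕ)
  | x (e : Sym2 (Fin n))
  | y (v : Fin n)
  | z (e : Sym2 (Fin n))

/-- Names of the gates: `path j r s u₁ u₂` holds the polynomial of the `(r,s)`-legitimate `j`-paths
from `v₀` whose last two vertices are `u₁, u₂`; `out` is the output. -/
inductive Node (n : ℕ)
  | path (j r s : ℕ) (u₁ u₂ : Fin n)
  | out
  deriving DecidableEq

inductive Wire (n : ℕ)
  | zero
  | input (v : Var n)
  | node (ν : Node n)

inductive GateOp
  | add | mul

/-- The assignment `dst := lhs op rhs`. -/
structure Gate (n : ℕ) where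
  dst : Node n
  op : GateOp
  lhs : Wire n
  rhs : Wire n

/-- Arithmetic circuits, as straight-line programs. -/
abbrev Circuit (n : ℕ) := List (Gate n)

section Algorithm

open Prog

variable {n : ℕ} {F : Type}

def Wire.val [Zero F] (ρ : Var n → F) (t : Node n → F) : Wire n → F
  | .zero => 0
  | .input v => ρ v
  | .node ν => t ν

/-- Compute the value of one gate, from the values `ρ` of the inputs and `t` of the other gates. -/
def Gate.compute [Zero F] (ρ : Var n → F) (t : Node n → F) (g : Gate n) : Prog n F F :=
  match g.op with
  | .add => exec (.fadd (g.lhs.val ρ t) (g.rhs.val ρ t))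
  | .mul => exec (.fmul (g.lhs.val ρ t) (g.rhs.val ρ t))

/-- Evaluate a circuit at the assignment `ρ`, gate by gate. -/
def evalCircuit [Zero F] (C : Circuit n) (ρ : Var n → F) : Prog n F F := do
  let t ← fold C (fun _ : Node n => (0 : F)) fun t g => do
    let a ← g.compute ρ t
    pure (Function.update t g.dst a)
  pure (t .out)

def emit (g : Gate n) : Prog n F (List (Gate n)) := do
  exec .tick
  pure [g]

/-- `ν := 0` -/
def clear (ν : Node n) : Prog n F (List (Gate n)) := emit ⟨ν, .add, .zero, .zero⟩

/-- `ν := ν + μ` -/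
def addNode (ν μ : Node n) : Prog n F (List (Gate n)) := emit ⟨ν, .add, .node ν, .node μ⟩

/-- `ν := ν * v` -/
def mulVar (ν : Node n) (v : Var n) : Prog n F (List (Gate n)) := emit ⟨ν, .mul, .node ν, .input v⟩

/-- `ν := ∑ path j r s w u`, over the neighbours `w` of `u` with `ok w`. -/
def sumGates (ν : Node n) (j r s : ℕ) (u : Fin n) (ok : Fin n → Bool) :
    Prog n F (List (Gate n)) := do
  let g₀ ← clear ν
  let g₁ ← collect (List.finRange n) fun w => do
    let e ← exec (.adj u w)
    if e && ok w then addNode ν (.path j r s w u) else pure []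
  pure (g₀ ++ g₁)

/-- The gates that compute `path j r s u₁ u₂` from the gates `path (j - 1) r' s' w u₁`;
here `V₁ v = true` says that `v` lies in the first part of the partition. -/
def pathGates (v₀ : Fin n) (V₁ : Fin n → Bool) (j r s : ℕ) (u₁ u₂ : Fin n) :
    Prog n F (List (Gate n)) := do
  let ν : Node n := .path j r s u₁ u₂
  let e ← exec (.adj u₁ u₂)
  if e then
    if j = 1 then
      if u₁ = v₀ ∧ V₁ u₂ = false ∧ r = 1 ∧ s = 0 then
        emit ⟨ν, .mul, .input (.x s(v₀, u₂)), .input (.y v₀)⟩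
      else if u₁ = v₀ ∧ V₁ u₂ = true ∧ r = 2 ∧ s = 0 then do
        let g₀ ← emit ⟨ν, .mul, .input (.x s(v₀, u₂)), .input (.y v₀)⟩
        let g₁ ← mulVar ν (.y u₂)
        pure (g₀ ++ g₁)
      else clear ν
    else if V₁ u₂ then
      match r with
      | 0 => clear ν
      | r' + 1 => do
        let g₀ ← sumGates ν (j - 1) r' s u₁ fun _ => true
        let g₁ ← mulVar ν (.x s(u₁, u₂))
        let g₂ ← mulVar ν (.y u₂)
        pure (g₀ ++ g₁ ++ g₂)
    else if V₁ u₁ then do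
      let g₀ ← sumGates ν (j - 1) r s u₁ fun w => decide (w ≠ u₂)
      let g₁ ← mulVar ν (.x s(u₁, u₂))
      pure (g₀ ++ g₁)
    else
      match s with
      | 0 => clear ν
      | s' + 1 => do
        let g₀ ← sumGates ν (j - 1) r s' u₁ fun _ => true
        let g₁ ← mulVar ν (.x s(u₁, u₂))
        let g₂ ← mulVar ν (.z s(u₁, u₂))
        pure (g₀ ++ g₁ ++ g₂)
  else clear ν

/-- Build, by dynamic programming, the circuit for the sum of the monomials
`∏_{e ∈ E(p)} x_e · ∏_{v ∈ V(p) ∩ V₁} y_v · ∏_{e ∈ E(p) ∩ E₂} z_e` over all `(r,s)`-legitimate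
`k`-paths `p` that start from `v₀`. -/
def buildCircuit (k r s : ℕ) (v₀ : Fin n) (V₁ : Fin n → Bool) : Prog n F (Circuit n) := do
  let g₀ ← collect (List.range' 1 k) fun j =>
    collect (List.range (r + 1)) fun r' =>
      collect (List.range (s + 1)) fun s' =>
        collect (List.finRange n) fun u₁ =>
          collect (List.finRange n) fun u₂ => pathGates v₀ V₁ j r' s' u₁ u₂
  let g₁ ← clear .out
  let g₂ ← collect (List.finRange n) fun u₁ =>
    collect (List.finRange n) fun u₂ => addNode .out (.path k r s u₁ u₂)
  pure (g₀ ++ g₁ ++ g₂)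

/-! ## The algorithm -/

/-- The array of the sums `∑_{i ∈ R} Y i a`, for `a` in `l`. -/
def sumArray [Zero F] {ι : Type} [DecidableEq ι] {q : ℕ} (l : List ι) (Y : Fin q → ι → F)
    (R : List (Fin q)) : Prog n F (ι → F) :=
  tabulate 0 l fun a => fold R 0 fun c i => exec (.fadd c (Y i a))

def assign (x : Sym2 (Fin n) → F) (y : Fin n → F) (z : Sym2 (Fin n) → F) : Var n → F
  | .x e => x e
  | .y v => y v
  | .z e => z e

/-- All unordered pairs of vertices. -/
def pairs (n : ℕ) : List (Sym2 (Fin n)) := (List.finRange n).sym2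

/-- Schwartz-Zippel test of
`∑_{S ⊆ [s]} ∑_{R ⊆ [r]} f (x, ∑_{i ∈ R} y⁽ⁱ⁾, ∑_{j ∈ S} z⁽ʲ⁾) ≢ 0`, for the polynomial `f` of the
circuit `C`: evaluate at a uniformly random point and compare with zero. -/
def phiTest [Zero F] (r s : ℕ) (C : Circuit n) : Prog n F Bool := do
  let x ← tabulate 0 (pairs n) fun _ => exec .rand
  let Y ← tabulate (fun _ => 0) (List.finRange r) fun _ =>
    tabulate 0 (List.finRange n) fun _ => exec .rand
  let Z ← tabulate (fun _ => 0) (List.finRange s) fun _ =>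
    tabulate 0 (pairs n) fun _ => exec .rand
  let total ← fold (List.finRange s).sublists 0 fun acc S => do
    let z ← sumArray (pairs n) Z S
    fold (List.finRange r).sublists acc fun acc R => do
      let y ← sumArray (List.finRange n) Y R
      let a ← evalCircuit C (assign x y z)
      exec (.fadd acc a)
  let isZero ← exec (.fzero total)
  pure (!isZero)

/-- One round: random partition with `v₀ ∈ V₁`, circuit, test. -/
def trial [Zero F] (k r s : ℕ) (v₀ : Fin n) : Prog n F Bool := do
  let V₁ ← tabulate true (List.finRange n) fun v => if v = v₀ then pure true else exec .coin
  let C ← buildCircuit k r s v₀ V₁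
  phiTest r s C

def powTwo (e : ℕ) : Prog n F ℕ := fold (List.range e) 1 fun a _ => exec (.arith .mul 2 a)

/-- The binomial coefficient `a choose b`. -/
def binomial (a b : ℕ) : Prog n F ℕ :=
  fold (List.range b) 1 fun c i => do
    let d ← exec (.arith .sub a i)
    let p ← exec (.arith .mul c d)
    let i' ← exec (.arith .add i 1)
    exec (.arith .div p i')

/-- The number of rounds for each start vertex, the integer part of
`2 ^ (k + 1) / ((r choose k - r - s + 1) * (k - r choose s))`. -/
def rounds (k r s : ℕ) : Prog n F ℕ := do
  let k' ← exec (.arith .add k 1)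
  let p ← powTwo k'
  let d ← exec (.arith .sub k' r)
  let t ← exec (.arith .sub d s)
  let b₁ ← binomial r t
  let d' ← exec (.arith .sub k r)
  let b₂ ← binomial d' s
  let b ← exec (.arith .mul b₁ b₂)
  exec (.arith .div p b)

/-- The algorithm `Hamiltonian(G, k, r, s)`; `true` is the answer YES. -/
def hamiltonian [Zero F] (n k r s : ℕ) : Prog n F Bool := do
  exec .setup
  let T ← rounds k r s
  anyOf (List.finRange n) fun v₀ =>
    anyOf (List.range T) fun _ => trial k r s v₀

/-- The algorithm for the undirected `k`-path problem: answer NO if there are not more than `k`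
vertices; otherwise run `Hamiltonian(G, k, r, s)` with `r = ⌊0.5 k⌋` and `s = ⌊0.208 k⌋`
(with `r = k + 1` and `s = 0` for the finitely many `k < 10`, where the binomial coefficients of the
former choice may vanish). -/
def kPath [Zero F] (n k : ℕ) : Prog n F Bool := do
  let b ← exec (.arith .lt k n)
  if b = 0 then pure false
  else if k < 10 then hamiltonian n k (k + 1) 0
  else hamiltonian n k (k / 2) (208 * k / 1000)

end Algorithm

/-- Bit length of the field elements used for paths of length `k`: the field has more than
`4 * (2 * k + 1)` elements. -/
def fieldBits (k : ℕ) : ℕ := Nat.size (4 * (2 * k + 1))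

/-- Distribution of answer and running time of `Hamiltonian(G, k, r, s)`. -/
noncomputable def runHamiltonian {n : ℕ} (G : SimpleGraph (Fin n)) (k r s : ℕ) : PMF (Bool × ℕ) :=
  Prog.run (m := fieldBits k) G (hamiltonian n k r s)

/-- Distribution of answer and running time of the `k`-path algorithm. -/
noncomputable def runKPath {n : ℕ} (G : SimpleGraph (Fin n)) (k : ℕ) : PMF (Bool × ℕ) :=
  Prog.run (m := fieldBits k) G (kPath n k)

/-- `G` contains a simple path with `k` edges. -/
def HasSimplePath {n : ℕ} (G : SimpleGraph (Fin n)) (k : ℕ) : Prop :=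
  ∃ (u v : Fin n) (p : G.Walk u v), p.IsPath ∧ p.length = k

/-- The parameters for which the number of rounds is defined: the binomial coefficients
`r choose k - r - s + 1` and `k - r choose s` are nonzero.  (The first one vanishes when
`k - r - s + 1` is negative; for `r = k + 1`, `s = 0` the second one is `-1 choose 0 = 1`.) -/
def Admissible (k r s : ℕ) : Prop :=
  r + s ≤ k + 1 ∧ r.choose (k + 1 - r - s) ≠ 0 ∧ (k - r).choose s ≠ 0

/-- Every possible execution takes time at most `B`. -/
def RunsInTime {α : Type} (D : PMF (α × ℕ)) (B : ℝ) : Prop :=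
  ∀ o ∈ D.support, (o.2 : ℝ) ≤ B

/-- The probability that the answer is `b`. -/
noncomputable def answerProb (D : PMF (Bool × ℕ)) (b : Bool) : ENNReal :=
  (D.map Prod.fst) b

end KPath

namespace KPath

/-! ## Semantics of programs -/

section Semantics

open Prog

variable {n m : ℕ} {G : SimpleGraph (Fin n)} {α β ι σ : Type}

/-! The heart is a cancellation in characteristic two. Summing a product of linear forms over all
subsets of a set of labels gives zero when there are fewer factors than labels. It also gives zero
when there are as many factors as labels and two of them coincide, because their product is a square
and squaring is additive (`sieve_eq_zero_of_eq`). A legitimate walk has exactly `r` visits to `V₁`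
and `s` edges in `E₂`, as many as there are labels, so `φ` removes every walk that repeats a vertex
of `V₁` or an edge of `E₂`.

In a remaining walk that is not simple, the first repeated vertex lies in `V₂`. Reversing the closed
segment between its first and last visit permutes the edges and the vertices of the walk, so the new
walk is legitimate and contributes the same. This is an involution. It has no fixed point: the
centre of a palindromic segment is either a pair of equal consecutive vertices, which is impossible,
or a turn `u, v, u`. With `u` in `V₁` the turn repeats a vertex of `V₁`, with `u` and `v` in `V₂` it
repeats an edge of `E₂`, and with `u` in `V₂` and `v` in `V₁` it is not legitimate. Hence only
simple paths survive in `φ f` (`sum_sieveWeight_eq`), and a graph without simple `k`-paths is never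
accepted.

Conversely, a simple path from a fixed `v₀` is determined by its edges. Setting the variables `x` to
the indicator of these edges isolates it, and suitable `y`, `z` make its sieve equal to one
(`exists_phi_eq_one`). So `φ f` is a nonzero polynomial of degree at most `2k + 1` over a field with
more than `4(2k + 1)` elements, and the random evaluation misses it with probability at most `1/4`
(`dist_phiTest_le`).

With `B = (r choose k-r-s+1) * (k-r choose s)`, a given path is legitimate for a fraction of at
least `B / 2^k` of the partitions, by counting patterns (`le_patternCount`). A round thus succeeds
with probability at least `3B / 2^(k+2)`, and `T ≥ 2^k / B` rounds push the failure below `exp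
(-3/4) < 1/2`. A round costs `2^(r+s)` evaluations of a circuit of polynomial size, built by a
recursion on the last vertex (`walkSum_succ`), which gives the time bound. For the special `r` and
`s` both binomial coefficients are estimated by entropy with the frequencies `0.416` and `0.584`,
and the base becomes `2^1.708 * 0.416^0.416 * 0.584^0.584 ≤ 1.657` (`base_le`). -/

theorem Prog.run_bind (p : Prog n (GaloisField 2 m) α) (f : α → Prog n (GaloisField 2 m) β) :
    (p >>= f).run G =
      (p.run G).bind fun o => ((f o.1).run G).map fun o' => (o'.1, o.2 + o'.2) := by
  change (p.bind f).run G = _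
  induction p with
  | ret a =>
    simp only [Prog.bind, Prog.run, PMF.pure_bind, zero_add]
    exact (PMF.map_id _).symm
  | step i k ih =>
    simp only [Prog.bind, Prog.run, ih, PMF.bind_bind, PMF.map_bind, PMF.bind_map]
    congr 1; funext b; congr 1; funext o
    simp only [PMF.map_comp, Function.comp_def, add_assoc]

theorem Prog.run_pure (a : α) :
    (pure a : Prog n (GaloisField 2 m) α).run G = PMF.pure (a, 0) := rfl

/-- Every possible result of `p` has the property `Q`. -/
def Prog.Ensures (G : SimpleGraph (Fin n)) (p : Prog n (GaloisField 2 m) α) (Q : α → Prop) : Prop :=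
  ∀ o ∈ (p.run G).support, Q o.1

/-- Every possible execution of `p` takes time at most `B`. -/
def Prog.TimeLe (G : SimpleGraph (Fin n)) (p : Prog n (GaloisField 2 m) α) (B : ℕ) : Prop :=
  ∀ o ∈ (p.run G).support, o.2 ≤ B

/-- The distribution of the result of `p`. -/
noncomputable def Prog.dist (G : SimpleGraph (Fin n)) (p : Prog n (GaloisField 2 m) α) : PMF α :=
  (p.run G).map Prod.fst

theorem Prog.dist_bind (p : Prog n (GaloisField 2 m) α) (f : α → Prog n (GaloisField 2 m) β) :
    (p >>= f).dist G = (p.dist G).bind fun a => (f a).dist G := by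
  simp only [Prog.dist, Prog.run_bind, PMF.map_bind, PMF.bind_map, PMF.map_comp,
    Function.comp_def]

theorem Prog.dist_pure (a : α) : (pure a : Prog n (GaloisField 2 m) α).dist G = PMF.pure a := by
  simp [Prog.dist, Prog.run_pure, PMF.pure_map]

theorem Prog.dist_exec (i : Instr n (GaloisField 2 m) β) : (exec i).dist G = i.sem G := by
  simp only [Prog.dist, exec, Prog.run, PMF.map_bind, PMF.pure_map]
  exact PMF.bind_pure _

theorem Prog.ensures_iff {p : Prog n (GaloisField 2 m) α} {Q : α → Prop} :
    p.Ensures G Q ↔ ∀ a ∈ (p.dist G).support, Q a := by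
  simp only [Prog.Ensures, Prog.dist, PMF.mem_support_map_iff]
  exact ⟨fun h a ⟨o, ho, e⟩ => e ▸ h o ho, fun h o ho => h _ ⟨o, ho, rfl⟩⟩

theorem Prog.Ensures.mono {p : Prog n (GaloisField 2 m) α} {Q Q' : α → Prop} (h : p.Ensures G Q)
    (hQ : ∀ a, Q a → Q' a) : p.Ensures G Q' := fun o ho => hQ _ (h o ho)

theorem Prog.ensures_pure {a : α} {Q : α → Prop} (h : Q a) :
    (pure a : Prog n (GaloisField 2 m) α).Ensures G Q := by
  rw [Prog.ensures_iff, Prog.dist_pure]; simpa using h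

theorem Prog.Ensures.bind {p : Prog n (GaloisField 2 m) α} {f : α → Prog n (GaloisField 2 m) β}
    {Q : α → Prop} {Q' : β → Prop} (hp : p.Ensures G Q) (hf : ∀ a, Q a → (f a).Ensures G Q') :
    (p >>= f).Ensures G Q' := by
  rw [Prog.ensures_iff] at *
  rw [Prog.dist_bind]
  intro b hb
  obtain ⟨a, ha, hb⟩ := (PMF.mem_support_bind_iff _ _ _).1 hb
  exact Prog.ensures_iff.1 (hf a (hp a ha)) b hb

theorem Prog.ensures_true (p : Prog n (GaloisField 2 m) α) : p.Ensures G fun _ => True :=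
  fun _ _ => trivial

theorem Prog.ensures_exec {i : Instr n (GaloisField 2 m) β} {Q : β → Prop}
    (h : ∀ b ∈ (i.sem G).support, Q b) : (exec i).Ensures G Q := by
  rwa [Prog.ensures_iff, Prog.dist_exec]

theorem Prog.ensures_tick : (exec (.tick : Instr n (GaloisField 2 m) Unit)).Ensures G fun _ => True :=
  ensures_true _

theorem Prog.ensures_adj (u v : Fin n) :
    (exec (.adj u v : Instr n (GaloisField 2 m) Bool)).Ensures G fun b => b = true ↔ G.Adj u v :=
  ensures_exec fun b hb => by
    simp only [Instr.sem, PMF.support_pure, Set.mem_singleton_iff] at hb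
    simp [hb]

theorem Prog.ensures_arith (op : ArithOp) (a b : ℕ) :
    (exec (.arith op a b : Instr n (GaloisField 2 m) ℕ)).Ensures G fun c => c = op.eval a b :=
  ensures_exec fun b hb => by simpa [Instr.sem] using hb

theorem Prog.ensures_fadd (a b : GaloisField 2 m) :
    (exec (.fadd a b : Instr n (GaloisField 2 m) _)).Ensures G fun c => c = a + b :=
  ensures_exec fun b hb => by simpa [Instr.sem] using hb

theorem Prog.ensures_fmul (a b : GaloisField 2 m) :
    (exec (.fmul a b : Instr n (GaloisField 2 m) _)).Ensures G fun c => c = a * b :=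
  ensures_exec fun b hb => by simpa [Instr.sem] using hb

theorem Prog.ensures_fzero (a : GaloisField 2 m) :
    (exec (.fzero a : Instr n (GaloisField 2 m) _)).Ensures G fun b => b = true ↔ a = 0 :=
  ensures_exec fun b hb => by
    simp only [Instr.sem, PMF.support_pure, Set.mem_singleton_iff] at hb
    simp [hb]

/-- A program with only one possible result. -/
theorem Prog.Ensures.dist_eq {p : Prog n (GaloisField 2 m) α} {a : α}
    (h : p.Ensures G fun b => b = a) : p.dist G = PMF.pure a := by
  rw [Prog.ensures_iff] at h
  have hs : (p.dist G).support = {a} :=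
    ((p.dist G).support_nonempty.subset_singleton_iff).1 fun b hb => h b hb
  ext b
  by_cases hb : b = a
  · subst hb
    rw [PMF.pure_apply_self, (PMF.apply_eq_one_iff _ _).2 hs]
  · rw [PMF.pure_apply_of_ne _ _ hb, PMF.apply_eq_zero_iff, hs]
    simpa using hb

theorem Prog.TimeLe.mono {p : Prog n (GaloisField 2 m) α} {B B' : ℕ} (h : p.TimeLe G B)
    (hB : B ≤ B') : p.TimeLe G B' := fun o ho => (h o ho).trans hB

theorem Prog.timeLe_pure (a : α) (B : ℕ) :
    (pure a : Prog n (GaloisField 2 m) α).TimeLe G B := by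
  intro o ho
  have : o = (a, 0) := by simpa [Prog.run_pure] using ho
  simp [this]

/-- The continuation needs a time bound only for values that can occur. This matters where the cost
depends on the value: the length of the circuit, the number of rounds, the size of intermediate
integers. -/
theorem Prog.TimeLe.bind_of_ensures {p : Prog n (GaloisField 2 m) α}
    {f : α → Prog n (GaloisField 2 m) β} {Q : α → Prop} {B B' : ℕ} (hp : p.TimeLe G B)
    (hQ : p.Ensures G Q) (hf : ∀ a, Q a → (f a).TimeLe G B') : (p >>= f).TimeLe G (B + B') := by
  intro o ho
  rw [Prog.run_bind] at ho
  obtain ⟨o₁, h₁, ho⟩ := (PMF.mem_support_bind_iff _ _ _).1 ho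
  obtain ⟨o₂, h₂, rfl⟩ := (PMF.mem_support_map_iff _ _ _).1 ho
  exact Nat.add_le_add (hp o₁ h₁) (hf _ (hQ o₁ h₁) o₂ h₂)

theorem Prog.TimeLe.bind {p : Prog n (GaloisField 2 m) α}
    {f : α → Prog n (GaloisField 2 m) β} {B B' : ℕ} (hp : p.TimeLe G B)
    (hf : ∀ a, (f a).TimeLe G B') : (p >>= f).TimeLe G (B + B') :=
  hp.bind_of_ensures (ensures_true p) fun a _ => hf a

theorem Prog.timeLe_exec {i : Instr n (GaloisField 2 m) β} {B : ℕ} (h : i.cost m ≤ B) :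
    (exec i).TimeLe G B := by
  intro o ho
  simp only [exec, Prog.run] at ho
  obtain ⟨b, _, ho⟩ := (PMF.mem_support_bind_iff _ _ _).1 ho
  obtain ⟨o', h', rfl⟩ := (PMF.mem_support_map_iff _ _ _).1 ho
  have : o' = (b, 0) := by simpa using h'
  subst this
  simpa using h

theorem Prog.timeLe_tick :
    (exec (.tick : Instr n (GaloisField 2 m) Unit)).TimeLe G 1 := timeLe_exec le_rfl

/-! ### Loops -/

theorem Prog.fold_cons (i : ι) (l : List ι) (a : σ) (f : σ → ι → Prog n (GaloisField 2 m) σ) :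
    fold (i :: l) a f = exec .tick >>= fun _ => f a i >>= fun a' => fold l a' f := rfl

theorem Prog.collect_cons (i : ι) (l : List ι) (f : ι → Prog n (GaloisField 2 m) (List β)) :
    collect (i :: l) f = exec .tick >>= fun _ => f i >>= fun b =>
      collect l f >>= fun bs => pure (b ++ bs) := rfl

theorem Prog.tabulate_cons [DecidableEq ι] (d : β) (i : ι) (l : List ι)
    (f : ι → Prog n (GaloisField 2 m) β) :
    tabulate d (i :: l) f = exec .tick >>= fun _ => f i >>= fun b =>
      tabulate d l f >>= fun t => pure (Function.update t i b) := rfl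

theorem Prog.anyOf_cons (i : ι) (l : List ι) (f : ι → Prog n (GaloisField 2 m) Bool) :
    anyOf (i :: l) f = exec .tick >>= fun _ => f i >>= fun b =>
      if b then pure true else anyOf l f := rfl

theorem Prog.ensures_fold {f : σ → ι → Prog n (GaloisField 2 m) σ} {g : σ → ι → σ}
    (h : ∀ a i, (f a i).Ensures G fun b => b = g a i) (l : List ι) (a : σ) :
    (fold l a f).Ensures G fun b => b = l.foldl g a := by
  induction l generalizing a with
  | nil => exact ensures_pure rfl
  | cons i l ih =>
    rw [fold_cons]
    refine ensures_tick.bind fun _ _ => (h a i).bind fun b hb => ?_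
    subst hb; exact ih _

theorem Prog.ensures_tabulate [DecidableEq ι] {d : β} {f : ι → Prog n (GaloisField 2 m) β}
    {Q : ι → β → Prop} (h : ∀ i, (f i).Ensures G (Q i)) (l : List ι) :
    (tabulate d l f).Ensures G fun t => ∀ i ∈ l, Q i (t i) := by
  induction l with
  | nil => exact ensures_pure (by simp)
  | cons i l ih =>
    rw [tabulate_cons]
    refine ensures_tick.bind fun _ _ => (h i).bind fun b hb => ih.bind fun t ht => ensures_pure ?_
    intro j hj
    by_cases hji : j = i
    · subst hji; simpa using hb
    · rw [Function.update_of_ne hji]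
      exact ht j ((List.mem_cons.1 hj).resolve_left hji)

theorem Prog.ensures_anyOf_false {f : ι → Prog n (GaloisField 2 m) Bool}
    (h : ∀ i, (f i).Ensures G fun b => b = false) (l : List ι) :
    (anyOf l f).Ensures G fun b => b = false := by
  induction l with
  | nil => exact ensures_pure rfl
  | cons i l ih =>
    rw [anyOf_cons]
    refine ensures_tick.bind fun _ _ => (h i).bind fun b hb => ?_
    subst hb; exact ih

theorem Prog.ensures_collect_length {f : ι → Prog n (GaloisField 2 m) (List β)} {L : ℕ}
    (h : ∀ i, (f i).Ensures G fun b => b.length ≤ L) (l : List ι) :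
    (collect l f).Ensures G fun b => b.length ≤ l.length * L := by
  induction l with
  | nil => exact ensures_pure (by simp)
  | cons i l ih =>
    rw [collect_cons]
    refine ensures_tick.bind fun _ _ => (h i).bind fun b hb => ih.bind fun bs hbs =>
      ensures_pure ?_
    simp only [List.length_append, List.length_cons]
    linarith

/-- Running time of a loop with an invariant that depends on the remaining iterations. -/
theorem Prog.timeLe_fold_of_invariant {f : σ → ι → Prog n (GaloisField 2 m) σ} {B : ℕ}
    (Inv : List ι → σ → Prop) (l : List ι) (a : σ) (ha : Inv l a)
    (hI : ∀ i l a, Inv (i :: l) a → (f a i).Ensures G (Inv l))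
    (hB : ∀ i l a, Inv (i :: l) a → (f a i).TimeLe G B) :
    (fold l a f).TimeLe G (l.length * (B + 1)) := by
  induction l generalizing a with
  | nil => exact timeLe_pure _ _
  | cons i l ih =>
    rw [fold_cons]
    refine (timeLe_tick.bind fun _ =>
      (hB i l a ha).bind_of_ensures (hI i l a ha) fun b hb => ih b hb).mono ?_
    simp only [List.length_cons]; linarith

theorem Prog.timeLe_fold {f : σ → ι → Prog n (GaloisField 2 m) σ} {B : ℕ} {l : List ι}
    (h : ∀ a, ∀ i ∈ l, (f a i).TimeLe G B) (a : σ) :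
    (fold l a f).TimeLe G (l.length * (B + 1)) :=
  -- The invariant remembers only that the remaining indices come from `l`, so the bound on the body
  -- is needed for those indices alone.
  timeLe_fold_of_invariant (fun l' _ => l' ⊆ l) l a (List.Subset.refl l)
    (fun _ _ _ h' => (ensures_true _).mono fun _ _ => (List.cons_subset.1 h').2)
    fun i _ a h' => h a i (List.cons_subset.1 h').1

theorem Prog.timeLe_collect {f : ι → Prog n (GaloisField 2 m) (List β)} {B : ℕ}
    (h : ∀ i, (f i).TimeLe G B) (l : List ι) :
    (collect l f).TimeLe G (l.length * (B + 1)) := by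
  induction l with
  | nil => exact timeLe_pure _ _
  | cons i l ih =>
    rw [collect_cons]
    refine (timeLe_tick.bind fun _ => (h i).bind fun b => ih.bind fun _ => timeLe_pure _ 0).mono ?_
    simp only [List.length_cons]; linarith

theorem Prog.timeLe_tabulate [DecidableEq ι] {d : β} {f : ι → Prog n (GaloisField 2 m) β} {B : ℕ}
    (h : ∀ i, (f i).TimeLe G B) (l : List ι) :
    (tabulate d l f).TimeLe G (l.length * (B + 1)) := by
  induction l with
  | nil => exact timeLe_pure _ _
  | cons i l ih =>
    rw [tabulate_cons]
    refine (timeLe_tick.bind fun _ => (h i).bind fun b => ih.bind fun _ => timeLe_pure _ 0).mono ?_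
    simp only [List.length_cons]; linarith

theorem Prog.timeLe_anyOf {f : ι → Prog n (GaloisField 2 m) Bool} {B : ℕ}
    (h : ∀ i, (f i).TimeLe G B) (l : List ι) :
    (anyOf l f).TimeLe G (l.length * (B + 1)) := by
  induction l with
  | nil => exact timeLe_pure _ _
  | cons i l ih =>
    rw [anyOf_cons]
    refine (timeLe_tick.bind fun _ => (h i).bind fun b => ?_).mono
      (B := 1 + (B + l.length * (B + 1))) ?_
    · cases b
      · exact ih
      · exact timeLe_pure _ _
    · simp only [List.length_cons]; linarith

/-! ### Distributions of loops -/

theorem Prog.dist_tick_bind (f : Unit → Prog n (GaloisField 2 m) β) :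
    (exec (.tick : Instr n (GaloisField 2 m) Unit) >>= f).dist G = (f ()).dist G := by
  rw [dist_bind, dist_exec]
  exact PMF.pure_bind _ _

/-- The loop halts at the first `true`, so `false` requires every call to return `false`. The calls
use independent random bits, hence the product. -/
theorem Prog.dist_anyOf_false (f : ι → Prog n (GaloisField 2 m) Bool) (l : List ι) :
    (anyOf l f).dist G false = (l.map fun i => (f i).dist G false).prod := by
  induction l with
  | nil => simp [anyOf, dist_pure]
  | cons i l ih =>
    rw [anyOf_cons, dist_tick_bind, dist_bind, PMF.bind_apply, tsum_bool]
    simp [ih, dist_pure]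

open scoped Classical in
/-- The entries of an array are independent. -/
theorem Prog.dist_tabulate [DecidableEq ι] (d : β)
    (f : ι → Prog n (GaloisField 2 m) β) {l : List ι} (hl : l.Nodup) (g : ι → β) :
    (tabulate d l f).dist G g =
      if ∀ i, i ∉ l → g i = d then (l.map fun i => (f i).dist G (g i)).prod else 0 := by
  induction l generalizing g with
  | nil =>
    have : (g = fun _ => d) ↔ ∀ i, g i = d := funext_iff
    simp [tabulate, dist_pure, PMF.pure_apply, this]
  | cons i l ih =>
    obtain ⟨hi, hl⟩ := List.nodup_cons.1 hl
    rw [tabulate_cons, dist_tick_bind, dist_bind, PMF.bind_apply, tsum_eq_single (g i)]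
    -- Only one array for the remaining indices `l` can lead to `g`: since `i ∉ l`, it still has the
    -- default value `d` at `i`.
    · rw [dist_bind, PMF.bind_apply, tsum_eq_single (Function.update g i d)]
      · rw [dist_pure, Function.update_idem, Function.update_eq_self, PMF.pure_apply_self, mul_one,
          ih hl]
        have h₁ : (∀ j, j ∉ l → Function.update g i d j = d) ↔ ∀ j, j ∉ i :: l → g j = d := by
          refine forall_congr' fun j => ?_
          by_cases hj : j = i
          · subst hj; simp
          · simp [hj]
        have h₂ : (l.map fun j => (f j).dist G (Function.update g i d j)) =
            l.map fun j => (f j).dist G (g j) :=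
          List.map_congr_left fun j hj => by
            rw [Function.update_of_ne (fun e : j = i => hi (e ▸ hj))]
        simp only [h₁, h₂, List.map_cons, List.prod_cons]
        split_ifs <;> simp
      · intro t ht
        rw [dist_pure, PMF.pure_apply]
        split_ifs with hg
        · rw [ih hl, if_neg, zero_mul]
          intro h
          apply ht
          rw [hg, Function.update_idem, eq_comm, Function.update_eq_self_iff]
          exact (h i hi).symm
        · simp
    · intro b hb
      rw [dist_bind, PMF.bind_apply]
      simp only [dist_pure, PMF.pure_apply]
      rw [ENNReal.tsum_eq_zero.2, mul_zero]
      intro t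
      rw [if_neg, mul_zero]
      intro h
      exact hb (by rw [h]; simp)

theorem Prog.dist_tabulate_of_complete [DecidableEq ι] [Fintype ι] (d : β)
    (f : ι → Prog n (GaloisField 2 m) β) {l : List ι} (hl : l.Nodup) (hc : ∀ i, i ∈ l) (g : ι → β) :
    (tabulate d l f).dist G g = ∏ i, (f i).dist G (g i) := by
  rw [dist_tabulate d f hl g, if_pos fun i hi => absurd (hc i) hi]
  have : (Finset.univ : Finset ι) = l.toFinset := by ext i; simp [hc i]
  rw [this, List.prod_toFinset _ hl]

end Semantics

/-! ## Legitimate walks -/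

section Walks

variable {V : Type} {k : ℕ}

/-- The sequence `p 0, …, p k`, continued by `p k`. -/
def extend (p : Fin (k + 1) → V) (t : ℕ) : V := p ⟨min t k, by omega⟩

theorem extend_snoc_of_le (p : Fin (k + 1) → V) (u : V) {t : ℕ} (ht : t ≤ k) :
    extend (Fin.snoc p u : Fin (k + 1 + 1) → V) t = extend p t := by
  have h : min t (k + 1) < k + 1 := by omega
  simp only [extend, Fin.snoc, h, dif_pos, cast_eq]
  congr 1
  ext
  simp only [Fin.val_castLT]
  omega

theorem extend_snoc_last (p : Fin (k + 1) → V) (u : V) :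
    extend (Fin.snoc p u : Fin (k + 1 + 1) → V) (k + 1) = u := by
  simp [extend, Fin.snoc]

theorem sum_eq_sum_snoc {R : Type} [AddCommMonoid R] [Fintype V] [DecidableEq V]
    (g : (Fin (k + 1 + 1) → V) → R) :
    ∑ p, g p = ∑ q : Fin (k + 1) → V, ∑ u, g (Fin.snoc q u) := by
  rw [← (Fin.snocEquiv fun _ : Fin (k + 1 + 1) => V).sum_comp, Fintype.sum_prod_type,
    Finset.sum_comm]
  rfl

end Walks

section Legit

variable {n : ℕ}

/-- The indices of the vertices in `V₁`. -/
def firstIdx {V : Type} (V₁ : V → Bool) (k : ℕ) (p : ℕ → V) : Finset ℕ :=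
  (Finset.range (k + 1)).filter fun t => V₁ (p t) = true

/-- The indices of the edges in `E₂`. -/
def secondIdx {V : Type} (V₁ : V → Bool) (k : ℕ) (p : ℕ → V) : Finset ℕ :=
  (Finset.range k).filter fun t => V₁ (p t) = false ∧ V₁ (p (t + 1)) = false

/-- `p 0, …, p k` is an `(r, s)`-legitimate walk from `v₀`. -/
structure IsLegit (G : SimpleGraph (Fin n)) (V₁ : Fin n → Bool) (v₀ : Fin n) (k r s : ℕ)
    (p : ℕ → Fin n) : Prop where
  start : p 0 = v₀
  adj : ∀ t < k, G.Adj (p t) (p (t + 1))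
  card_first : (firstIdx V₁ k p).card = r
  card_second : (secondIdx V₁ k p).card = s
  no_return : ∀ t, t + 2 ≤ k → p (t + 2) = p t → V₁ (p t) = false → V₁ (p (t + 1)) = false

variable {R : Type} [CommSemiring R]

/-- The monomial of the walk `p 0, …, p k`. -/
def weight (V₁ : Fin n → Bool) (ρ : Var n → R) (k : ℕ) (p : ℕ → Fin n) : R :=
  (∏ t ∈ Finset.range k, ρ (.x s(p t, p (t + 1)))) * (∏ t ∈ firstIdx V₁ k p, ρ (.y (p t))) *
    ∏ t ∈ secondIdx V₁ k p, ρ (.z s(p t, p (t + 1)))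

theorem firstIdx_congr {V : Type} {V₁ : V → Bool} {k : ℕ} {p q : ℕ → V} (h : ∀ t ≤ k, p t = q t) :
    firstIdx V₁ k p = firstIdx V₁ k q :=
  Finset.filter_congr fun t ht => by rw [h t (by simpa [Nat.lt_succ_iff] using ht)]

theorem secondIdx_congr {V : Type} {V₁ : V → Bool} {k : ℕ} {p q : ℕ → V} (h : ∀ t ≤ k, p t = q t) :
    secondIdx V₁ k p = secondIdx V₁ k q :=
  Finset.filter_congr fun t ht => by
    have := Finset.mem_range.1 ht
    rw [h t (by omega), h (t + 1) (by omega)]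

theorem firstIdx_succ {V : Type} (V₁ : V → Bool) (k : ℕ) (p : ℕ → V) :
    firstIdx V₁ (k + 1) p =
      if V₁ (p (k + 1)) then insert (k + 1) (firstIdx V₁ k p) else firstIdx V₁ k p := by
  rw [firstIdx, Finset.range_add_one, Finset.filter_insert]; rfl

theorem secondIdx_succ {V : Type} (V₁ : V → Bool) (k : ℕ) (p : ℕ → V) :
    secondIdx V₁ (k + 1) p =
      if V₁ (p k) = false ∧ V₁ (p (k + 1)) = false then insert k (secondIdx V₁ k p)
      else secondIdx V₁ k p := by
  rw [secondIdx, Finset.range_add_one, Finset.filter_insert]; rfl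

theorem card_firstIdx_succ {V : Type} (V₁ : V → Bool) (k : ℕ) (p : ℕ → V) :
    (firstIdx V₁ (k + 1) p).card =
      (firstIdx V₁ k p).card + if V₁ (p (k + 1)) then 1 else 0 := by
  rw [firstIdx_succ]
  split_ifs
  · exact Finset.card_insert_of_notMem (by simp [firstIdx])
  · rfl

theorem card_secondIdx_succ {V : Type} (V₁ : V → Bool) (k : ℕ) (p : ℕ → V) :
    (secondIdx V₁ (k + 1) p).card = (secondIdx V₁ k p).card +
      if V₁ (p k) = false ∧ V₁ (p (k + 1)) = false then 1 else 0 := by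
  rw [secondIdx_succ]
  split_ifs
  · exact Finset.card_insert_of_notMem (by simp [secondIdx])
  · rfl

theorem weight_succ (V₁ : Fin n → Bool) (ρ : Var n → R) (k : ℕ) (p : ℕ → Fin n) :
    weight V₁ ρ (k + 1) p = weight V₁ ρ k p * (ρ (.x s(p k, p (k + 1))) *
      (if V₁ (p (k + 1)) then ρ (.y (p (k + 1))) else 1) *
      (if V₁ (p k) = false ∧ V₁ (p (k + 1)) = false then ρ (.z s(p k, p (k + 1))) else 1)) := by
  have h₁ : ∏ t ∈ firstIdx V₁ (k + 1) p, ρ (.y (p t)) = (∏ t ∈ firstIdx V₁ k p, ρ (.y (p t))) *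
      if V₁ (p (k + 1)) then ρ (.y (p (k + 1))) else 1 := by
    rw [firstIdx_succ]
    split_ifs
    · rw [Finset.prod_insert (by simp [firstIdx]), mul_comm]
    · rw [mul_one]
  have h₂ : ∏ t ∈ secondIdx V₁ (k + 1) p, ρ (.z s(p t, p (t + 1))) =
      (∏ t ∈ secondIdx V₁ k p, ρ (.z s(p t, p (t + 1)))) *
        if V₁ (p k) = false ∧ V₁ (p (k + 1)) = false then ρ (.z s(p k, p (k + 1))) else 1 := by
    rw [secondIdx_succ]
    split_ifs
    · rw [Finset.prod_insert (by simp [secondIdx]), mul_comm]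
    · rw [mul_one]
  simp only [weight]
  rw [h₁, h₂, Finset.prod_range_succ]
  ring

theorem weight_congr {V₁ : Fin n → Bool} {ρ : Var n → R} {k : ℕ} {p q : ℕ → Fin n}
    (h : ∀ t ≤ k, p t = q t) : weight V₁ ρ k p = weight V₁ ρ k q := by
  simp only [weight, ← firstIdx_congr h, ← secondIdx_congr h]
  congr 1
  · congr 1
    · refine Finset.prod_congr rfl fun t ht => ?_
      have := Finset.mem_range.1 ht
      rw [h t (by omega), h (t + 1) (by omega)]
    · refine Finset.prod_congr rfl fun t ht => ?_
      have := Finset.mem_range.1 (Finset.mem_filter.1 ht).1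
      rw [h t (by omega)]
  · refine Finset.prod_congr rfl fun t ht => ?_
    have := Finset.mem_range.1 (Finset.mem_filter.1 ht).1
    rw [h t (by omega), h (t + 1) (by omega)]

theorem IsLegit.congr {G : SimpleGraph (Fin n)} {V₁ : Fin n → Bool} {v₀ : Fin n} {k r s : ℕ}
    {p q : ℕ → Fin n} (hp : IsLegit G V₁ v₀ k r s p) (h : ∀ t ≤ k, p t = q t) :
    IsLegit G V₁ v₀ k r s q where
  start := by rw [← h 0 (by omega), hp.start]
  adj t ht := by rw [← h t (by omega), ← h (t + 1) (by omega)]; exact hp.adj t ht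
  card_first := by rw [← firstIdx_congr h, hp.card_first]
  card_second := by rw [← secondIdx_congr h, hp.card_second]
  no_return t ht := by
    rw [← h t (by omega), ← h (t + 1) (by omega), ← h (t + 2) (by omega)]
    exact hp.no_return t ht

theorem isLegit_congr {G : SimpleGraph (Fin n)} {V₁ : Fin n → Bool} {v₀ : Fin n} {k r s : ℕ}
    {p q : ℕ → Fin n} (h : ∀ t ≤ k, p t = q t) :
    IsLegit G V₁ v₀ k r s p ↔ IsLegit G V₁ v₀ k r s q :=
  ⟨fun hp => hp.congr h, fun hq => hq.congr fun t ht => (h t ht).symm⟩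

/-- The step of the dynamic programming. Appending a vertex changes the two counts according to the
last two vertices and adds one turn, at the last three vertices. Writing the increments on the left
avoids subtraction, and `1 ≤ k` makes `p (k - 1)` the vertex before `p k`. -/
theorem isLegit_succ_iff {G : SimpleGraph (Fin n)} {V₁ : Fin n → Bool} {v₀ : Fin n} {k r s : ℕ}
    {p : ℕ → Fin n} (hk : 1 ≤ k) :
    IsLegit G V₁ v₀ (k + 1) (r + if V₁ (p (k + 1)) then 1 else 0)
        (s + if V₁ (p k) = false ∧ V₁ (p (k + 1)) = false then 1 else 0) p ↔
      IsLegit G V₁ v₀ k r s p ∧ G.Adj (p k) (p (k + 1)) ∧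
        (V₁ (p k) = true ∧ V₁ (p (k + 1)) = false → p (k - 1) ≠ p (k + 1)) := by
  obtain ⟨j, rfl⟩ : ∃ j, k = j + 1 := ⟨k - 1, by omega⟩
  constructor
  · intro h
    refine ⟨⟨h.start, fun t ht => h.adj t (by omega), ?_, ?_,
      fun t ht => h.no_return t (by omega)⟩, h.adj _ (by omega), ?_⟩
    · have := h.card_first
      rw [card_firstIdx_succ] at this
      omega
    · have := h.card_second
      rw [card_secondIdx_succ] at this
      omega
    · rintro ⟨h₁, h₂⟩ he
      simp only [Nat.add_sub_cancel] at he
      have := h.no_return j le_rfl he.symm (he ▸ h₂)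
      simp [h₁] at this
  · rintro ⟨h, ha, hr⟩
    refine ⟨h.start, fun t ht => ?_, ?_, ?_, fun t ht he hf => ?_⟩
    · rcases Nat.lt_succ_iff_lt_or_eq.1 ht with ht | rfl
      · exact h.adj t ht
      · exact ha
    · rw [card_firstIdx_succ, h.card_first]
    · rw [card_secondIdx_succ, h.card_second]
    · rcases Nat.lt_or_ge t j with ht' | ht'
      · exact h.no_return t (by omega) he hf
      · obtain rfl : t = j := by omega
        by_contra hc
        exact hr ⟨by simpa using hc, by rw [← hf, ← he]⟩ (by simpa using he.symm)

open Classical in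
/-- The sum of the monomials of all `(r, s)`-legitimate walks of length `k` from `v₀` whose last two
vertices are `u₁, u₂`. -/
noncomputable def walkSum (G : SimpleGraph (Fin n)) (V₁ : Fin n → Bool) (v₀ : Fin n) (ρ : Var n → R)
    (k r s : ℕ) (u₁ u₂ : Fin n) : R :=
  ∑ p : Fin (k + 1) → Fin n,
    if IsLegit G V₁ v₀ k r s (extend p) ∧ extend p (k - 1) = u₁ ∧ extend p k = u₂ then
      weight V₁ ρ k (extend p) else 0

variable {G : SimpleGraph (Fin n)} {V₁ : Fin n → Bool} {v₀ : Fin n} {ρ : Var n → R}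

theorem walkSum_of_not_adj {k r s : ℕ} (hk : 1 ≤ k) {u₁ u₂ : Fin n} (h : ¬ G.Adj u₁ u₂) :
    walkSum G V₁ v₀ ρ k r s u₁ u₂ = 0 := by
  refine Finset.sum_eq_zero fun p _ => if_neg ?_
  rintro ⟨hp, rfl, rfl⟩
  apply h
  have := hp.adj (k - 1) (by omega)
  rwa [Nat.sub_add_cancel hk] at this

theorem walkSum_of_first_eq_zero {k s : ℕ} {u₁ u₂ : Fin n} (h : V₁ u₂ = true) :
    walkSum G V₁ v₀ ρ k 0 s u₁ u₂ = 0 := by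
  refine Finset.sum_eq_zero fun p _ => if_neg ?_
  rintro ⟨hp, rfl, rfl⟩
  have := Finset.card_eq_zero.1 hp.card_first
  have hk : k ∈ firstIdx V₁ k (extend p) := by simp [firstIdx, h]
  simp [this] at hk

theorem walkSum_of_second_eq_zero {k r : ℕ} (hk : 1 ≤ k) {u₁ u₂ : Fin n} (h₁ : V₁ u₁ = false)
    (h₂ : V₁ u₂ = false) : walkSum G V₁ v₀ ρ k r 0 u₁ u₂ = 0 := by
  refine Finset.sum_eq_zero fun p _ => if_neg ?_
  rintro ⟨hp, rfl, rfl⟩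
  have := Finset.card_eq_zero.1 hp.card_second
  have hk : k - 1 ∈ secondIdx V₁ k (extend p) := by
    simp only [secondIdx, Finset.mem_filter, Finset.mem_range, Nat.sub_add_cancel hk]
    exact ⟨by omega, h₁, h₂⟩
  simp [this] at hk

/-- A walk of length `k + 1` is a walk of length `k` followed by `u₂`. The new edge and vertex
contribute a factor that depends on `u₁` and `u₂` only. Remembering the last two vertices is enough,
because the turn condition looks back to the vertex `w` before `u₁` and no further. -/
theorem walkSum_succ {k r s : ℕ} (hk : 1 ≤ k) (u₁ u₂ : Fin n) (h : G.Adj u₁ u₂) :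
    walkSum G V₁ v₀ ρ (k + 1) (r + if V₁ u₂ then 1 else 0)
        (s + if V₁ u₁ = false ∧ V₁ u₂ = false then 1 else 0) u₁ u₂ =
      (∑ w, if V₁ u₁ = true ∧ V₁ u₂ = false → w ≠ u₂ then walkSum G V₁ v₀ ρ k r s w u₁ else 0) *
        (ρ (.x s(u₁, u₂)) * (if V₁ u₂ then ρ (.y u₂) else 1) *
          (if V₁ u₁ = false ∧ V₁ u₂ = false then ρ (.z s(u₁, u₂)) else 1)) := by
  classical
  set c := (ρ (.x s(u₁, u₂)) * (if V₁ u₂ then ρ (.y u₂) else 1) *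
    (if V₁ u₁ = false ∧ V₁ u₂ = false then ρ (.z s(u₁, u₂)) else 1)) with hc
  -- For a fixed initial part `q`, only the extension by `u₂` contributes.
  have hL : ∀ q : Fin (k + 1) → Fin n, (∑ u, if IsLegit G V₁ v₀ (k + 1)
      (r + if V₁ u₂ then 1 else 0) (s + if V₁ u₁ = false ∧ V₁ u₂ = false then 1 else 0)
      (extend (Fin.snoc q u : Fin (k + 1 + 1) → Fin n)) ∧
      extend (Fin.snoc q u : Fin (k + 1 + 1) → Fin n) (k + 1 - 1) = u₁ ∧
      extend (Fin.snoc q u : Fin (k + 1 + 1) → Fin n) (k + 1) = u₂ then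
      weight V₁ ρ (k + 1) (extend (Fin.snoc q u : Fin (k + 1 + 1) → Fin n)) else 0) =
      (if IsLegit G V₁ v₀ k r s (extend q) ∧ extend q k = u₁ ∧
        (V₁ u₁ = true ∧ V₁ u₂ = false → extend q (k - 1) ≠ u₂) then
        weight V₁ ρ k (extend q) else 0) * c := by
    intro q
    rw [Finset.sum_eq_single u₂]
    · have e : ∀ t ≤ k, extend (Fin.snoc q u₂ : Fin (k + 1 + 1) → Fin n) t = extend q t :=
        fun t ht => extend_snoc_of_le q u₂ ht
      have e' := extend_snoc_last q u₂
      rw [ite_mul, zero_mul]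
      by_cases hu : extend q k = u₁
      · have hiff := isLegit_succ_iff (G := G) (V₁ := V₁) (v₀ := v₀) (r := r) (s := s)
          (p := extend (Fin.snoc q u₂ : Fin (k + 1 + 1) → Fin n)) hk
        rw [e k le_rfl, e', hu, e (k - 1) (by omega), isLegit_congr e] at hiff
        rw [Nat.add_sub_cancel, e k le_rfl, e', weight_succ, e k le_rfl, e', hu, weight_congr e]
        simp only [hiff, h, true_and, and_true]
        rfl
      · rw [if_neg, if_neg]
        · exact fun h => hu h.2.1
        · rw [Nat.add_sub_cancel, e k le_rfl]
          exact fun h => hu h.2.1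
    · intro u _ hu
      rw [if_neg]
      rw [extend_snoc_last]
      exact fun h => hu h.2.2
    · simp
  rw [walkSum, sum_eq_sum_snoc, Finset.sum_congr rfl fun q _ => hL q, ← Finset.sum_mul]
  congr 1
  simp only [walkSum]
  -- The walks are sorted by their last but one vertex. After the sums are exchanged, each walk is
  -- counted for exactly one `w`.
  have : ∀ w : Fin n, (if V₁ u₁ = true ∧ V₁ u₂ = false → w ≠ u₂ then
      ∑ p : Fin (k + 1) → Fin n, (if IsLegit G V₁ v₀ k r s (extend p) ∧ extend p (k - 1) = w ∧
        extend p k = u₁ then weight V₁ ρ k (extend p) else 0) else 0) =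
      ∑ p : Fin (k + 1) → Fin n, if w = extend p (k - 1) then
        (if IsLegit G V₁ v₀ k r s (extend p) ∧ extend p k = u₁ ∧
        (V₁ u₁ = true ∧ V₁ u₂ = false → extend p (k - 1) ≠ u₂) then
        weight V₁ ρ k (extend p) else 0) else 0 := by
    intro w
    split_ifs with hw
    · refine Finset.sum_congr rfl fun p _ => ?_
      by_cases hpw : w = extend p (k - 1)
      · subst hpw
        simp only [true_and, if_true]
        refine if_congr ?_ rfl rfl
        tauto
      · rw [if_neg hpw, if_neg fun h => hpw h.2.1.symm]
    · symm
      refine Finset.sum_eq_zero fun p _ => ?_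
      split_ifs with h₁ h₂
      · subst h₁
        exact absurd h₂.2.2 hw
      all_goals rfl
  rw [Finset.sum_congr rfl fun w _ => this w, Finset.sum_comm]
  simp

/-- The only candidate is the single edge from `v₀ = u₁` to `u₂`. As `v₀` lies in `V₁`, it
contributes one factor `y`, and the edge is not in `E₂`. -/
theorem walkSum_one {r s : ℕ} (hv : V₁ v₀ = true) (u₁ u₂ : Fin n) (h : G.Adj u₁ u₂) :
    walkSum G V₁ v₀ ρ 1 r s u₁ u₂ =
      if u₁ = v₀ ∧ r = (1 + if V₁ u₂ then 1 else 0) ∧ s = 0 then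
        ρ (.x s(u₁, u₂)) * ρ (.y u₁) * (if V₁ u₂ then ρ (.y u₂) else 1) else 0 := by
  classical
  have h₀ : extend (![u₁, u₂] : Fin (1 + 1) → Fin n) 0 = u₁ := rfl
  have h₁ : extend (![u₁, u₂] : Fin (1 + 1) → Fin n) 1 = u₂ := rfl
  rw [walkSum, Finset.sum_eq_single ![u₁, u₂]]
  · rw [Nat.sub_self, h₀, h₁]
    by_cases hu : u₁ = v₀
    · subst hu
      have hf : firstIdx V₁ 0 (extend (![u₁, u₂] : Fin (1 + 1) → Fin n)) = {0} := by
        simp [firstIdx, Finset.filter_singleton, h₀, hv]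
      have hs : secondIdx V₁ 0 (extend (![u₁, u₂] : Fin (1 + 1) → Fin n)) = ∅ := by
        simp [secondIdx]
      refine if_congr ?_ ?_ rfl
      · constructor
        · rintro ⟨hp, -⟩
          refine ⟨rfl, ?_, ?_⟩
          · rw [← hp.card_first, card_firstIdx_succ, hf, zero_add, h₁]; rfl
          · rw [← hp.card_second, card_secondIdx_succ, hs, h₀, hv]; simp
        · rintro ⟨-, hr, hs'⟩
          refine ⟨⟨h₀, ?_, ?_, ?_, fun t ht => by omega⟩, rfl, rfl⟩
          · intro t ht
            obtain rfl : t = 0 := by omega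
            rw [h₀, zero_add, h₁]; exact h
          · rw [hr, card_firstIdx_succ, hf, zero_add, h₁]; rfl
          · rw [hs', card_secondIdx_succ, hs, h₀, hv]; simp
      · rw [weight_succ, zero_add, h₀, h₁, weight, hf, hs]
        simp [hv, h₀]
        ring_nf
    · rw [if_neg, if_neg]
      · tauto
      · exact fun h => hu (h₀ ▸ h.1.start)
  · intro p _ hp
    rw [if_neg]
    rintro ⟨-, rfl, rfl⟩
    apply hp
    funext i
    fin_cases i <;> rfl
  · simp

end Legit

/-! ## The circuit computes the sums over walks -/

section CircuitCorrectness

open Prog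

variable {n m : ℕ} {G : SimpleGraph (Fin n)}

/-- The value of a gate. -/
def Gate.value {R : Type} [CommSemiring R] (ρ : Var n → R) (t : Node n → R) (g : Gate n) : R :=
  match g.op with
  | .add => g.lhs.val ρ t + g.rhs.val ρ t
  | .mul => g.lhs.val ρ t * g.rhs.val ρ t

/-- The values of the nodes after a circuit has been evaluated, starting from the values `t`. -/
def Circuit.eval {R : Type} [CommSemiring R] (ρ : Var n → R) (t : Node n → R) (C : Circuit n) :
    Node n → R :=
  C.foldl (fun t g => Function.update t g.dst (g.value ρ t)) t

variable {ρ : Var n → GaloisField 2 m} {t₀ : Node n → GaloisField 2 m}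

theorem Circuit.eval_append {R : Type} [CommSemiring R] (ρ : Var n → R) (t : Node n → R)
    (C D : Circuit n) : Circuit.eval ρ t (C ++ D) = Circuit.eval ρ (Circuit.eval ρ t C) D :=
  List.foldl_append

theorem ensures_evalCircuit (C : Circuit n) :
    (evalCircuit C ρ).Ensures G fun a => a = Circuit.eval ρ (fun _ => 0) C .out := by
  refine (ensures_fold (g := fun t g => Function.update t g.dst (g.value ρ t)) (fun t g => ?_)
    C _).bind fun t ht => ensures_pure (by rw [ht]; rfl)
  refine Ensures.bind (Q := fun a => a = g.value ρ t) ?_ fun a ha => ensures_pure (by rw [ha])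
  rcases g with ⟨d, op, l, r⟩
  cases op
  · exact ensures_fadd _ _
  · exact ensures_fmul _ _

/-- The effect of the gates `C` is to assign the value `a` to `ν`. -/
def Circuit.Sets {R : Type} [CommSemiring R] (ρ : Var n → R) (t : Node n → R) (ν : Node n) (a : R)
    (C : Circuit n) : Prop :=
  Circuit.eval ρ t C = Function.update t ν a

theorem ensures_sets_of_eq {p : Prog n (GaloisField 2 m) (List (Gate n))} {ν : Node n}
    {a b : GaloisField 2 m} (h : p.Ensures G fun C => Circuit.Sets ρ t₀ ν a C) (hab : a = b) :
    p.Ensures G fun C => Circuit.Sets ρ t₀ ν b C := hab ▸ h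

theorem ensures_emit (g : Gate n) :
    (emit (F := GaloisField 2 m) g).Ensures G fun C => Circuit.Sets ρ t₀ g.dst (g.value ρ t₀) C :=
  ensures_tick.bind fun _ _ => ensures_pure rfl

theorem ensures_clear (ν : Node n) : (clear (F := GaloisField 2 m) ν).Ensures G fun C => Circuit.Sets ρ t₀ ν 0 C :=
  (ensures_emit _).mono fun C hC => by
    simpa [Gate.value, Wire.val] using hC

theorem ensures_addNode (ν μ : Node n) :
    (addNode (F := GaloisField 2 m) ν μ).Ensures G fun C => Circuit.Sets ρ t₀ ν (t₀ ν + t₀ μ) C := ensures_emit _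

theorem ensures_mulVar (ν : Node n) (v : Var n) :
    (mulVar (F := GaloisField 2 m) ν v).Ensures G fun C => Circuit.Sets ρ t₀ ν (t₀ ν * ρ v) C := ensures_emit _

theorem Circuit.Sets.append {R : Type} [CommSemiring R] {ρ : Var n → R} {t : Node n → R}
    {ν : Node n} {a b : R} {C D : Circuit n} (hC : C.Sets ρ t ν a)
    (hD : D.Sets ρ (Function.update t ν a) ν b) : Circuit.Sets ρ t ν b (C ++ D) := by
  rw [Circuit.Sets] at *
  rw [Circuit.eval_append, hC, hD, Function.update_idem]

theorem ensures_append_sets {p q : Prog n (GaloisField 2 m) (List (Gate n))} {ν : Node n}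
    {a b : GaloisField 2 m} (hp : p.Ensures G fun C => Circuit.Sets ρ t₀ ν a C)
    (hq : q.Ensures G fun C => Circuit.Sets ρ (Function.update t₀ ν a) ν b C) :
    (p >>= fun C => q >>= fun D => pure (C ++ D)).Ensures G
      fun C => Circuit.Sets ρ t₀ ν b C :=
  hp.bind fun _ hC => hq.bind fun _ hD => ensures_pure (hC.append hD)

theorem ensures_append_append_sets {p q q' : Prog n (GaloisField 2 m) (List (Gate n))} {ν : Node n}
    {a b c : GaloisField 2 m} (hp : p.Ensures G fun C => Circuit.Sets ρ t₀ ν a C)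
    (hq : q.Ensures G fun C => Circuit.Sets ρ (Function.update t₀ ν a) ν b C)
    (hq' : q'.Ensures G fun C => Circuit.Sets ρ (Function.update t₀ ν b) ν c C) :
    (p >>= fun C => q >>= fun D => q' >>= fun E => pure (C ++ D ++ E)).Ensures G
      fun C => Circuit.Sets ρ t₀ ν c C :=
  hp.bind fun _ hC => hq.bind fun _ hD => hq'.bind fun _ hE =>
    ensures_pure ((hC.append hD).append hE)

/-- Accumulation of a sum in the node `ν`. -/
theorem ensures_collect_sets {ι : Type} {ν : Node n} {f : ι → Prog n (GaloisField 2 m) (List (Gate n))}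
    {a : ι → GaloisField 2 m} (l : List ι)
    (h : ∀ i c, (f i).Ensures G fun C => Circuit.Sets ρ (Function.update t₀ ν c) ν (c + a i) C)
    (c : GaloisField 2 m) :
    (collect l f).Ensures G fun C =>
      Circuit.Sets ρ (Function.update t₀ ν c) ν (c + (l.map a).sum) C := by
  induction l generalizing c with
  | nil => exact ensures_pure (by simp [Circuit.Sets, Circuit.eval])
  | cons i l ih =>
    rw [collect_cons]
    refine ensures_tick.bind fun _ _ => ensures_append_sets (h i c) ?_
    rw [Function.update_idem, List.map_cons, List.sum_cons, ← add_assoc]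
    exact ih _

/-- Because of `hν`, the accumulation in `ν` never overwrites a summand. -/
theorem ensures_sumGates {ν : Node n} {j r s : ℕ} {u : Fin n} {ok : Fin n → Bool}
    (hν : ∀ w, ν ≠ .path j r s w u) [DecidableRel G.Adj] :
    (sumGates (F := GaloisField 2 m) ν j r s u ok).Ensures G fun C =>
      Circuit.Sets ρ t₀ ν (∑ w, if G.Adj u w ∧ ok w then t₀ (.path j r s w u) else 0) C := by
  refine ensures_append_sets (ensures_clear ν) ?_
  rw [Fin.sum_univ_def, ← zero_add (List.sum _)]
  refine ensures_collect_sets _ (fun w c => ?_) 0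
  refine (ensures_adj u w).bind fun e he => ?_
  have he' : (e && ok w) = true ↔ G.Adj u w ∧ ok w := by simp [he]
  by_cases h : (e && ok w) = true
  · rw [if_pos h, if_pos (he'.1 h)]
    exact ensures_sets_of_eq (ensures_addNode _ _) (by simp [Function.update_of_ne (hν w).symm])
  · rw [if_neg h, if_neg fun h' => h (he'.2 h')]
    exact ensures_pure (by simp [Circuit.Sets, Circuit.eval])

/-- No walk ends with a step between vertices that are not adjacent. The sum over neighbours formed
by the circuit is therefore the sum over all `w` that occurs in `walkSum_succ`. -/
theorem sum_neighbours {V₁ : Fin n → Bool} {v₀ : Fin n} {k r s : ℕ} (hk : 1 ≤ k) (u : Fin n)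
    (ok : Fin n → Prop) [DecidablePred ok] [DecidableRel G.Adj] :
    (∑ w, if G.Adj u w ∧ ok w then walkSum G V₁ v₀ ρ k r s w u else 0) =
      ∑ w, if ok w then walkSum G V₁ v₀ ρ k r s w u else 0 := by
  refine Finset.sum_congr rfl fun w _ => ?_
  by_cases h : G.Adj u w
  · simp [h]
  · rw [walkSum_of_not_adj hk fun h' => h h'.symm]
    simp

/-- Each branch of `pathGates` is a case of `walkSum_one`, a case of `walkSum_succ`, or a situation
in which no walk exists and the node is cleared. The gates read only nodes of length `j - 1` with
counts at most `r` and `s`, and this is all that `ht` asks for. -/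
theorem ensures_pathGates {V₁ : Fin n → Bool} {v₀ : Fin n} (hv : V₁ v₀ = true) {j r s : ℕ}
    (hj : 1 ≤ j) (u₁ u₂ : Fin n)
    (ht : 2 ≤ j → ∀ r' ≤ r, ∀ s' ≤ s, ∀ w u,
      t₀ (.path (j - 1) r' s' w u) = walkSum G V₁ v₀ ρ (j - 1) r' s' w u) :
    (pathGates (F := GaloisField 2 m) v₀ V₁ j r s u₁ u₂).Ensures G fun C =>
      Circuit.Sets ρ t₀ (.path j r s u₁ u₂) (walkSum G V₁ v₀ ρ j r s u₁ u₂) C := by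
  classical
  refine (ensures_adj u₁ u₂).bind fun e he => ?_
  by_cases h : e = true
  swap
  · rw [if_neg h, walkSum_of_not_adj hj fun h' => h (he.2 h')]
    exact ensures_clear _
  rw [if_pos h]
  replace h := he.1 h
  by_cases hj1 : j = 1
  · subst hj1
    rw [if_pos rfl, walkSum_one hv _ _ h]
    by_cases h₁ : u₁ = v₀ ∧ V₁ u₂ = false ∧ r = 1 ∧ s = 0
    · rw [if_pos h₁]
      obtain ⟨rfl, h₂, rfl, rfl⟩ := h₁
      exact ensures_sets_of_eq (ensures_emit _) (by simp [h₂, Gate.value, Wire.val])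
    rw [if_neg h₁]
    by_cases h₂ : u₁ = v₀ ∧ V₁ u₂ = true ∧ r = 2 ∧ s = 0
    · rw [if_pos h₂]
      obtain ⟨rfl, h₂, rfl, rfl⟩ := h₂
      refine ensures_append_sets (ensures_emit _) (ensures_sets_of_eq
        (ensures_mulVar _ _) (by simp [h₂, Gate.value, Wire.val]))
    rw [if_neg h₂, if_neg]
    · exact ensures_clear _
    · rintro ⟨hu, hr, hs⟩
      cases hV : V₁ u₂
      · exact h₁ ⟨hu, hV, by simpa [hV] using hr, hs⟩
      · exact h₂ ⟨hu, hV, by simpa [hV] using hr, hs⟩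
  · rw [if_neg hj1]
    obtain ⟨i, rfl⟩ : ∃ i, j = i + 1 := ⟨j - 1, by omega⟩
    have hi : 1 ≤ i := by omega
    replace ht := ht (by omega)
    rw [Nat.add_sub_cancel] at ht ⊢
    have hν : ∀ r' s' w, (Node.path (i + 1) r s u₁ u₂ : Node n) ≠ .path i r' s' w u₁ := by
      intro r' s' w h; injection h; omega
    cases hV₂ : V₁ u₂
    · rw [if_neg (by simp)]
      cases hV₁ : V₁ u₁
      · rw [if_neg (by simp)]
        cases s with
        | zero =>
          rw [walkSum_of_second_eq_zero (by omega) hV₁ hV₂]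
          exact ensures_clear _
        | succ s' =>
          have key := walkSum_succ (V₁ := V₁) (v₀ := v₀) (ρ := ρ) (r := r) (s := s') hi u₁ u₂ h
          simp only [hV₁, hV₂, and_self, if_true, Bool.false_eq_true, if_false, add_zero,
            false_and, false_implies] at key
          refine ensures_append_append_sets (ensures_sumGates (hν r s'))
            (ensures_mulVar _ _) (ensures_sets_of_eq (ensures_mulVar _ _) ?_)
          have := sum_neighbours (G := G) (V₁ := V₁) (v₀ := v₀) (ρ := ρ) (r := r) (s := s') hi u₁
            fun _ => True
          simp only [and_true, if_true] at this
          simp only [Function.update_self, and_true, ht r le_rfl s' (by omega)]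
          rw [this, key]
          ring
      · rw [if_pos rfl]
        have key := walkSum_succ (V₁ := V₁) (v₀ := v₀) (ρ := ρ) (r := r) (s := s) hi u₁ u₂ h
        simp only [hV₁, hV₂, and_self, Bool.true_eq_false, Bool.false_eq_true, if_false,
          add_zero, false_and, true_implies, mul_one] at key
        refine ensures_append_sets (ensures_sumGates (hν r s)) ?_
        simp only [decide_eq_true_eq, ht r le_rfl s le_rfl]
        rw [sum_neighbours hi, key]
        exact ensures_sets_of_eq (ensures_mulVar _ _) (by simp)
    · rw [if_pos rfl]
      cases r with
      | zero =>
        rw [walkSum_of_first_eq_zero hV₂]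
        exact ensures_clear _
      | succ r' =>
        have key := walkSum_succ (V₁ := V₁) (v₀ := v₀) (ρ := ρ) (r := r') (s := s) hi u₁ u₂ h
        simp only [hV₂, Bool.true_eq_false, if_true, if_false, add_zero, and_false, false_implies,
          mul_one] at key
        refine ensures_append_append_sets (ensures_sumGates (hν r' s))
          (ensures_mulVar _ _) (ensures_sets_of_eq (ensures_mulVar _ _) ?_)
        have := sum_neighbours (G := G) (V₁ := V₁) (v₀ := v₀) (ρ := ρ) (r := r') (s := s) hi u₁
          fun _ => True
        simp only [and_true, if_true] at this
        simp only [Function.update_self, and_true, ht r' (by omega) s le_rfl]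
        rw [this, key]
        ring

/-- If the nodes in `A` have their final values `τ` before the gates `C` are evaluated, then the
nodes in `B` have them afterwards. -/
def Circuit.Achieves {R : Type} [CommSemiring R] (ρ : Var n → R) (τ : Node n → R)
    (A B : Set (Node n)) (C : Circuit n) : Prop :=
  ∀ t, (∀ ν ∈ A, t ν = τ ν) → ∀ ν ∈ B, Circuit.eval ρ t C ν = τ ν

variable {τ : Node n → GaloisField 2 m}

/-- For loops whose iterations do not depend on each other: `A₀` is what every iteration reads,
while `A` also contains what has been finished so far. Allowing every `A ⊇ A₀` lets such loops be
nested. -/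
theorem ensures_collect_achieves {ι : Type} {f : ι → Prog n (GaloisField 2 m) (List (Gate n))}
    {A₀ : Set (Node n)} {N : ι → Set (Node n)} (l : List ι)
    (h : ∀ i ∈ l, ∀ A, A₀ ⊆ A → (f i).Ensures G fun C => Circuit.Achieves ρ τ A (A ∪ N i) C)
    (A : Set (Node n)) (hA : A₀ ⊆ A) :
    (collect l f).Ensures G fun C => Circuit.Achieves ρ τ A (A ∪ ⋃ i ∈ l, N i) C := by
  induction l generalizing A with
  | nil => exact ensures_pure (by simp [Circuit.Achieves, Circuit.eval])
  | cons i l ih =>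
    rw [collect_cons]
    refine ensures_tick.bind fun _ _ => (h i (by simp) A hA).bind fun C hC =>
      (ih (fun i hi => h i (by simp [hi])) (A ∪ N i) (hA.trans Set.subset_union_left)).bind
        fun D hD => ensures_pure fun t ht ν hν => ?_
    rw [Circuit.eval_append]
    refine hD _ (hC t ht) ν ?_
    simpa [or_assoc] using hν

/-- For the outer loop over the lengths, where a stage may read everything that the earlier stages
produced. -/
theorem ensures_collect_range'_achieves {f : ℕ → Prog n (GaloisField 2 m) (List (Gate n))}
    {A : ℕ → Set (Node n)} {a : ℕ} (h : ∀ j ≥ a,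
      (f j).Ensures G fun C => Circuit.Achieves ρ τ (A j) (A (j + 1)) C) (k : ℕ) :
    (collect (List.range' a k) f).Ensures G fun C => Circuit.Achieves ρ τ (A a) (A (a + k)) C := by
  induction k generalizing a with
  | zero => exact ensures_pure (by simp [Circuit.Achieves, Circuit.eval])
  | succ k ih =>
    rw [List.range'_succ, collect_cons]
    refine ensures_tick.bind fun _ _ => (h a le_rfl).bind fun C hC =>
      (ih fun j hj => h j (by omega)).bind fun D hD => ensures_pure fun t ht => ?_
    rw [Circuit.eval_append, show a + (k + 1) = a + 1 + k by ring]
    exact hD _ (hC t ht)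

/-- Induction over the lengths: before stage `j`, all path nodes of lengths `1, …, j - 1` hold their
final values. The quantifier over `ρ` stands inside, as the same circuit is evaluated at many
points. -/
theorem ensures_buildCircuit {V₁ : Fin n → Bool} {v₀ : Fin n} (hv : V₁ v₀ = true) {k r s : ℕ}
    (hk : 1 ≤ k) :
    (buildCircuit (F := GaloisField 2 m) k r s v₀ V₁).Ensures G fun C => ∀ ρ : Var n → GaloisField 2 m,
      Circuit.eval ρ (fun _ => 0) C .out = ∑ u₁, ∑ u₂, walkSum G V₁ v₀ ρ k r s u₁ u₂ := by
  suffices H : ∀ ρ : Var n → GaloisField 2 m, (buildCircuit (F := GaloisField 2 m) k r s v₀ V₁).Ensures G fun C =>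
      Circuit.eval ρ (fun _ => 0) C .out = ∑ u₁, ∑ u₂, walkSum G V₁ v₀ ρ k r s u₁ u₂ from
    fun o ho ρ => H ρ o ho
  intro ρ
  -- The value at `out` is arbitrary, since the sets `A j` consist of path nodes only.
  let τ : Node n → GaloisField 2 m := fun ν => match ν with
    | .path j r s u₁ u₂ => walkSum G V₁ v₀ ρ j r s u₁ u₂
    | .out => 0
  let A : ℕ → Set (Node n) := fun j =>
    {ν | ∃ j' r' s' u₁ u₂, ν = .path j' r' s' u₁ u₂ ∧ 1 ≤ j' ∧ j' < j ∧ r' ≤ r ∧ s' ≤ s}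
  have h₀ := ensures_collect_range'_achieves (G := G) (ρ := ρ) (τ := τ) (A := A) (a := 1)
    (f := fun j => collect (List.range (r + 1)) fun r' =>
      collect (List.range (s + 1)) fun s' => collect (List.finRange n) fun u₁ =>
        collect (List.finRange n) fun u₂ => pathGates v₀ V₁ j r' s' u₁ u₂) (fun j hj => ?_) k
  swap
  · refine (ensures_collect_achieves (A₀ := A j) (List.range (r + 1)) (fun r' hr A' hA' =>
      ensures_collect_achieves (A₀ := A j) (List.range (s + 1)) (fun s' hs A' hA' =>
      ensures_collect_achieves (A₀ := A j) (List.finRange n) (fun u₁ _ A' hA' =>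
      ensures_collect_achieves (A₀ := A j) (N := fun u₂ => {.path j r' s' u₁ u₂})
        (List.finRange n) (fun u₂ _ A' hA' => ?_) A' hA') A' hA') A' hA') _ subset_rfl).mono
        fun C hC t ht ν hν => hC t ht ν ?_
    · suffices H : ∀ t : Node n → GaloisField 2 m, (∀ ν ∈ A', t ν = τ ν) →
          (pathGates (F := GaloisField 2 m) v₀ V₁ j r' s' u₁ u₂).Ensures G fun C =>
            Circuit.Sets ρ t (.path j r' s' u₁ u₂) (walkSum G V₁ v₀ ρ j r' s' u₁ u₂) C by
        intro o ho t ht ν hν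
        rw [show Circuit.eval ρ t o.1 = _ from H t ht o ho]
        by_cases e : ν = .path j r' s' u₁ u₂
        · subst e; simp [τ]
        · rw [Function.update_of_ne e]
          exact ht ν (hν.resolve_right e)
      intro t ht
      refine ensures_pathGates hv hj u₁ u₂ fun hj2 r'' hr'' s'' hs'' w u => ht _ (hA' ?_)
      have := List.mem_range.1 hr
      have := List.mem_range.1 hs
      exact ⟨_, _, _, _, _, rfl, by omega, by omega, by omega, by omega⟩
    · obtain ⟨j', r', s', u₁, u₂, rfl, h₁, h₂, h₃, h₄⟩ := hν
      rcases Nat.lt_succ_iff_lt_or_eq.1 h₂ with h₂ | rfl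
      · exact Or.inl ⟨_, _, _, _, _, rfl, h₁, h₂, h₃, h₄⟩
      · right
        simp only [Set.mem_iUnion, List.mem_range, List.mem_finRange, Set.mem_singleton_iff]
        exact ⟨r', by omega, s', by omega, u₁, trivial, u₂, trivial, rfl⟩
  refine h₀.bind fun C₀ hC₀ => ?_
  -- The set `A 1` is empty, so the initial values do not matter.
  have hτ := hC₀ (fun _ => 0) (by rintro ν ⟨j', _, _, _, _, _, h₁, h₂, _⟩; omega)
  set t := Circuit.eval ρ (fun _ => 0) C₀
  have h₂ := ensures_collect_sets (G := G) (ρ := ρ) (t₀ := t) (ν := .out)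
    (f := fun u₁ => collect (List.finRange n) fun u₂ => addNode .out (.path k r s u₁ u₂))
    (a := fun u₁ => ((List.finRange n).map fun u₂ => t (.path k r s u₁ u₂)).sum)
    (List.finRange n) (fun u₁ c => ensures_collect_sets _ (fun u₂ c =>
      ensures_sets_of_eq (ensures_addNode _ _) (by simp)) c) 0
  refine (ensures_clear (ρ := ρ) (t₀ := t) .out).bind fun C₁ hC₁ => h₂.bind fun C₂ hC₂ => ensures_pure ?_
  rw [Circuit.eval_append, Circuit.eval_append, show Circuit.eval ρ t C₁ = _ from hC₁,
    show Circuit.eval ρ (Function.update t .out 0) C₂ = _ from hC₂, Function.update_self, zero_add,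
    ← Fin.sum_univ_def]
  refine Finset.sum_congr rfl fun u₁ _ => ?_
  rw [← Fin.sum_univ_def]
  exact Finset.sum_congr rfl fun u₂ _ =>
    hτ (.path k r s u₁ u₂) ⟨k, r, s, u₁, u₂, rfl, hk, by omega, le_rfl, le_rfl⟩

open Classical in
theorem sum_walkSum {R : Type} [CommSemiring R] (V₁ : Fin n → Bool) (v₀ : Fin n) (ρ : Var n → R)
    (k r s : ℕ) : ∑ u₁, ∑ u₂, walkSum G V₁ v₀ ρ k r s u₁ u₂ =
      ∑ p : Fin (k + 1) → Fin n with IsLegit G V₁ v₀ k r s (extend p), weight V₁ ρ k (extend p) := by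
  simp only [walkSum]
  rw [Finset.sum_congr rfl fun u₁ _ => Finset.sum_comm, Finset.sum_comm, Finset.sum_filter]
  refine Finset.sum_congr rfl fun p _ => ?_
  simp only [ite_and]
  split_ifs
  · simp
  · simp

end CircuitCorrectness

/-! ## Sieving for distinct elements in characteristic two -/

section Sieve

variable {R ι ι' α : Type} [CommRing R]

/-- The sum over all `S ⊆ T` of the product over `i ∈ I` of the linear forms `∑_{a ∈ S} c i a`. -/
def sieve (T : Finset α) (I : Finset ι) (c : ι → α → R) : R :=
  ∑ S ∈ T.powerset, ∏ i ∈ I, ∑ a ∈ S, c i a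

theorem sieve_image [DecidableEq ι'] (T : Finset α) (I : Finset ι) (c : ι' → α → R) {f : ι → ι'}
    (hf : Function.Injective f) : sieve T (I.image f) c = sieve T I fun i => c (f i) :=
  Finset.sum_congr rfl fun _ _ => Finset.prod_image fun _ _ _ _ h => hf h

/-- Expanding the product assigns to each factor a label. With too few factors some labels are not
used, and each assignment is counted once for every `S` that contains the used ones, an even number
of times. The proof is an induction that removes one label `a`. -/
theorem sieve_eq_zero_of_card_lt [CharP R 2] (T : Finset α) (I : Finset ι) (c : ι → α → R)
    (h : I.card < T.card) : sieve T I c = 0 := by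
  classical
  induction T using Finset.induction_on generalizing I with
  | empty => simp at h
  | insert a T ha ih =>
    rw [Finset.card_insert_of_notMem ha] at h
    -- The product for `S ∪ {a}` is expanded according to the set `J` of factors that take the label
    -- `a`.
    have key : ∀ S ∈ T.powerset, ∏ i ∈ I, ∑ b ∈ insert a S, c i b =
        ∑ J ∈ I.powerset, (∏ i ∈ I \ J, ∑ b ∈ S, c i b) * ∏ i ∈ J, c i a := by
      intro S hS
      have haS : a ∉ S := fun h => ha (Finset.mem_powerset.1 hS h)
      simp only [Finset.sum_insert haS, Finset.prod_add]
      exact Finset.sum_congr rfl fun J _ => mul_comm _ _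
    rw [sieve, Finset.sum_powerset_insert ha, Finset.sum_congr rfl key, Finset.sum_comm,
      ← Finset.sum_erase_add _ _ (Finset.empty_mem_powerset I)]
    simp only [Finset.sdiff_empty, Finset.prod_empty, mul_one]
    -- The terms with `J = ∅` reproduce the sum over the sets without `a` and cancel it. Every other
    -- `J` leaves fewer than `I.card` factors, so the induction hypothesis applies to `I \ J`.
    rw [add_comm, add_assoc, CharTwo.add_self_eq_zero, add_zero]
    refine Finset.sum_eq_zero fun J hJ => ?_
    rw [← Finset.sum_mul]
    obtain ⟨hJ₁, hJ₂⟩ := Finset.mem_erase.1 hJ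
    have hc : (I \ J).card < I.card := by
      refine Finset.card_lt_card (Finset.sdiff_ssubset (Finset.mem_powerset.1 hJ₂) ?_)
      exact Finset.nonempty_iff_ne_empty.2 hJ₁
    have := ih (I \ J) (by omega)
    rw [sieve] at this
    rw [this, zero_mul]

/-- Two equal linear forms multiply to a square, and in characteristic two the square of a sum is
the sum of the squares, which is again a single linear form. One factor is thereby lost, and fewer
factors than labels remain. -/
theorem sieve_eq_zero_of_eq [CharP R 2] (T : Finset α) (I : Finset ι) (c : ι → α → R)
    (h : I.card ≤ T.card) {i j : ι} (hi : i ∈ I) (hj : j ∈ I) (hij : i ≠ j) (hc : c i = c j) :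
    sieve T I c = 0 := by
  classical
  have hji : j ∈ I.erase i := Finset.mem_erase.2 ⟨hij.symm, hj⟩
  rw [← sieve_eq_zero_of_card_lt T (I.erase i) (fun t a => if t = j then c j a * c j a else c t a)]
  · refine Finset.sum_congr rfl fun S _ => ?_
    rw [← Finset.mul_prod_erase _ _ hi, ← Finset.mul_prod_erase _ _ hji,
      ← Finset.mul_prod_erase (I.erase i) _ hji, ← mul_assoc]
    congr 1
    · simp only [if_true, hc]
      exact CharTwo.sum_mul_self S _
    · refine Finset.prod_congr rfl fun t ht => ?_
      simp only [if_neg (Finset.mem_erase.1 ht).1]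
  · rw [Finset.card_erase_of_mem hi]
    have := Finset.card_pos.2 ⟨i, hi⟩
    omega

/-- If the elements `w i` are distinct, then the sieve does not vanish for a suitable choice of the
coefficients. -/
theorem exists_sieve_eq_one {K : Type} [DecidableEq K] (I : Finset ι) (w : ι → K)
    (hw : Set.InjOn w I) {r : ℕ} (hr : I.card = r) :
    ∃ Y : Fin r → K → R, sieve Finset.univ I (fun i a => Y a (w i)) = 1 := by
  classical
  let e := I.equivFinOfCardEq hr
  -- Label `a` is attached to the `a`-th element alone. A factor is then `1` or `0` according to
  -- whether its label lies in `S`, and only the full set `S` survives.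
  refine ⟨fun a v => if v = w (e.symm a) then 1 else 0, ?_⟩
  have key : ∀ (S : Finset (Fin r)) (i : ι) (hi : i ∈ I),
      (∑ a ∈ S, if w i = w (e.symm a) then (1 : R) else 0) = if e ⟨i, hi⟩ ∈ S then 1 else 0 := by
    intro S i hi
    have : ∀ a, w i = w (e.symm a) ↔ e ⟨i, hi⟩ = a := fun a => by
      rw [hw.eq_iff hi (e.symm a).2, ← Equiv.eq_symm_apply, Subtype.ext_iff]
    simp only [this, Finset.sum_ite_eq]
  rw [sieve, Finset.sum_eq_single Finset.univ]
  · refine Finset.prod_eq_one fun i hi => ?_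
    rw [key _ i hi, if_pos (Finset.mem_univ _)]
  · intro S _ hS
    obtain ⟨a, ha⟩ : ∃ a, a ∉ S := by
      by_contra! h
      exact hS (Finset.eq_univ_of_forall h)
    refine Finset.prod_eq_zero (e.symm a).2 ?_
    rw [key _ _ (e.symm a).2, if_neg]
    simpa using ha
  · simp

end Sieve

/-! ## Reversal of a closed segment -/

section Reversal

variable {V : Type} {k : ℕ}

/-- Reversal of the interval from `i` to `j`. -/
def rev (i j t : ℕ) : ℕ := if i ≤ t ∧ t ≤ j then i + j - t else t

theorem rev_rev (i j t : ℕ) : rev i j (rev i j t) = t := by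
  unfold rev; split_ifs <;> omega

theorem rev_injective (i j : ℕ) : Function.Injective (rev i j) :=
  Function.LeftInverse.injective (rev_rev i j)

theorem rev_lt_iff {i j N : ℕ} (hj : j < N) (t : ℕ) : rev i j t < N ↔ t < N := by
  unfold rev; split_ifs <;> omega

theorem filter_rev {i j N : ℕ} (hj : j < N) (C : ℕ → Prop) [DecidablePred C] :
    ((Finset.range N).filter fun t => C (rev i j t)) =
      ((Finset.range N).filter C).image (rev i j) := by
  ext t
  simp only [Finset.mem_filter, Finset.mem_range, Finset.mem_image]
  constructor
  · rintro ⟨h₁, h₂⟩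
    exact ⟨rev i j t, ⟨(rev_lt_iff hj t).2 h₁, h₂⟩, rev_rev i j t⟩
  · rintro ⟨u, ⟨h₁, h₂⟩, rfl⟩
    exact ⟨(rev_lt_iff hj u).2 h₁, by rwa [rev_rev]⟩

/-- `i` is the first index of a repeated vertex, and `j` is the last index of the same vertex. -/
structure IsRepeat (k : ℕ) (P : ℕ → V) (i j : ℕ) : Prop where
  lt : i < j
  le : j ≤ k
  eq : P i = P j
  last : ∀ j', j < j' → j' ≤ k → P j' ≠ P i
  first : ∀ i' < i, ∀ j', i' < j' → j' ≤ k → P i' ≠ P j'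

/-- This makes `flip` independent of the choice in its definition. -/
theorem IsRepeat.unique {P : ℕ → V} {i j i' j' : ℕ} (h : IsRepeat k P i j)
    (h' : IsRepeat k P i' j') : i = i' ∧ j = j' := by
  obtain rfl : i = i' := by
    rcases lt_trichotomy i i' with h₁ | h₁ | h₁
    · exact absurd h.eq (h'.first i h₁ j h.lt h.le)
    · exact h₁
    · exact absurd h'.eq (h.first i' h₁ j' h'.lt h'.le)
  refine ⟨rfl, ?_⟩
  rcases lt_trichotomy j j' with h₁ | h₁ | h₁
  · exact absurd h'.eq.symm (h.last j' h₁ h'.le)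
  · exact h₁
  · exact absurd h.eq.symm (h'.last j h₁ h.le)

theorem exists_isRepeat {P : ℕ → V} {a b : ℕ} (hab : a < b) (hb : b ≤ k) (h : P a = P b) :
    ∃ i j, IsRepeat k P i j := by
  classical
  have h₁ : ∃ i, ∃ j, i < j ∧ j ≤ k ∧ P i = P j := ⟨a, b, hab, hb, h⟩
  obtain ⟨j₀, hj₁, hj₂, hj₃⟩ := Nat.find_spec h₁
  set i := Nat.find h₁ with hi
  refine ⟨i, Nat.findGreatest (fun j => P j = P i) k, ?_, Nat.findGreatest_le _, ?_, ?_, ?_⟩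
  · exact hj₁.trans_le (Nat.le_findGreatest hj₂ hj₃.symm)
  · exact (Nat.findGreatest_spec (P := fun j => P j = P i) hj₂ hj₃.symm).symm
  · exact fun j' h₁ h₂ => Nat.findGreatest_is_greatest h₁ h₂
  · exact fun i' hi' j' h₂ h₃ h₄ => Nat.find_min h₁ hi' ⟨j', h₂, h₃, h₄⟩

/-- The ends of the segment carry the same vertex and nothing outside moves, so the reversed walk
has the same first repetition. Hence a second reversal acts on the same segment and restores the
walk. -/
theorem IsRepeat.reverse {P : ℕ → V} {i j : ℕ} (h : IsRepeat k P i j) :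
    IsRepeat k (fun t => P (rev i j t)) i j := by
  have hlt := h.lt
  have hi : rev i j i = j := by unfold rev; split_ifs <;> omega
  have hj : rev i j j = i := by unfold rev; split_ifs <;> omega
  have hout : ∀ t, t < i ∨ j < t → rev i j t = t := fun t ht => by
    unfold rev; split_ifs <;> omega
  refine ⟨hlt, h.le, by simp only [hi, hj, h.eq], fun j' h₁ h₂ => ?_, fun i' h₁ j' h₂ h₃ => ?_⟩
  · simp only [hi, hout j' (Or.inr h₁), ← h.eq]
    exact h.last j' h₁ h₂
  · simp only [hout i' (Or.inl h₁)]
    refine h.first i' h₁ _ ?_ ?_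
    · unfold rev; split_ifs <;> omega
    · unfold rev; have := h.le; split_ifs <;> omega

theorem IsRepeat.congr {P Q : ℕ → V} {i j : ℕ} (h : IsRepeat k P i j) (hPQ : ∀ t ≤ k, P t = Q t) :
    IsRepeat k Q i j := by
  have h₁ := h.lt
  have h₂ := h.le
  refine ⟨h₁, h₂, ?_, fun j' h₃ h₄ => ?_, fun i' h₃ j' h₄ h₅ => ?_⟩
  · rw [← hPQ i (by omega), ← hPQ j h₂, h.eq]
  · rw [← hPQ i (by omega), ← hPQ j' h₄]
    exact h.last j' h₃ h₄
  · rw [← hPQ i' (by omega), ← hPQ j' h₅]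
    exact h.first i' h₃ j' h₄ h₅

/-- Reversing the vertices at `i, …, j` reverses the edges at `i, …, j - 1`. The edges that enter
and leave the segment stay the same because `P i = P j`. That edges are unordered pairs is
essential. -/
theorem edge_rev {P : ℕ → V} {i j : ℕ} (hij : i < j) (h : P i = P j) (t : ℕ) :
    s(P (rev i j t), P (rev i j (t + 1))) =
      s(P (rev i (j - 1) t), P (rev i (j - 1) t + 1)) := by
  by_cases h₁ : t + 1 < i ∨ j < t
  · have e₁ : rev i j t = t := by unfold rev; split_ifs <;> omega
    have e₂ : rev i j (t + 1) = t + 1 := by unfold rev; split_ifs <;> omega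
    have e₃ : rev i (j - 1) t = t := by unfold rev; split_ifs <;> omega
    rw [e₁, e₂, e₃]
  by_cases h₂ : t + 1 = i
  · have e₁ : rev i j t = t := by unfold rev; split_ifs <;> omega
    have e₂ : rev i j (t + 1) = j := by unfold rev; split_ifs <;> omega
    have e₃ : rev i (j - 1) t = t := by unfold rev; split_ifs <;> omega
    rw [e₁, e₂, e₃, h₂, h]
  by_cases h₃ : t = j
  · have e₁ : rev i j t = i := by unfold rev; split_ifs <;> omega
    have e₂ : rev i j (t + 1) = t + 1 := by unfold rev; split_ifs <;> omega
    have e₃ : rev i (j - 1) t = t := by unfold rev; split_ifs <;> omega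
    rw [e₁, e₂, e₃, h, h₃]
  · have e₁ : rev i j t = rev i (j - 1) t + 1 := by unfold rev; split_ifs <;> omega
    have e₂ : rev i j (t + 1) = rev i (j - 1) t := by unfold rev; split_ifs <;> omega
    rw [e₁, e₂, Sym2.eq_swap]

open Classical in
/-- The walk in which the segment between the first and the last visit of the first repeated vertex
is reversed. -/
noncomputable def flip (p : Fin (k + 1) → V) : Fin (k + 1) → V :=
  if h : ∃ ij : ℕ × ℕ, IsRepeat k (extend p) ij.1 ij.2 then
    fun t => extend p (rev h.choose.1 h.choose.2 t)
  else p

theorem flip_eq {p : Fin (k + 1) → V} {i j : ℕ} (h : IsRepeat k (extend p) i j) :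
    flip p = fun t : Fin (k + 1) => extend p (rev i j t) := by
  have h' : ∃ ij : ℕ × ℕ, IsRepeat k (extend p) ij.1 ij.2 := ⟨(i, j), h⟩
  obtain ⟨e₁, e₂⟩ := h'.choose_spec.unique h
  rw [flip, dif_pos h', e₁, e₂]

theorem extend_of_le (p : ℕ → V) {t : ℕ} (ht : t ≤ k) :
    extend (fun u : Fin (k + 1) => p u) t = p t := by
  simp [extend, min_eq_left ht]

theorem extend_val (p : Fin (k + 1) → V) (t : Fin (k + 1)) : extend p t = p t := by
  simp [extend, min_eq_left (Nat.lt_succ_iff.1 t.2)]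

theorem extend_flip {p : Fin (k + 1) → V} {i j : ℕ} (h : IsRepeat k (extend p) i j) {t : ℕ}
    (ht : t ≤ k) : extend (flip p) t = extend p (rev i j t) := by
  rw [flip_eq h, extend_of_le (fun t => extend p (rev i j t)) ht]

theorem isRepeat_flip {p : Fin (k + 1) → V} {i j : ℕ} (h : IsRepeat k (extend p) i j) :
    IsRepeat k (extend (flip p)) i j :=
  h.reverse.congr fun _ ht => (extend_flip h ht).symm

theorem flip_flip {p : Fin (k + 1) → V} {i j : ℕ} (h : IsRepeat k (extend p) i j) :
    flip (flip p) = p := by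
  have hle := h.le
  rw [flip_eq (isRepeat_flip h)]
  funext t
  have : rev i j t < k + 1 := (rev_lt_iff (by omega) _).2 t.2
  rw [extend_flip h (by omega), rev_rev, extend_val]

end Reversal

/-! ## Cancellation of the walks that are not simple -/

section Cancellation

variable {n : ℕ} {R : Type} [CommRing R] {G : SimpleGraph (Fin n)} {V₁ : Fin n → Bool}
  {v₀ : Fin n} {k r s : ℕ}

/-- The contribution of the walk `P 0, …, P k` after sieving. -/
def sieveWeight (V₁ : Fin n → Bool) (x : Sym2 (Fin n) → R) (Y : Fin r → Fin n → R)
    (Z : Fin s → Sym2 (Fin n) → R) (k : ℕ) (P : ℕ → Fin n) : R :=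
  (∏ t ∈ Finset.range k, x s(P t, P (t + 1))) *
    sieve Finset.univ (firstIdx V₁ k P) (fun t a => Y a (P t)) *
    sieve Finset.univ (secondIdx V₁ k P) (fun t b => Z b s(P t, P (t + 1)))

variable {x : Sym2 (Fin n) → R} {Y : Fin r → Fin n → R} {Z : Fin s → Sym2 (Fin n) → R}

/-- The `y`-part depends on `T` alone and the `z`-part on `S` alone, so the double sum factors into
two sieves. -/
theorem sum_weight_eq_sieveWeight (P : ℕ → Fin n) :
    ∑ S : Finset (Fin s), ∑ T : Finset (Fin r),
      weight V₁ (assign x (fun v => ∑ i ∈ T, Y i v) (fun e => ∑ j ∈ S, Z j e)) k P =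
      sieveWeight V₁ x Y Z k P := by
  simp only [weight, assign, sieveWeight, sieve, Finset.powerset_univ, Finset.mul_sum,
    Finset.sum_mul]

theorem sieveWeight_congr {P Q : ℕ → Fin n} (h : ∀ t ≤ k, P t = Q t) :
    sieveWeight V₁ x Y Z k P = sieveWeight V₁ x Y Z k Q := by
  rw [← sum_weight_eq_sieveWeight, ← sum_weight_eq_sieveWeight]
  simp only [weight_congr h]

theorem firstIdx_rev {P : ℕ → Fin n} {i j : ℕ} (hj : j ≤ k) :
    firstIdx V₁ k (fun t => P (rev i j t)) = (firstIdx V₁ k P).image (rev i j) :=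
  filter_rev (Nat.lt_succ_iff.2 hj) fun t => V₁ (P t) = true

/-- Membership is expressed through the unordered edge, so that `edge_rev` applies. -/
theorem secondIdx_eq (P : ℕ → Fin n) : secondIdx V₁ k P =
    (Finset.range k).filter fun t => ∀ v ∈ s(P t, P (t + 1)), V₁ v = false := by
  simp [secondIdx]

theorem secondIdx_rev {P : ℕ → Fin n} {i j : ℕ} (hij : i < j) (hj : j ≤ k) (h : P i = P j) :
    secondIdx V₁ k (fun t => P (rev i j t)) = (secondIdx V₁ k P).image (rev i (j - 1)) := by
  rw [secondIdx_eq, secondIdx_eq, ← filter_rev (by omega)]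
  simp only [edge_rev hij h]

/-- Each of the three factors depends only on the family of edges or of vertices, not on their
order, and reversal merely permutes the indices. -/
theorem sieveWeight_rev {P : ℕ → Fin n} {i j : ℕ} (hij : i < j) (hj : j ≤ k) (h : P i = P j) :
    sieveWeight V₁ x Y Z k (fun t => P (rev i j t)) = sieveWeight V₁ x Y Z k P := by
  simp only [sieveWeight]
  rw [firstIdx_rev hj, secondIdx_rev hij hj h, sieve_image _ _ _ (rev_injective _ _),
    sieve_image _ _ _ (rev_injective _ _)]
  simp only [edge_rev hij h, rev_rev]
  congr 2
  refine Finset.prod_nbij' (rev i (j - 1)) (rev i (j - 1)) ?_ ?_ ?_ ?_ ?_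
  · exact fun t ht => Finset.mem_range.2 ((rev_lt_iff (by omega) t).2 (Finset.mem_range.1 ht))
  · exact fun t ht => Finset.mem_range.2 ((rev_lt_iff (by omega) t).2 (Finset.mem_range.1 ht))
  · exact fun t _ => rev_rev _ _ _
  · exact fun t _ => rev_rev _ _ _
  · exact fun t _ => rfl

/-- Only the turn condition needs care. A turn inside the segment is read backwards, and a turn with
an end of the segment as its middle vertex is harmless because `hV` puts that vertex in `V₂`. In
every other turn all three vertices are unchanged, by `P i = P j` for those that touch the segment.
-/
theorem IsLegit.reverse {P : ℕ → Fin n} (hP : IsLegit G V₁ v₀ k r s P) {i j : ℕ} (hij : i < j)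
    (hj : j ≤ k) (h : P i = P j) (hV : V₁ (P i) = false) :
    IsLegit G V₁ v₀ k r s fun t => P (rev i j t) := by
  refine ⟨?_, fun t ht => ?_, ?_, ?_, fun t ht he hf => ?_⟩
  · by_cases hi : i = 0
    · subst hi
      have : rev 0 j 0 = j := by simp [rev]
      rw [this, ← h, hP.start]
    · have : rev i j 0 = 0 := by unfold rev; split_ifs <;> omega
      rw [this, hP.start]
  · have := hP.adj (rev i (j - 1) t) ((rev_lt_iff (by omega) t).2 ht)
    rw [← SimpleGraph.mem_edgeSet] at this ⊢
    rwa [edge_rev hij h]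
  · rw [firstIdx_rev hj, Finset.card_image_of_injective _ (rev_injective _ _), hP.card_first]
  · rw [secondIdx_rev hij hj h, Finset.card_image_of_injective _ (rev_injective _ _),
      hP.card_second]
  -- In this and the next case the middle vertex of the turn is `P i = P j`, which lies in `V₂`.
  · by_cases h₁ : t + 1 = i
    · have : rev i j (t + 1) = j := by unfold rev; split_ifs <;> omega
      rw [this, ← h, hV]
    by_cases h₂ : t + 1 = j
    · have : rev i j (t + 1) = i := by unfold rev; split_ifs <;> omega
      rw [this, hV]
    by_cases h₃ : i ≤ t ∧ t + 2 ≤ j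
    · have e₀ : rev i j t = i + j - (t + 2) + 2 := by unfold rev; split_ifs <;> omega
      have e₁ : rev i j (t + 1) = i + j - (t + 2) + 1 := by unfold rev; split_ifs <;> omega
      have e₂ : rev i j (t + 2) = i + j - (t + 2) := by unfold rev; split_ifs <;> omega
      rw [e₀, e₂] at he
      rw [e₁]
      refine hP.no_return _ (by omega) he.symm ?_
      rw [he, ← e₀, hf]
    -- Here, and in the case `t = j`, an outer vertex of the turn is an end of the segment, which
    -- holds the same vertex after the reversal.
    by_cases h₄ : t + 2 = i
    · have e₀ : rev i j t = t := by unfold rev; split_ifs <;> omega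
      have e₁ : rev i j (t + 1) = t + 1 := by unfold rev; split_ifs <;> omega
      have e₂ : rev i j (t + 2) = j := by unfold rev; split_ifs <;> omega
      rw [e₀, e₂, ← h, ← h₄] at he
      rw [e₀] at hf
      rw [e₁]
      exact hP.no_return _ ht he hf
    by_cases h₅ : t = j
    · have e₀ : rev i j t = i := by unfold rev; split_ifs <;> omega
      have e₁ : rev i j (t + 1) = t + 1 := by unfold rev; split_ifs <;> omega
      have e₂ : rev i j (t + 2) = t + 2 := by unfold rev; split_ifs <;> omega
      rw [e₀, e₂, h, ← h₅] at he
      rw [e₀, h, ← h₅] at hf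
      rw [e₁]
      exact hP.no_return _ ht he hf
    · have e₀ : rev i j t = t := by unfold rev; split_ifs <;> omega
      have e₁ : rev i j (t + 1) = t + 1 := by unfold rev; split_ifs <;> omega
      have e₂ : rev i j (t + 2) = t + 2 := by unfold rev; split_ifs <;> omega
      rw [e₀, e₂] at he
      rw [e₀] at hf
      rw [e₁]
      exact hP.no_return _ ht he hf

variable [CharP R 2]

/-- There are exactly as many visits to `V₁` as labels, so a repeated vertex would give two equal
linear forms and a vanishing sieve. -/
theorem IsLegit.injOn_first {P : ℕ → Fin n} (hP : IsLegit G V₁ v₀ k r s P)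
    (h₀ : sieveWeight V₁ x Y Z k P ≠ 0) {a b : ℕ} (ha : a ≤ k) (hb : b ≤ k)
    (hV : V₁ (P a) = true) (hab : P a = P b) : a = b := by
  by_contra hne
  apply h₀
  rw [sieveWeight, sieve_eq_zero_of_eq _ (firstIdx V₁ k P) _ (by simp [hP.card_first])
    (i := a) (j := b), mul_zero, zero_mul]
  · simp only [firstIdx, Finset.mem_filter, Finset.mem_range]
    exact ⟨by omega, hV⟩
  · simp only [firstIdx, Finset.mem_filter, Finset.mem_range]
    exact ⟨by omega, hab ▸ hV⟩
  · exact hne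
  · simp [hab]

theorem IsLegit.injOn_second {P : ℕ → Fin n} (hP : IsLegit G V₁ v₀ k r s P)
    (h₀ : sieveWeight V₁ x Y Z k P ≠ 0) {a b : ℕ} (ha : a ∈ secondIdx V₁ k P)
    (hb : b ∈ secondIdx V₁ k P) (hab : s(P a, P (a + 1)) = s(P b, P (b + 1))) : a = b := by
  by_contra hne
  apply h₀
  rw [sieveWeight, sieve_eq_zero_of_eq _ (secondIdx V₁ k P) _ (by simp [hP.card_second]) ha hb hne,
    mul_zero]
  simp only [hab]

/-- The reversed segment differs from the original one. -/
theorem IsLegit.exists_rev_ne {P : ℕ → Fin n} (hP : IsLegit G V₁ v₀ k r s P)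
    (h₀ : sieveWeight V₁ x Y Z k P ≠ 0) {i j : ℕ} (hij : i < j) (hj : j ≤ k) :
    ∃ t ≤ k, P (rev i j t) ≠ P t := by
  by_contra! hc
  -- Suppose the segment is a palindrome. If `i + j` is even, its centre is a turn `P d, P (d + 1),
  -- P (d + 2)` with equal outer vertices.
  rcases Nat.even_or_odd' (i + j) with ⟨c, hc' | hc'⟩
  · obtain ⟨d, rfl⟩ : ∃ d, c = d + 1 := ⟨c - 1, by omega⟩
    have e : rev i j d = d + 2 := by unfold rev; split_ifs <;> omega
    have hd := hc d (by omega)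
    rw [e] at hd
    cases h₁ : V₁ (P d)
    -- With the outer vertex in `V₂`, legitimacy puts the middle vertex in `V₂` as well, and the
    -- same edge of `E₂` is used twice in a row.
    · have h₂ := hP.no_return d (by omega) hd h₁
      have : d = d + 1 := by
        refine hP.injOn_second h₀ ?_ ?_ ?_
        · simp only [secondIdx, Finset.mem_filter, Finset.mem_range]
          exact ⟨by omega, h₁, h₂⟩
        · simp only [secondIdx, Finset.mem_filter, Finset.mem_range]
          exact ⟨by omega, h₂, by rw [hd, h₁]⟩
        · rw [hd, Sym2.eq_swap]
      omega
    · have := hP.injOn_first h₀ (a := d) (b := d + 2) (by omega) (by omega) h₁ hd.symm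
      omega
  -- If `i + j` is odd, the two central vertices are adjacent and equal.
  · have e : rev i j c = c + 1 := by unfold rev; split_ifs <;> omega
    have hd := hc c (by omega)
    rw [e] at hd
    exact (hP.adj c (by omega)).ne hd.symm

open Classical in
/-- In characteristic two, the contributions of the walks that are not simple cancel. -/
theorem sum_sieveWeight_eq :
    ∑ p : Fin (k + 1) → Fin n with IsLegit G V₁ v₀ k r s (extend p),
      sieveWeight V₁ x Y Z k (extend p) =
    ∑ p : Fin (k + 1) → Fin n with IsLegit G V₁ v₀ k r s (extend p) ∧ Function.Injective p,
      sieveWeight V₁ x Y Z k (extend p) := by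
  rw [← Finset.sum_filter_add_sum_filter_not _ fun p => Function.Injective p, Finset.filter_filter]
  convert add_zero _ using 2
  -- Walks with vanishing sieve are discarded beforehand. Only for the others is the repeated vertex
  -- known to lie in `V₂` and the reversal known to change the walk.
  rw [← Finset.sum_filter_ne_zero]
  have hrep : ∀ p : Fin (k + 1) → Fin n, ¬ Function.Injective p →
      ∃ i j, IsRepeat k (extend p) i j := by
    intro p hp
    simp only [Function.Injective, not_forall] at hp
    obtain ⟨a, b, hab, hne⟩ := hp
    rw [← extend_val p a, ← extend_val p b] at hab
    rcases Nat.lt_or_ge a b with h | h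
    · exact exists_isRepeat h (by omega) hab
    · exact exists_isRepeat (lt_of_le_of_ne h fun e => hne (Fin.ext e.symm)) (by omega) hab.symm
  have hV : ∀ p : Fin (k + 1) → Fin n, IsLegit G V₁ v₀ k r s (extend p) →
      sieveWeight V₁ x Y Z k (extend p) ≠ 0 → ∀ i j, IsRepeat k (extend p) i j →
      V₁ (extend p i) = false := by
    intro p hp h₀ i j hij
    by_contra h
    have h₁ := hij.lt
    have h₂ := hij.le
    exact h₁.ne (hp.injOn_first h₀ (by omega) h₂ (by simpa using h) hij.eq)
  have hw : ∀ p : Fin (k + 1) → Fin n, ∀ i j, IsRepeat k (extend p) i j →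
      sieveWeight V₁ x Y Z k (extend (flip p)) = sieveWeight V₁ x Y Z k (extend p) := by
    intro p i j hij
    rw [sieveWeight_congr fun t ht => extend_flip hij ht, sieveWeight_rev hij.lt hij.le hij.eq]
  refine Finset.sum_involution (fun p _ => flip p) ?_ ?_ ?_ ?_
  · intro p hp
    simp only [Finset.mem_filter, Finset.mem_univ, true_and] at hp
    obtain ⟨i, j, hij⟩ := hrep p hp.1.2
    simp only [hw p i j hij, CharTwo.add_self_eq_zero]
  · intro p hp h₀ he
    simp only [Finset.mem_filter, Finset.mem_univ, true_and] at hp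
    obtain ⟨i, j, hij⟩ := hrep p hp.1.2
    obtain ⟨t, ht, hne⟩ := hp.1.1.exists_rev_ne h₀ hij.lt hij.le
    rw [← extend_flip hij ht, he] at hne
    exact hne rfl
  · intro p hp
    simp only [Finset.mem_filter, Finset.mem_univ, true_and] at hp ⊢
    obtain ⟨i, j, hij⟩ := hrep p hp.1.2
    refine ⟨⟨?_, fun hinj => ?_⟩, by rw [hw p i j hij]; exact hp.2⟩
    · rw [isLegit_congr fun t ht => extend_flip hij ht]
      exact hp.1.1.reverse hij.lt hij.le hij.eq (hV p hp.1.1 hp.2 i j hij)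
    · have h' := isRepeat_flip hij
      have h₁ := h'.lt
      have h₂ := h'.le
      have := congrArg Fin.val (hinj (a₁ := ⟨min i k, by omega⟩) (a₂ := ⟨min j k, by omega⟩) h'.eq)
      simp only at this
      omega
  · intro p hp
    simp only [Finset.mem_filter, Finset.mem_univ, true_and] at hp
    obtain ⟨i, j, hij⟩ := hrep p hp.1.2
    exact flip_flip hij

end Cancellation

/-! ## The polynomial identity test -/

section Test

open Prog

variable {n : ℕ} {R : Type} [CommRing R] {G : SimpleGraph (Fin n)} {V₁ : Fin n → Bool}
  {v₀ : Fin n} {k r s : ℕ}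

open Classical in
/-- The value of `φ f` at the point `(x, Y, Z)`. -/
noncomputable def phi (G : SimpleGraph (Fin n)) (V₁ : Fin n → Bool) (v₀ : Fin n) (k : ℕ)
    (x : Sym2 (Fin n) → R) (Y : Fin r → Fin n → R) (Z : Fin s → Sym2 (Fin n) → R) : R :=
  ∑ S : Finset (Fin s), ∑ T : Finset (Fin r),
    ∑ p : Fin (k + 1) → Fin n with IsLegit G V₁ v₀ k r s (extend p),
      weight V₁ (assign x (fun v => ∑ i ∈ T, Y i v) (fun e => ∑ j ∈ S, Z j e)) k (extend p)

-- Exchanging the sums performs the sieving walk by walk, after which the walks that are not simple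
-- cancel.
open Classical in
theorem phi_eq_sum_simple [CharP R 2] (x : Sym2 (Fin n) → R) (Y : Fin r → Fin n → R)
    (Z : Fin s → Sym2 (Fin n) → R) : phi G V₁ v₀ k x Y Z =
      ∑ p : Fin (k + 1) → Fin n with IsLegit G V₁ v₀ k r s (extend p) ∧ Function.Injective p,
        sieveWeight V₁ x Y Z k (extend p) := by
  rw [← sum_sieveWeight_eq, phi]
  simp only [← sum_weight_eq_sieveWeight]
  rw [Finset.sum_congr rfl fun S _ => Finset.sum_comm, Finset.sum_comm]

/-- As `phi` makes sense over every commutative ring, one expression serves both as the polynomial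
`φ f` and as its value at a point. This compatibility links the two. -/
theorem map_phi {R' : Type} [CommRing R'] (φ : R →+* R') (x : Sym2 (Fin n) → R)
    (Y : Fin r → Fin n → R) (Z : Fin s → Sym2 (Fin n) → R) :
    φ (phi G V₁ v₀ k x Y Z) =
      phi G V₁ v₀ k (fun e => φ (x e)) (fun i v => φ (Y i v)) (fun j e => φ (Z j e)) := by
  simp only [phi, weight, assign, map_sum, map_prod, map_mul]

/-- A simple path that starts from `v₀` is determined by its edges. -/
theorem eq_of_edges_subset {P Q : ℕ → Fin n} (hP : Set.InjOn P (Set.Iic k))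
    (hQ : Set.InjOn Q (Set.Iic k)) (h₀ : P 0 = Q 0)
    (h : ∀ t < k, ∃ u < k, s(Q t, Q (t + 1)) = s(P u, P (u + 1))) {t : ℕ} (ht : t ≤ k) :
    P t = Q t := by
  induction t using Nat.strong_induction_on with
  | _ t ih =>
    rcases t with _ | t
    · exact h₀
    · obtain ⟨u, hu, he⟩ := h t (by omega)
      rw [← ih t (by omega) (by omega), Sym2.eq_iff] at he
      rcases he with ⟨h₁, h₂⟩ | ⟨h₁, h₂⟩
      · have : t = u := hP (Set.mem_Iic.2 (by omega)) (Set.mem_Iic.2 (by omega)) h₁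
        rw [h₂, this]
      -- In the opposite orientation `Q` would step back to `P u = Q u` with `u + 1 = t`, so it
      -- would visit a vertex twice.
      · have : t = u + 1 := hP (Set.mem_Iic.2 (by omega)) (Set.mem_Iic.2 (by omega)) h₁
        rw [ih u (by omega) (by omega)] at h₂
        have := hQ (Set.mem_Iic.2 (by omega)) (Set.mem_Iic.2 (by omega)) h₂
        omega

theorem injOn_extend {p : Fin (k + 1) → Fin n} (hp : Function.Injective p) :
    Set.InjOn (extend p) (Set.Iic k) := by
  intro a ha b hb hab
  have ha' := Set.mem_Iic.1 ha
  have hb' := Set.mem_Iic.1 hb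
  have := congrArg Fin.val (hp hab)
  simp only at this
  omega

theorem injOn_edges {P : ℕ → Fin n} (hP : Set.InjOn P (Set.Iic k)) {a b : ℕ} (ha : a < k)
    (hb : b < k) (h : s(P a, P (a + 1)) = s(P b, P (b + 1))) : a = b := by
  rw [Sym2.eq_iff] at h
  rcases h with ⟨h₁, -⟩ | ⟨h₁, h₂⟩
  · exact hP (Set.mem_Iic.2 (by omega)) (Set.mem_Iic.2 (by omega)) h₁
  · have e₁ := hP (Set.mem_Iic.2 (by omega)) (Set.mem_Iic.2 (by omega)) h₁
    have e₂ := hP (Set.mem_Iic.2 (by omega)) (Set.mem_Iic.2 (by omega)) h₂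
    omega

/-- If there is a legitimate simple path, then `φ f` does not vanish identically. -/
theorem exists_phi_eq_one [CharP R 2] {p : Fin (k + 1) → Fin n}
    (hp : IsLegit G V₁ v₀ k r s (extend p)) (hinj : Function.Injective p) :
    ∃ (x : Sym2 (Fin n) → R) (Y : Fin r → Fin n → R) (Z : Fin s → Sym2 (Fin n) → R),
      phi G V₁ v₀ k x Y Z = 1 := by
  classical
  have hP := injOn_extend hinj
  obtain ⟨Y, hY⟩ := exists_sieve_eq_one (R := R) (firstIdx V₁ k (extend p)) (extend p)
    (hP.mono fun t ht => by
      have := Finset.mem_range.1 (Finset.mem_filter.1 ht).1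
      exact Set.mem_Iic.2 (by omega)) hp.card_first
  obtain ⟨Z, hZ⟩ := exists_sieve_eq_one (R := R) (secondIdx V₁ k (extend p))
    (fun t => s(extend p t, extend p (t + 1)))
    (fun a ha b hb h => injOn_edges hP (Finset.mem_range.1 (Finset.mem_filter.1 ha).1)
      (Finset.mem_range.1 (Finset.mem_filter.1 hb).1) h) hp.card_second
  -- With `x` the indicator of the edges of `p`, every other simple path from `v₀` contains an edge
  -- of weight zero, by `eq_of_edges_subset`. The choices of `Y` and `Z` are possible because the
  -- vertices and the edges of `p` are distinct.
  refine ⟨fun e => if ∃ u < k, e = s(extend p u, extend p (u + 1)) then 1 else 0, Y, Z, ?_⟩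
  rw [phi_eq_sum_simple, Finset.sum_eq_single p]
  · rw [sieveWeight, hY, hZ, mul_one, mul_one]
    exact Finset.prod_eq_one fun t ht => if_pos ⟨t, Finset.mem_range.1 ht, rfl⟩
  · intro q hq hne
    obtain ⟨hq, hq'⟩ := (Finset.mem_filter.1 hq).2
    by_cases hall : ∀ t < k, ∃ u < k,
        s(extend q t, extend q (t + 1)) = s(extend p u, extend p (u + 1))
    · refine absurd ?_ hne
      funext t
      rw [← extend_val p t, ← extend_val q t]
      exact (eq_of_edges_subset hP (injOn_extend hq') (by rw [hp.start, hq.start]) hall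
        (by omega)).symm
    · push Not at hall
      obtain ⟨t, ht, hall⟩ := hall
      rw [sieveWeight, Finset.prod_eq_zero (Finset.mem_range.2 ht), zero_mul, zero_mul]
      rw [if_neg]
      rintro ⟨u, hu, he⟩
      exact hall u hu he
  · intro h
    exact absurd (Finset.mem_filter.2 ⟨Finset.mem_univ _, hp, hinj⟩) h

/-! ### Degree and zeros of the polynomial `φ f` -/

/-- The coordinates of the points `(x, Y, Z)`. -/
abbrev Coord (n r s : ℕ) : Type := Sym2 (Fin n) ⊕ (Fin r × Fin n) ⊕ (Fin s × Sym2 (Fin n))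

/-- The polynomial `φ f`. -/
noncomputable def phiPoly (R : Type) [CommRing R] (G : SimpleGraph (Fin n)) (V₁ : Fin n → Bool)
    (v₀ : Fin n) (k r s : ℕ) : MvPolynomial (Coord n r s) R :=
  phi G V₁ v₀ k (fun e => .X (.inl e)) (fun i v => .X (.inr (.inl (i, v))))
    (fun j e => .X (.inr (.inr (j, e))))

theorem eval_phiPoly (f : Coord n r s → R) :
    (phiPoly R G V₁ v₀ k r s).eval f = phi G V₁ v₀ k (fun e => f (.inl e))
      (fun i v => f (.inr (.inl (i, v)))) (fun j e => f (.inr (.inr (j, e)))) := by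
  rw [phiPoly, map_phi]
  simp only [MvPolynomial.eval_X]

/-- Each walk contributes a product of `k + r + s` linear forms: one per edge, one per visit to
`V₁`, one per edge in `E₂`. -/
theorem totalDegree_phiPoly_le [Nontrivial R] :
    (phiPoly R G V₁ v₀ k r s).totalDegree ≤ k + r + s := by
  classical
  refine MvPolynomial.totalDegree_finsetSum_le fun S _ =>
    MvPolynomial.totalDegree_finsetSum_le fun T _ =>
    MvPolynomial.totalDegree_finsetSum_le fun p hp => ?_
  have hp := (Finset.mem_filter.1 hp).2
  have hprod : ∀ (I : Finset ℕ) (g : ℕ → MvPolynomial (Coord n r s) R),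
      (∀ i, (g i).totalDegree ≤ 1) → (∏ i ∈ I, g i).totalDegree ≤ I.card := fun I g hg =>
    (MvPolynomial.totalDegree_finsetProd I g).trans
      ((Finset.sum_le_card_nsmul I _ 1 fun i _ => hg i).trans (by simp))
  refine (MvPolynomial.totalDegree_mul _ _).trans (add_le_add
    ((MvPolynomial.totalDegree_mul _ _).trans (add_le_add ?_ ?_)) ?_)
  · refine (hprod _ _ fun t => ?_).trans (Finset.card_range k).le
    simp [assign]
  · refine (hprod _ _ fun t => ?_).trans hp.card_first.le
    exact MvPolynomial.totalDegree_finsetSum_le fun i _ => (MvPolynomial.totalDegree_X _).le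
  · refine (hprod _ _ fun t => ?_).trans hp.card_second.le
    exact MvPolynomial.totalDegree_finsetSum_le fun i _ => (MvPolynomial.totalDegree_X _).le

/-- The Schwartz-Zippel lemma with the whole field as sample set, stated without denominators. The
variables are numbered by `e`. -/
theorem card_zeros_le {σ F : Type} [Fintype σ] [DecidableEq σ] [Field F] [Fintype F] [DecidableEq F]
    {P : MvPolynomial σ F} (hP : P ≠ 0) :
    (Finset.univ.filter fun f : σ → F => P.eval f = 0).card * Fintype.card F ≤
      P.totalDegree * Fintype.card F ^ Fintype.card σ := by
  classical
  let e := Fintype.equivFin σ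
  have hP' : MvPolynomial.rename e P ≠ 0 := fun h =>
    hP (MvPolynomial.rename_injective e e.injective (h.trans (map_zero _).symm))
  have h := MvPolynomial.schwartz_zippel_totalDegree hP' Finset.univ
  rw [Fintype.piFinset_univ, Finset.card_univ] at h
  have hq : (0 : ℚ≥0) < Fintype.card F := by exact_mod_cast Fintype.card_pos
  rw [div_le_div_iff₀ (by positivity) hq] at h
  have hc : (Finset.univ.filter fun f : σ → F => P.eval f = 0).card =
      (Finset.univ.filter fun f : Fin (Fintype.card σ) → F =>
        (MvPolynomial.rename e P).eval f = 0).card := by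
    refine Finset.card_equiv (Equiv.arrowCongr e (Equiv.refl F)) fun f => ?_
    simp only [Finset.mem_filter, Finset.mem_univ, true_and, MvPolynomial.eval_rename]
    have : ((Equiv.arrowCongr e (Equiv.refl F)) f) ∘ e = f := by funext i; simp [Equiv.arrowCongr]
    rw [this]
  rw [hc]
  have h' : (Finset.univ.filter fun f : Fin (Fintype.card σ) → F =>
        (MvPolynomial.rename e P).eval f = 0).card * Fintype.card F ≤
      (MvPolynomial.rename e P).totalDegree * Fintype.card F ^ Fintype.card σ := by
    exact_mod_cast h
  exact h'.trans (Nat.mul_le_mul_right _ (MvPolynomial.totalDegree_rename_le _ _))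

open Classical in
theorem card_phi_zeros_le {F : Type} [Field F] [Fintype F] [CharP F 2]
    {p : Fin (k + 1) → Fin n} (hp : IsLegit G V₁ v₀ k r s (extend p))
    (hinj : Function.Injective p) :
    (Finset.univ.filter fun a : (Sym2 (Fin n) → F) × (Fin r → Fin n → F) ×
        (Fin s → Sym2 (Fin n) → F) => phi G V₁ v₀ k a.1 a.2.1 a.2.2 = 0).card * Fintype.card F ≤
      (k + r + s) * Fintype.card ((Sym2 (Fin n) → F) × (Fin r → Fin n → F) ×
        (Fin s → Sym2 (Fin n) → F)) := by
  have e : Fintype.card ((Sym2 (Fin n) → F) × (Fin r → Fin n → F) ×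
        (Fin s → Sym2 (Fin n) → F)) = Fintype.card F ^ Fintype.card (Coord n r s) := by
    simp only [Fintype.card_prod, Fintype.card_sum, Fintype.card_fun, pow_add, ← pow_mul,
      Fintype.card_fin, mul_comm]
  let ψ : (Sym2 (Fin n) → F) × (Fin r → Fin n → F) × (Fin s → Sym2 (Fin n) → F) →
      Coord n r s → F := fun a => Sum.elim a.1 (Sum.elim (fun i => a.2.1 i.1 i.2)
        fun i => a.2.2 i.1 i.2)
  have hψ : Function.Injective ψ := by
    rintro ⟨x, Y, Z⟩ ⟨x', Y', Z'⟩ h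
    refine Prod.ext (funext fun e => congrFun h (.inl e)) (Prod.ext ?_ ?_)
    · exact funext fun i => funext fun v => congrFun h (.inr (.inl (i, v)))
    · exact funext fun i => funext fun v => congrFun h (.inr (.inr (i, v)))
  have heval : ∀ a, (phiPoly F G V₁ v₀ k r s).eval (ψ a) = phi G V₁ v₀ k a.1 a.2.1 a.2.2 :=
    fun a => eval_phiPoly _
  have hne : phiPoly F G V₁ v₀ k r s ≠ 0 := by
    obtain ⟨x, Y, Z, h⟩ := exists_phi_eq_one (R := F) hp hinj
    intro h₀
    have := heval (x, Y, Z)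
    rw [h₀, map_zero, h] at this
    exact zero_ne_one this
  rw [e]
  refine le_trans (Nat.mul_le_mul_right _ ?_)
    ((card_zeros_le hne).trans (Nat.mul_le_mul_right _ totalDegree_phiPoly_le))
  refine Finset.card_le_card_of_injOn ψ (fun a ha => ?_) hψ.injOn
  have := (Finset.mem_filter.1 ha).2
  simpa [heval] using this

/-! ### The result of the test -/

/-- The sublists of a list without duplicates run through its subsets exactly once. -/
theorem sum_sublists {M α : Type} [AddCommMonoid M] [DecidableEq α] {l : List α} (hl : l.Nodup)
    (H : Finset α → M) :
    (l.sublists.map fun L => H L.toFinset).sum = ∑ S ∈ l.toFinset.powerset, H S := by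
  induction l generalizing H with
  | nil => simp
  | cons a l ih =>
    obtain ⟨ha, hl⟩ := List.nodup_cons.1 hl
    rw [((List.sublists_cons_perm_append a l).map _).sum_eq, List.map_append, List.sum_append,
      List.map_map, ih hl, List.toFinset_cons, Finset.sum_powerset_insert (by simpa using ha),
      ← ih hl fun S => H (insert a S)]
    simp [Function.comp_def]

theorem foldl_add {M α : Type} [AddMonoid M] (f : α → M) (l : List α) (c : M) :
    l.foldl (fun a i => a + f i) c = c + (l.map f).sum := by
  induction l generalizing c with
  | nil => simp
  | cons i l ih => simp [ih, add_assoc]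

variable {m : ℕ}

theorem ensures_sumArray {ι : Type} [DecidableEq ι] {q : ℕ} {l : List ι} (hl : ∀ i, i ∈ l)
    (Y : Fin q → ι → GaloisField 2 m) (L : List (Fin q)) :
    (sumArray l Y L).Ensures G fun t => t = fun a => (L.map fun i => Y i a).sum := by
  refine (ensures_tabulate (Q := fun a b => b = (L.map fun i => Y i a).sum) (fun a => ?_) l).mono
    fun t ht => funext fun a => ht a (hl a)
  refine (ensures_fold (g := fun c i => c + Y i a) (fun c i => ensures_fadd _ _) L 0).mono
    fun b hb => ?_
  rw [hb, foldl_add, zero_add]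

theorem mem_pairs (e : Sym2 (Fin n)) : e ∈ pairs n := by
  rw [pairs, List.mem_sym2_iff]
  exact fun y _ => List.mem_finRange y

theorem nodup_pairs : (pairs n).Nodup := (List.nodup_finRange n).sym2

/-- The sum of the values of the circuit at the points `(x, ∑_{i ∈ R} Y i, ∑_{j ∈ S} Z j)`. -/
noncomputable def phiCircuit (C : Circuit n) (x : Sym2 (Fin n) → GaloisField 2 m)
    (Y : Fin r → Fin n → GaloisField 2 m) (Z : Fin s → Sym2 (Fin n) → GaloisField 2 m) :
    GaloisField 2 m :=
  ∑ S : Finset (Fin s), ∑ T : Finset (Fin r),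
    Circuit.eval (assign x (fun v => ∑ i ∈ T, Y i v) (fun e => ∑ j ∈ S, Z j e)) (fun _ => 0) C .out

/-- The deterministic part of the test. -/
def phiEval {F : Type} [Zero F] (C : Circuit n) (x : Sym2 (Fin n) → F) (Y : Fin r → Fin n → F)
    (Z : Fin s → Sym2 (Fin n) → F) : Prog n F Bool := do
  let total ← fold (List.finRange s).sublists 0 fun acc S => do
    let z ← sumArray (pairs n) Z S
    fold (List.finRange r).sublists acc fun acc R => do
      let y ← sumArray (List.finRange n) Y R
      let a ← evalCircuit C (assign x y z)
      exec (.fadd acc a)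
  let isZero ← exec (.fzero total)
  pure (!isZero)

theorem phiTest_eq {F : Type} [Zero F] (C : Circuit n) : phiTest (F := F) r s C =
    tabulate 0 (pairs n) (fun _ => exec .rand) >>= fun x =>
    tabulate (fun _ => 0) (List.finRange r) (fun _ =>
      tabulate 0 (List.finRange n) fun _ => exec .rand) >>= fun Y =>
    tabulate (fun _ => 0) (List.finRange s) (fun _ =>
      tabulate 0 (pairs n) fun _ => exec .rand) >>= fun Z => phiEval C x Y Z := rfl

theorem ensures_phiEval (C : Circuit n) (x : Sym2 (Fin n) → GaloisField 2 m)
    (Y : Fin r → Fin n → GaloisField 2 m) (Z : Fin s → Sym2 (Fin n) → GaloisField 2 m) :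
    (phiEval C x Y Z).Ensures G fun b => b = true ↔ phiCircuit C x Y Z ≠ 0 := by
  let E : List (Fin s) → List (Fin r) → GaloisField 2 m := fun S T =>
    Circuit.eval (assign x (fun v => (T.map fun i => Y i v).sum)
      (fun e => (S.map fun j => Z j e).sum)) (fun _ => 0) C .out
  have h := ensures_fold (G := G) (f := fun (acc : GaloisField 2 m) S => do
    let z ← sumArray (pairs n) Z S
    fold (List.finRange r).sublists acc fun acc R => do
      let y ← sumArray (List.finRange n) Y R
      let a ← evalCircuit C (assign x y z)
      exec (.fadd acc a))
    (g := fun acc S => acc + ((List.finRange r).sublists.map fun T => E S T).sum)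
    (fun acc S => ?_) (List.finRange s).sublists 0
  swap
  · refine (ensures_sumArray mem_pairs Z S).bind fun z hz => ?_
    refine (ensures_fold (g := fun acc T => acc + E S T) (fun acc T => ?_) _ _).mono fun b hb => ?_
    · refine (ensures_sumArray List.mem_finRange Y T).bind fun y hy =>
        (ensures_evalCircuit C).bind fun a ha => (ensures_fadd _ _).mono fun b hb => ?_
      rw [hb, ha, hy, hz]
    · rw [hb, foldl_add]
  refine h.bind fun total ht => (ensures_fzero total).bind fun b hb => ensures_pure ?_
  rw [foldl_add, zero_add] at ht
  have hT : total = phiCircuit C x Y Z := by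
    let H : Finset (Fin s) → Finset (Fin r) → GaloisField 2 m := fun S T =>
      Circuit.eval (assign x (fun v => ∑ i ∈ T, Y i v) (fun e => ∑ j ∈ S, Z j e)) (fun _ => 0)
        C .out
    have hE : ∀ S ∈ (List.finRange s).sublists, ∀ T ∈ (List.finRange r).sublists,
        E S T = H S.toFinset T.toFinset := by
      intro S hS T hT
      have hS' : S.Nodup := (List.mem_sublists.1 hS).nodup (List.nodup_finRange s)
      have hT' : T.Nodup := (List.mem_sublists.1 hT).nodup (List.nodup_finRange r)
      simp only [E, H, List.sum_toFinset _ hS', List.sum_toFinset _ hT']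
    rw [ht, List.map_congr_left fun S hS => congrArg List.sum (List.map_congr_left (hE S hS))]
    simp only [sum_sublists (List.nodup_finRange r)]
    rw [sum_sublists (List.nodup_finRange s) fun S => ∑ T ∈ (List.finRange r).toFinset.powerset,
      H S T]
    simp only [List.toFinset_finRange, Finset.powerset_univ]
    rfl
  rw [← hT]
  cases b
  · simpa using hb
  · simpa using hb

theorem phiCircuit_eq_phi {C : Circuit n} (hC : ∀ ρ : Var n → GaloisField 2 m,
    Circuit.eval ρ (fun _ => 0) C .out = ∑ u₁, ∑ u₂, walkSum G V₁ v₀ ρ k r s u₁ u₂)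
    (x : Sym2 (Fin n) → GaloisField 2 m) (Y : Fin r → Fin n → GaloisField 2 m)
    (Z : Fin s → Sym2 (Fin n) → GaloisField 2 m) :
    phiCircuit C x Y Z = phi G V₁ v₀ k x Y Z := by
  simp only [phiCircuit, hC, sum_walkSum, phi]

/-- The probability of `b` is an average, over the possible values of `p`, of numbers that are at
least `c`. -/
theorem Prog.le_dist_bind {α β : Type} {p : Prog n (GaloisField 2 m) α}
    {f : α → Prog n (GaloisField 2 m) β} {Q : α → Prop} (hp : p.Ensures G Q) {b : β} {c : ENNReal}
    (h : ∀ a, Q a → c ≤ (f a).dist G b) : c ≤ (p >>= f).dist G b := by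
  rw [dist_bind, PMF.bind_apply]
  calc c = ∑' a, p.dist G a * c := by rw [ENNReal.tsum_mul_right, PMF.tsum_coe, one_mul]
    _ ≤ _ := ENNReal.tsum_le_tsum fun a => ?_
  by_cases ha : p.dist G a = 0
  · simp [ha]
  · exact mul_le_mul_right (h a (ensures_iff.1 hp a ((PMF.mem_support_iff _ _).2 ha))) _

theorem PMF.bool_add (p : PMF Bool) : p true + p false = 1 := by
  rw [add_comm, ← p.tsum_coe, tsum_bool]

theorem dist_rand (a : GaloisField 2 m) :
    (exec (.rand : Instr n (GaloisField 2 m) _)).dist G a =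
      (Nat.card (GaloisField 2 m) : ENNReal)⁻¹ := by
  let := Fintype.ofFinite (GaloisField 2 m)
  rw [dist_exec, Nat.card_eq_fintype_card]
  exact PMF.uniformOfFintype_apply a

theorem card_galoisField (hm : m ≠ 0) : Nat.card (GaloisField 2 m) = 2 ^ m := GaloisField.card 2 m hm

/-- The test draws one of `N` points uniformly and fails exactly on the `z` zeros of `φ f`. With `q`
the size of the field, `z * q ≤ (k + r + s) * N` and `4 * (k + r + s) ≤ q`, so `4 * z ≤ N`. -/
theorem dist_phiTest_le (hk : 4 * (k + r + s) ≤ Nat.card (GaloisField 2 m)) {C : Circuit n}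
    (hC : ∀ ρ : Var n → GaloisField 2 m,
      Circuit.eval ρ (fun _ => 0) C .out = ∑ u₁, ∑ u₂, walkSum G V₁ v₀ ρ k r s u₁ u₂)
    {p : Fin (k + 1) → Fin n} (hp : IsLegit G V₁ v₀ k r s (extend p))
    (hinj : Function.Injective p) :
    (phiTest (F := GaloisField 2 m) r s C).dist G false ≤ 1 / 4 := by
  classical
  let := Fintype.ofFinite (GaloisField 2 m)
  set q := Nat.card (GaloisField 2 m) with hq
  have hq' : q = Fintype.card (GaloisField 2 m) := Nat.card_eq_fintype_card
  have hb : ∀ (x : Sym2 (Fin n) → GaloisField 2 m) (Y : Fin r → Fin n → GaloisField 2 m)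
      (Z : Fin s → Sym2 (Fin n) → GaloisField 2 m), (phiEval C x Y Z).dist G false =
      if phi G V₁ v₀ k x Y Z = 0 then 1 else 0 := by
    intro x Y Z
    have h := ensures_phiEval (G := G) C x Y Z
    rw [phiCircuit_eq_phi hC] at h
    have : (phiEval C x Y Z).Ensures G fun b => b = decide (phi G V₁ v₀ k x Y Z ≠ 0) :=
      h.mono fun b hb => by rw [Bool.eq_iff_iff, hb]; simp
    rw [this.dist_eq, PMF.pure_apply]
    simp
  rw [phiTest_eq]
  simp only [dist_bind, PMF.bind_apply, tsum_fintype, hb,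
    dist_tabulate_of_complete _ _ nodup_pairs mem_pairs,
    dist_tabulate_of_complete _ _ (List.nodup_finRange _) List.mem_finRange, dist_rand,
    Finset.prod_const, Finset.card_univ, Fintype.card_fin]
  simp only [← Finset.mul_sum, ← mul_assoc]
  have hsum : (∑ x : Sym2 (Fin n) → GaloisField 2 m, ∑ Y : Fin r → Fin n → GaloisField 2 m,
      ∑ Z : Fin s → Sym2 (Fin n) → GaloisField 2 m,
        if phi G V₁ v₀ k x Y Z = 0 then (1 : ENNReal) else 0) =
      ((Finset.univ.filter fun a : (Sym2 (Fin n) → GaloisField 2 m) ×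
        (Fin r → Fin n → GaloisField 2 m) × (Fin s → Sym2 (Fin n) → GaloisField 2 m) =>
          phi G V₁ v₀ k a.1 a.2.1 a.2.2 = 0).card : ENNReal) := by
    rw [Finset.card_filter, Nat.cast_sum, Fintype.sum_prod_type]
    simp only [Fintype.sum_prod_type]
    push_cast
    rfl
  have hz := card_phi_zeros_le (F := GaloisField 2 m) hp hinj
  rw [hsum]
  set z := (Finset.univ.filter fun a : (Sym2 (Fin n) → GaloisField 2 m) ×
        (Fin r → Fin n → GaloisField 2 m) × (Fin s → Sym2 (Fin n) → GaloisField 2 m) =>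
          phi G V₁ v₀ k a.1 a.2.1 a.2.2 = 0).card
  rw [← hq'] at hz
  set N := Fintype.card ((Sym2 (Fin n) → GaloisField 2 m) ×
        (Fin r → Fin n → GaloisField 2 m) × (Fin s → Sym2 (Fin n) → GaloisField 2 m)) with hN
  have hNq : N = q ^ Fintype.card (Sym2 (Fin n)) * ((q ^ n) ^ r *
      (q ^ Fintype.card (Sym2 (Fin n))) ^ s) := by
    rw [hN, hq']
    simp only [Fintype.card_prod, Fintype.card_fun, Fintype.card_fin]
  have hq0 : 0 < q := Nat.card_pos
  have h4 : 4 * z ≤ N := by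
    have : q * (4 * z) ≤ q * N := by
      calc q * (4 * z) = 4 * (z * q) := by ring
        _ ≤ 4 * ((k + r + s) * N) := Nat.mul_le_mul_left _ hz
        _ = 4 * (k + r + s) * N := by ring
        _ ≤ q * N := Nat.mul_le_mul_right _ hk
    exact Nat.le_of_mul_le_mul_left this hq0
  -- The product of the probabilities of the independent entries is the uniform weight `1 / N`.
  have hinv : ((q : ENNReal)⁻¹ ^ Fintype.card (Sym2 (Fin n)) * ((q : ENNReal)⁻¹ ^ n) ^ r *
      ((q : ENNReal)⁻¹ ^ Fintype.card (Sym2 (Fin n))) ^ s) = (N : ENNReal)⁻¹ := by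
    rw [hNq]
    push_cast
    simp only [← ENNReal.inv_pow]
    rw [ENNReal.mul_inv (Or.inr (by finiteness)) (Or.inl (by finiteness)),
      ENNReal.mul_inv (Or.inr (by finiteness)) (Or.inl (by finiteness)), mul_assoc]
  have hN0 : N ≠ 0 := by rw [hNq]; positivity
  rw [hinv, mul_comm, ← div_eq_mul_inv]
  refine ENNReal.div_le_of_le_mul ?_
  rw [one_div, mul_comm, ← div_eq_mul_inv, ENNReal.le_div_iff_mul_le (by simp) (by simp), mul_comm]
  exact_mod_cast h4

end Test

/-! ## The number of partitions for which a given path is legitimate -/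

section Patterns

/-- The number of patterns of length `k + 1` that start in `V₁`, end in the part given by `c`, have
`r` entries in `V₁`, and `s` pairs of consecutive entries in `V₂`. -/
def patternCount (k r s : ℕ) (c : Bool) : ℕ :=
  ∑ b : Fin (k + 1) → Bool, if extend b 0 = true ∧ (firstIdx id k (extend b)).card = r ∧
    (secondIdx id k (extend b)).card = s ∧ extend b k = c then 1 else 0

theorem patternCount_succ (k r s : ℕ) (c : Bool) : patternCount (k + 1) r s c =
    ∑ b : Fin (k + 1) → Bool, if extend b 0 = true ∧
      (firstIdx id k (extend b)).card + (if c then 1 else 0) = r ∧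
      (secondIdx id k (extend b)).card + (if extend b k = false ∧ c = false then 1 else 0) = s
      then 1 else 0 := by
  rw [patternCount, sum_eq_sum_snoc]
  refine Finset.sum_congr rfl fun q _ => ?_
  rw [Finset.sum_eq_single c]
  · have e : ∀ t ≤ k, extend (Fin.snoc q c : Fin (k + 1 + 1) → Bool) t = extend q t :=
      fun t ht => extend_snoc_of_le q c ht
    rw [card_firstIdx_succ, card_secondIdx_succ, extend_snoc_last, e 0 (by omega), e k le_rfl,
      firstIdx_congr e, secondIdx_congr e]
    simp
  · intro u _ hu
    rw [if_neg]
    rw [extend_snoc_last]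
    exact fun h => hu h.2.2.2
  · simp

/-- Removing the last entry: an entry in `V₁` raises `r`, and an entry in `V₂` raises `s` only when
it follows another one in `V₂`. This and the next two relations drive the induction in
`le_patternCount`. -/
theorem patternCount_succ_true (k r s : ℕ) : patternCount (k + 1) (r + 1) s true =
    patternCount k r s true + patternCount k r s false := by
  rw [patternCount_succ, patternCount, patternCount, ← Finset.sum_add_distrib]
  refine Finset.sum_congr rfl fun b _ => ?_
  cases extend b k <;> simp

theorem patternCount_le_succ_false (k r s : ℕ) :
    patternCount k r s true ≤ patternCount (k + 1) r s false := by
  rw [patternCount_succ, patternCount]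
  refine Finset.sum_le_sum fun b _ => ?_
  cases extend b k <;> simp

theorem patternCount_succ_false (k r s : ℕ) : patternCount (k + 1) r (s + 1) false =
    patternCount k r (s + 1) true + patternCount k r s false := by
  rw [patternCount_succ, patternCount, patternCount, ← Finset.sum_add_distrib]
  refine Finset.sum_congr rfl fun b _ => ?_
  cases extend b k <;> simp

/-- A pattern with `a + 1` entries in `V₁` has `m + s` entries in `V₂`. With `s` consecutive pairs
among them they form `m` runs, whose lengths can be chosen in `(m + s - 1) choose s` ways. Each run
follows its own entry in `V₁`. If the pattern ends in `V₁`, the last such entry is excluded, which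
leaves `a choose m` positions; if it ends in `V₂`, that entry is used, which leaves `a choose (m -
1)`. The induction turns this count into Pascal's rule. -/
theorem le_patternCount (k a m s : ℕ) (h : a + m + s = k) :
    a.choose m * (m + s - 1).choose s ≤ patternCount k (a + 1) s true ∧
      ∀ m', m = m' + 1 → a.choose m' * (m' + s).choose s ≤ patternCount k (a + 1) s false := by
  induction k generalizing a m s with
  | zero =>
    obtain ⟨rfl, rfl, rfl⟩ : a = 0 ∧ m = 0 ∧ s = 0 := by omega
    refine ⟨?_, fun m' h => by omega⟩
    decide
  | succ k ih =>
    constructor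
    · rcases a with _ | a
      -- With `a = 0` the left side is zero since `m + s > 0`: either `m > 0`, or the second factor
      -- is `(s - 1) choose s` with `s > 0`.
      · have : (0 : ℕ).choose m * (m + s - 1).choose s = 0 := by
          rcases m with _ | m
          · rw [Nat.choose_eq_zero_of_lt (n := 0 + s - 1) (by omega), mul_zero]
          · simp
        omega
      · rw [patternCount_succ_true]
        rcases m with _ | m
        · have := (ih a 0 s (by omega)).1
          simp only [Nat.choose_zero_right] at this ⊢
          omega
        · have h₁ := (ih a (m + 1) s (by omega)).1
          have h₂ := (ih a (m + 1) s (by omega)).2 m rfl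
          rw [show m + 1 + s - 1 = m + s by omega] at h₁ ⊢
          rw [Nat.choose_succ_succ]
          linarith
    · rintro m' rfl
      have h₁ := (ih a m' s (by omega)).1
      rcases s with _ | s
      · refine le_trans ?_ (h₁.trans (patternCount_le_succ_false _ _ _))
        simp
      · have h₂ := (ih a (m' + 1) s (by omega)).2 m' rfl
        rw [patternCount_succ_false, ← add_assoc, Nat.choose_succ_succ]
        rw [show m' + (s + 1) - 1 = m' + s by omega] at h₁
        linarith

/-- The patterns of length `k + 1` with the parameters `r, s`. -/
def IsPattern (k r s : ℕ) (b : Fin (k + 1) → Bool) : Prop :=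
  extend b 0 = true ∧ (firstIdx id k (extend b)).card = r ∧ (secondIdx id k (extend b)).card = s

-- The bounds for the two possible parts of the last entry add up by Pascal's rule.
open Classical in
theorem Admissible.le_card_isPattern {k r s : ℕ} (h : Admissible k r s) :
    r.choose (k + 1 - r - s) * (k - r).choose s ≤
      (Finset.univ.filter fun b : Fin (k + 1) → Bool => IsPattern k r s b).card := by
  obtain ⟨h₁, h₂, h₃⟩ := h
  have hsum : (Finset.univ.filter fun b : Fin (k + 1) → Bool => IsPattern k r s b).card =
      patternCount k r s true + patternCount k r s false := by
    rw [patternCount, patternCount, ← Finset.sum_add_distrib, Finset.card_filter]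
    refine Finset.sum_congr rfl fun b _ => ?_
    unfold IsPattern
    cases extend b k <;> simp
  rw [hsum]
  rcases r with _ | a
  -- For `r = 0` the first coefficient forces `s ≥ k + 1`, and then the second one vanishes.
  · exfalso
    have h₄ : k + 1 - 0 - s = 0 := by
      by_contra hc
      exact h₂ (Nat.choose_eq_zero_of_lt (by omega))
    exact h₃ (Nat.choose_eq_zero_of_lt (by omega))
  · obtain ⟨m, hm⟩ : ∃ m, k = a + m + s := ⟨k - a - s, by omega⟩
    have h₄ := le_patternCount k a m s hm.symm
    rw [show k + 1 - (a + 1) - s = m by omega, show k - (a + 1) = m + s - 1 by omega]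
    rcases m with _ | m
    · have := h₄.1
      simp only [Nat.choose_zero_right] at this ⊢
      omega
    · have h₅ := h₄.1
      have h₆ := h₄.2 m rfl
      rw [show m + 1 + s - 1 = m + s by omega] at h₅ ⊢
      rw [Nat.choose_succ_succ]
      linarith

/-- This bound makes the rounding in the number of rounds harmless: the integer part of `2 ^ (k + 1)
/ B` is at least `1`, and its product with `B` is still at least `2 ^ k`. -/
theorem Admissible.mul_choose_le {k r s : ℕ} (h : Admissible k r s) :
    r.choose (k + 1 - r - s) * (k - r).choose s ≤ 2 ^ k := by
  obtain ⟨h₁, h₂, h₃⟩ := h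
  rcases Nat.lt_or_ge k r with hr | hr
  · obtain ⟨rfl, rfl⟩ : r = k + 1 ∧ s = 0 := by omega
    simpa using Nat.one_le_two_pow
  · calc _ ≤ 2 ^ r * 2 ^ (k - r) :=
          Nat.mul_le_mul (Nat.choose_le_two_pow _ _) (Nat.choose_le_two_pow _ _)
      _ = 2 ^ k := by rw [← pow_add, Nat.add_sub_cancel' hr]

theorem Admissible.mul_choose_pos {k r s : ℕ} (h : Admissible k r s) :
    0 < r.choose (k + 1 - r - s) * (k - r).choose s :=
  Nat.mul_pos (Nat.pos_of_ne_zero h.2.1) (Nat.pos_of_ne_zero h.2.2)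

open Classical in
/-- Every pattern on the image of `p` extends in `2 ^ (n - (k + 1))` ways. -/
theorem card_pattern_mul_le {n k : ℕ} {p : Fin (k + 1) → Fin n} (hp : Function.Injective p)
    (Q : (Fin (k + 1) → Bool) → Prop) :
    (Finset.univ.filter fun b => Q b).card * 2 ^ (n - (k + 1)) ≤
      (Finset.univ.filter fun V₁ : Fin n → Bool => Q (V₁ ∘ p)).card := by
  have hc : Fintype.card ({v // v ∉ Set.range p} → Bool) = 2 ^ (n - (k + 1)) := by
    rw [Fintype.card_fun, Fintype.card_bool, Fintype.card_subtype_compl, Fintype.card_fin]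
    congr 2
    have := Set.card_range_of_injective hp
    rw [Fintype.card_fin] at this
    convert this
  rw [← hc, ← Finset.card_univ, ← Finset.card_product]
  let ψ : (Fin (k + 1) → Bool) × ({v // v ∉ Set.range p} → Bool) → Fin n → Bool := fun bc v =>
    if h : v ∈ Set.range p then bc.1 h.choose else bc.2 ⟨v, h⟩
  have hψ : ∀ bc, ψ bc ∘ p = bc.1 := by
    intro bc
    funext i
    have h : p i ∈ Set.range p := ⟨i, rfl⟩
    simp only [ψ, Function.comp_apply, dif_pos h]
    rw [hp h.choose_spec]
  refine Finset.card_le_card_of_injOn ψ (fun bc hbc => ?_) fun bc _ bc' _ h => ?_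
  · have := (Finset.mem_filter.1 (Finset.mem_product.1 hbc).1).2
    simpa [hψ] using this
  · refine Prod.ext (by rw [← hψ bc, h, hψ]) (funext fun v => ?_)
    have := congrFun h v.1
    simpa only [ψ, dif_neg v.2, Subtype.coe_eta] using this

end Patterns

/-! ## Simple paths -/

section SimplePaths

variable {n k : ℕ} {G : SimpleGraph (Fin n)}

theorem exists_walk_support (P : ℕ → Fin n) (k : ℕ) (h : ∀ t < k, G.Adj (P t) (P (t + 1))) :
    ∃ w : G.Walk (P 0) (P k), w.support = (List.range (k + 1)).map P := by
  induction k with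
  | zero => exact ⟨.nil, by simp⟩
  | succ k ih =>
    obtain ⟨w, hw⟩ := ih fun t ht => h t (by omega)
    refine ⟨w.concat (h k (by omega)), ?_⟩
    rw [SimpleGraph.Walk.support_concat, hw, List.range_succ (n := k + 1)]
    simp

theorem hasSimplePath_iff : HasSimplePath G k ↔ ∃ p : Fin (k + 1) → Fin n, Function.Injective p ∧
    ∀ t < k, G.Adj (extend p t) (extend p (t + 1)) := by
  constructor
  · rintro ⟨u, v, w, hw, rfl⟩
    refine ⟨fun t => w.getVert t, fun a b hab => ?_, fun t ht => ?_⟩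
    · exact Fin.ext (hw.getVert_injOn (Set.mem_ofPred.2 (by omega)) (Set.mem_ofPred.2 (by omega)) hab)
    · rw [extend_of_le w.getVert (by omega), extend_of_le w.getVert (by omega)]
      exact w.adj_getVert_succ ht
  · rintro ⟨p, hp, hadj⟩
    obtain ⟨w, hw⟩ := exists_walk_support (extend p) k hadj
    refine ⟨_, _, w, ?_, ?_⟩
    · rw [SimpleGraph.Walk.isPath_def, hw]
      refine List.Nodup.map_on (fun a ha b hb hab => ?_) List.nodup_range
      have ha := List.mem_range.1 ha
      have hb := List.mem_range.1 hb
      exact injOn_extend hp (Set.mem_Iic.2 (by omega)) (Set.mem_Iic.2 (by omega)) hab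
    · have := congrArg List.length hw
      simpa using this

/-- A simple path never returns to a vertex, so the turn condition is vacuous and only the two
counts matter. -/
theorem isLegit_of_isPattern {p : Fin (k + 1) → Fin n} (hp : Function.Injective p)
    (hadj : ∀ t < k, G.Adj (extend p t) (extend p (t + 1))) {V₁ : Fin n → Bool} {r s : ℕ}
    (h : IsPattern k r s (V₁ ∘ p)) : IsLegit G V₁ (p 0) k r s (extend p) where
  start := rfl
  adj := hadj
  card_first := h.2.1
  card_second := h.2.2
  no_return t ht he := by
    have := injOn_extend hp (Set.mem_Iic.2 ht) (Set.mem_Iic.2 (by omega)) he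
    omega

end SimplePaths

/-! ## Probability of success -/

section Success

open Prog

variable {n m k r s : ℕ} {G : SimpleGraph (Fin n)}

theorem ensures_partition (v₀ : Fin n) :
    (tabulate true (List.finRange n) fun v =>
      if v = v₀ then (pure true : Prog n (GaloisField 2 m) Bool) else exec .coin).Ensures G
      fun V₁ => V₁ v₀ = true := by
  refine (ensures_tabulate (Q := fun v b => v = v₀ → b = true) (fun v => ?_) _).mono fun t ht =>
    ht v₀ (List.mem_finRange _) rfl
  split_ifs with h
  · exact ensures_pure fun _ => rfl
  · exact (ensures_true _).mono fun _ _ h' => absurd h' h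

theorem dist_partition {v₀ : Fin n} {V₁ : Fin n → Bool} (h : V₁ v₀ = true) :
    (tabulate true (List.finRange n) fun v =>
      if v = v₀ then (pure true : Prog n (GaloisField 2 m) Bool) else exec .coin).dist G V₁ =
      (2⁻¹ : ENNReal) ^ (n - 1) := by
  rw [dist_tabulate_of_complete _ _ (List.nodup_finRange _) List.mem_finRange,
    ← Finset.mul_prod_erase _ _ (Finset.mem_univ v₀), if_pos rfl, dist_pure, h,
    PMF.pure_apply_self, one_mul]
  have : ∀ v ∈ Finset.univ.erase v₀,
      (if v = v₀ then (pure true : Prog n (GaloisField 2 m) Bool) else exec .coin).dist G (V₁ v) =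
        2⁻¹ := by
    intro v hv
    rw [if_neg (Finset.mem_erase.1 hv).1, dist_exec]
    exact (PMF.uniformOfFintype_apply _).trans (by simp)
  rw [Finset.prod_congr rfl this, Finset.prod_const, Finset.card_erase_of_mem (Finset.mem_univ _),
    Finset.card_univ, Fintype.card_fin]

theorem ensures_phiTest_false {C : Circuit n}
    (h : ∀ (x : Sym2 (Fin n) → GaloisField 2 m) (Y : Fin r → Fin n → GaloisField 2 m)
      (Z : Fin s → Sym2 (Fin n) → GaloisField 2 m), phiCircuit C x Y Z = 0) :
    (phiTest (F := GaloisField 2 m) r s C).Ensures G fun b => b = false := by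
  rw [phiTest_eq]
  refine (ensures_true _).bind fun x _ => (ensures_true _).bind fun Y _ =>
    (ensures_true _).bind fun Z _ => (ensures_phiEval C x Y Z).mono fun b hb => ?_
  simpa [h x Y Z] using hb

/-- Without simple paths `φ f` vanishes at every point and for every partition, so the error is
one-sided. -/
theorem ensures_trial_false (hk : 1 ≤ k) (h : ¬ HasSimplePath G k) (v₀ : Fin n) :
    (trial (F := GaloisField 2 m) k r s v₀).Ensures G fun b => b = false := by
  classical
  refine (ensures_partition v₀).bind fun V₁ hv => (ensures_buildCircuit hv hk).bind fun C hC =>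
    ensures_phiTest_false fun x Y Z => ?_
  rw [phiCircuit_eq_phi hC, phi_eq_sum_simple]
  refine Finset.sum_eq_zero fun p hp => absurd ?_ h
  obtain ⟨hp, hinj⟩ := (Finset.mem_filter.1 hp).2
  exact hasSimplePath_iff.2 ⟨p, hinj, hp.adj⟩

theorem ensures_hamiltonian_false (hk : 1 ≤ k) (h : ¬ HasSimplePath G k) :
    (hamiltonian (F := GaloisField 2 m) n k r s).Ensures G fun b => b = false :=
  (ensures_true _).bind fun _ _ => (ensures_true _).bind fun _ _ =>
    ensures_anyOf_false (fun v₀ => ensures_anyOf_false (fun _ => ensures_trial_false hk h v₀) _) _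

/-- At least `B * 2 ^ (n - k - 1)` partitions make the path `p` legitimate, where `B` is the product
of the two binomial coefficients. Each has probability `2 ^ (-(n - 1))`, because the part of the
start vertex is not random. For each of them the test succeeds with probability at least `3 / 4`. -/
theorem le_dist_trial (hk : 1 ≤ k) (hm : 4 * (k + r + s) ≤ Nat.card (GaloisField 2 m))
    {p : Fin (k + 1) → Fin n} (hp : Function.Injective p)
    (hadj : ∀ t < k, G.Adj (extend p t) (extend p (t + 1))) (hA : Admissible k r s) :
    ((r.choose (k + 1 - r - s) * (k - r).choose s : ℕ) : ENNReal) * 2⁻¹ ^ k * (3 / 4) ≤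
      (trial (F := GaloisField 2 m) k r s (p 0)).dist G true := by
  classical
  have hkn : k + 1 ≤ n := by simpa using Fintype.card_le_of_injective p hp
  set good := Finset.univ.filter fun V₁ : Fin n → Bool => IsPattern k r s (V₁ ∘ p) with hgood
  have hcard : r.choose (k + 1 - r - s) * (k - r).choose s * 2 ^ (n - (k + 1)) ≤ good.card :=
    (Nat.mul_le_mul_right _ hA.le_card_isPattern).trans (card_pattern_mul_le hp _)
  have hV : ∀ V₁ ∈ good, V₁ (p 0) = true := fun V₁ h => (Finset.mem_filter.1 h).2.1
  have htest : ∀ V₁ ∈ good, (3 / 4 : ENNReal) ≤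
      (buildCircuit (F := GaloisField 2 m) k r s (p 0) V₁ >>= fun C => phiTest r s C).dist G
        true := by
    intro V₁ h
    refine le_dist_bind (ensures_buildCircuit (hV V₁ h) hk) fun C hC => ?_
    have h₁ := dist_phiTest_le hm hC (isLegit_of_isPattern hp hadj (Finset.mem_filter.1 h).2) hp
    have h₂ := PMF.bool_add ((phiTest (F := GaloisField 2 m) r s C).dist G)
    set a := (phiTest (F := GaloisField 2 m) r s C).dist G true
    have h₃ : (1 : ENNReal) ≤ a + 1 / 4 := h₂.ge.trans (add_le_add_right h₁ a)
    have h₄ : (3 / 4 : ENNReal) + 1 / 4 = 1 := by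
      rw [← ENNReal.add_div]
      norm_num
      exact ENNReal.div_self (by simp) (by simp)
    exact (ENNReal.add_le_add_iff_right (show (1 / 4 : ENNReal) ≠ ⊤ by simp)).1 (h₄.le.trans h₃)
  calc _ ≤ (good.card : ENNReal) * 2⁻¹ ^ (n - 1) * (3 / 4) := by
        refine mul_le_mul_left ?_ _
        obtain ⟨e, rfl⟩ : ∃ e, n = k + 1 + e := ⟨n - (k + 1), by omega⟩
        rw [show k + 1 + e - (k + 1) = e by omega] at hcard
        rw [show k + 1 + e - 1 = e + k by omega, pow_add, ← mul_assoc]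
        refine mul_le_mul_left ?_ _
        calc _ = ((r.choose (k + 1 - r - s) * (k - r).choose s : ℕ) : ENNReal) * 2 ^ e * 2⁻¹ ^ e := by
              rw [mul_assoc, ← mul_pow, ENNReal.mul_inv_cancel (by simp) (by simp), one_pow, mul_one]
          _ ≤ _ := mul_le_mul_left (by exact_mod_cast hcard) _
    _ = ∑ V₁ ∈ good, 2⁻¹ ^ (n - 1) * (3 / 4) := by
        rw [Finset.sum_const, nsmul_eq_mul, mul_assoc]
    _ ≤ ∑ V₁ ∈ good, (tabulate true (List.finRange n) fun v =>
          if v = p 0 then (pure true : Prog n (GaloisField 2 m) Bool) else exec .coin).dist G V₁ *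
          (buildCircuit (F := GaloisField 2 m) k r s (p 0) V₁ >>= fun C => phiTest r s C).dist G
            true := by
        refine Finset.sum_le_sum fun V₁ h => ?_
        rw [dist_partition (hV V₁ h)]
        exact mul_le_mul_right (htest V₁ h) _
    _ ≤ _ := by
        rw [trial, dist_bind, PMF.bind_apply]
        exact ENNReal.sum_le_tsum _

/-! ### The number of rounds -/

theorem ensures_powTwo (e : ℕ) :
    (powTwo e : Prog n (GaloisField 2 m) ℕ).Ensures G fun a => a = 2 ^ e := by
  refine (ensures_fold (g := fun a _ => 2 * a) (fun a i => ensures_arith _ _ _) _ _).mono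
    fun a ha => ?_
  rw [ha]
  clear ha
  induction e with
  | zero => rfl
  | succ e ih => rw [List.range_succ, List.foldl_append, ih, pow_succ']; rfl

/-- The division is exact, since `(a choose i) * (a - i) = (a choose (i + 1)) * (i + 1)`. Truncated
subtraction does no harm: for `i ≥ a` the next coefficient is zero. -/
theorem ensures_binomial (a b : ℕ) :
    (binomial a b : Prog n (GaloisField 2 m) ℕ).Ensures G fun c => c = a.choose b := by
  refine (ensures_fold (g := fun c i => c * (a - i) / (i + 1)) (fun c i => ?_) _ _).mono
    fun c hc => ?_
  · refine (ensures_arith _ _ _).bind fun d hd => (ensures_arith _ _ _).bind fun p hp =>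
      (ensures_arith _ _ _).bind fun i' hi => (ensures_arith _ _ _).mono fun c hc => ?_
    rw [hc, hi, hp, hd]; rfl
  · rw [hc]
    clear hc
    induction b with
    | zero => simp
    | succ b ih =>
      rw [List.range_succ, List.foldl_append, ih]
      simp only [List.foldl_cons, List.foldl_nil]
      rw [← Nat.choose_succ_right_eq, Nat.mul_div_cancel _ (Nat.succ_pos b)]

theorem ensures_rounds (k r s : ℕ) :
    (rounds k r s : Prog n (GaloisField 2 m) ℕ).Ensures G fun T =>
      T = 2 ^ (k + 1) / (r.choose (k + 1 - r - s) * (k - r).choose s) := by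
  refine (ensures_arith _ _ _).bind fun k' hk' => (ensures_powTwo _).bind fun p hp =>
    (ensures_arith _ _ _).bind fun d hd => (ensures_arith _ _ _).bind fun t ht =>
    (ensures_binomial _ _).bind fun b₁ hb₁ => (ensures_arith _ _ _).bind fun d' hd' =>
    (ensures_binomial _ _).bind fun b₂ hb₂ => (ensures_arith _ _ _).bind fun b hb =>
    (ensures_arith _ _ _).mono fun T hT => ?_
  simp only [ArithOp.eval] at *
  subst hT hb hb₂ hd' hb₁ ht hd hp hk'
  rfl

/-- `(1 - x) ^ T ≤ exp (-x T)`, and `exp y ≥ 1 + y + y² / 2 > 2` already for `y = 3 / 4`. -/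
theorem pow_le_half {x : ℝ} (hx₁ : x ≤ 1) {T : ℕ} (hT : 3 / 4 ≤ x * T) :
    (1 - x) ^ T ≤ 1 / 2 := by
  have h₁ : (1 - x) ^ T ≤ Real.exp (-(x * T)) := by
    have : Real.exp (-(x * T)) = Real.exp (-x) ^ T := by rw [← Real.exp_nat_mul]; congr 1; ring
    rw [this]
    refine pow_le_pow_left₀ (by linarith) ?_ T
    have := Real.add_one_le_exp (-x)
    linarith
  have h₂ : (2 : ℝ) ≤ Real.exp (x * T) := by
    have := Real.quadratic_le_exp_of_nonneg (x := x * T) (by linarith)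
    nlinarith
  refine h₁.trans ?_
  rw [Real.exp_neg, one_div]
  exact inv_anti₀ (by norm_num) h₂

theorem half_le_dist_hamiltonian (hk : 1 ≤ k)
    (hm : 4 * (k + r + s) ≤ Nat.card (GaloisField 2 m)) (h : HasSimplePath G k)
    (hA : Admissible k r s) :
    1 / 2 ≤ (hamiltonian (F := GaloisField 2 m) n k r s).dist G true := by
  obtain ⟨p, hp, hadj⟩ := hasSimplePath_iff.1 h
  refine le_dist_bind (ensures_true _) fun _ _ => le_dist_bind (ensures_rounds k r s) fun T hT => ?_
  set B := r.choose (k + 1 - r - s) * (k - r).choose s with hB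
  have hB₀ : 0 < B := hA.mul_choose_pos
  have hB₁ : B ≤ 2 ^ k := hA.mul_choose_le
  have htr := le_dist_trial hk hm hp hadj hA
  rw [← hB] at htr
  set D := (trial (F := GaloisField 2 m) k r s (p 0)).dist G
  have hD := PMF.bool_add D
  set E := (anyOf (List.finRange n) fun v₀ =>
    anyOf (List.range T) fun _ => trial (F := GaloisField 2 m) k r s v₀).dist G with hE
  have hE' := PMF.bool_add E
  -- Only the rounds that start at `p 0` are counted; the other start vertices contribute factors at
  -- most one.
  have hfalse : E false ≤ D false ^ T := by
    rw [hE, dist_anyOf_false]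
    simp only [dist_anyOf_false, List.map_const', List.prod_replicate, List.length_range]
    rw [← Fin.prod_univ_def, ← Finset.mul_prod_erase _ _ (Finset.mem_univ (p 0))]
    refine mul_le_of_le_one_right zero_le ?_
    exact Finset.prod_le_one' fun v _ => pow_le_one' (PMF.coe_le_one _ _) _
  have hreal : (D false).toReal = 1 - (D true).toReal := by
    rw [eq_sub_iff_add_eq, add_comm, ← ENNReal.toReal_add (PMF.apply_ne_top _ _)
      (PMF.apply_ne_top _ _), hD, ENNReal.toReal_one]
  have htr' : (B : ℝ) * 2⁻¹ ^ k * (3 / 4) ≤ (D true).toReal := by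
    have := ENNReal.toReal_mono (PMF.apply_ne_top _ _) htr
    simpa using this
  have hD₁ : (D true).toReal ≤ 1 := by
    have := ENNReal.toReal_mono ENNReal.one_ne_top (PMF.coe_le_one D true)
    simpa using this
  -- `2 ^ (k + 1) < B * (T + 1)` by division with remainder, and `B ≤ 2 ^ k`.
  have hTB : 2 ^ k ≤ B * T := by
    have := Nat.lt_mul_div_succ (2 ^ (k + 1)) hB₀
    rw [← hT, pow_succ] at this
    nlinarith
  have hhalf : (D false).toReal ^ T ≤ 1 / 2 := by
    rw [hreal]
    refine pow_le_half hD₁ ?_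
    have h₁ : ((2 : ℝ) ^ k) ≤ B * T := by exact_mod_cast hTB
    calc (3 / 4 : ℝ) = 2 ^ k * 2⁻¹ ^ k * (3 / 4) := by
          rw [← mul_pow]; norm_num
      _ ≤ B * T * 2⁻¹ ^ k * (3 / 4) := by gcongr
      _ = B * 2⁻¹ ^ k * (3 / 4) * T := by ring
      _ ≤ _ := by gcongr
  have hEf : E false ≤ 1 / 2 := by
    refine hfalse.trans ?_
    rw [← ENNReal.ofReal_toReal (PMF.apply_ne_top D false), ← ENNReal.ofReal_pow
      ENNReal.toReal_nonneg]
    refine (ENNReal.ofReal_le_ofReal hhalf).trans ?_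
    rw [ENNReal.ofReal_div_of_pos (by norm_num)]
    simp
  have h₃ : (1 : ENNReal) ≤ E true + 1 / 2 := hE'.ge.trans (add_le_add_right hEf _)
  exact (ENNReal.add_le_add_iff_right (show (1 / 2 : ENNReal) ≠ ⊤ by simp)).1
    ((ENNReal.add_halves 1).le.trans h₃)

theorem card_galoisField_fieldBits (k : ℕ) :
    4 * (2 * k + 1) ≤ Nat.card (GaloisField 2 (fieldBits k)) := by
  have h : fieldBits k ≠ 0 := fun h => by
    have := Nat.size_eq_zero.1 h
    omega
  rw [card_galoisField h]
  exact (Nat.lt_size_self _).le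

theorem answerProb_runHamiltonian (b : Bool) : answerProb (runHamiltonian G k r s) b =
    (hamiltonian (F := GaloisField 2 (fieldBits k)) n k r s).dist G b := rfl

theorem half_le_answerProb (hk : 1 ≤ k) (hA : Admissible k r s) (h : HasSimplePath G k) :
    1 / 2 ≤ answerProb (runHamiltonian G k r s) true := by
  refine half_le_dist_hamiltonian hk ?_ h hA
  -- Admissibility gives `r + s ≤ k + 1`, so the degree `k + r + s` is at most `2 * k + 1`.
  have := card_galoisField_fieldBits k
  have := hA.1
  omega

theorem answerProb_eq_one (hk : 1 ≤ k) (h : ¬ HasSimplePath G k) :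
    answerProb (runHamiltonian G k r s) false = 1 := by
  rw [answerProb_runHamiltonian, (ensures_hamiltonian_false hk h).dist_eq, PMF.pure_apply_self]

end Success

/-! ## Running time -/

section Time

open Prog

variable {n m k r s : ℕ} {G : SimpleGraph (Fin n)} {α β ι σ : Type}

/-- All polynomial bounds are powers of a single number `N`. A sum of two powers is absorbed by any
higher power, so constants need not be tracked; the exponents are generous. -/
theorem pow_add_pow_le_pow {N a b c : ℕ} (hN : 2 ≤ N) (ha : a < c) (hb : b < c) :
    N ^ a + N ^ b ≤ N ^ c := by
  obtain ⟨d, rfl⟩ : ∃ d, c = d + 1 := ⟨c - 1, by omega⟩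
  have h₁ : N ^ a ≤ N ^ d := Nat.pow_le_pow_right (by omega) (by omega)
  have h₂ : N ^ b ≤ N ^ d := Nat.pow_le_pow_right (by omega) (by omega)
  rw [pow_succ]
  exact le_trans (by omega) (Nat.mul_le_mul_left (N ^ d) hN)

theorem Prog.TimeLe.bind_pow {N a b : ℕ} (c : ℕ) (hN : 2 ≤ N) {p : Prog n (GaloisField 2 m) α}
    {f : α → Prog n (GaloisField 2 m) β} (hp : p.TimeLe G (N ^ a))
    (hf : ∀ x, (f x).TimeLe G (N ^ b)) (ha : a < c := by norm_num) (hb : b < c := by norm_num) :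
    (p >>= f).TimeLe G (N ^ c) :=
  (hp.bind hf).mono (pow_add_pow_le_pow hN ha hb)

theorem loop_le_pow {N L a b c : ℕ} (hN : 2 ≤ N) (hL : L ≤ N ^ b) (hc : a + b < c) :
    L * (N ^ a + 1) ≤ N ^ c := by
  calc L * (N ^ a + 1) ≤ N ^ b * N ^ (a + 1) :=
        Nat.mul_le_mul hL (pow_add_pow_le_pow (a := a) (b := 0) hN (by omega) (by omega))
    _ = N ^ (a + b + 1) := by rw [← pow_add]; congr 1; ring
    _ ≤ N ^ c := Nat.pow_le_pow_right (by omega) (by omega)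

theorem Prog.timeLe_collect_pow {N a b : ℕ} (c : ℕ) (hN : 2 ≤ N) {l : List ι}
    {f : ι → Prog n (GaloisField 2 m) (List β)} (hl : l.length ≤ N ^ b)
    (h : ∀ i, (f i).TimeLe G (N ^ a)) (hc : a + b < c := by norm_num) :
    (collect l f).TimeLe G (N ^ c) :=
  (timeLe_collect h l).mono (loop_le_pow hN hl hc)

theorem Prog.timeLe_tabulate_pow [DecidableEq ι] {N a b : ℕ} (c : ℕ) (hN : 2 ≤ N) {l : List ι}
    {d : β} {f : ι → Prog n (GaloisField 2 m) β} (hl : l.length ≤ N ^ b)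
    (h : ∀ i, (f i).TimeLe G (N ^ a)) (hc : a + b < c := by norm_num) :
    (tabulate d l f).TimeLe G (N ^ c) :=
  (timeLe_tabulate h l).mono (loop_le_pow hN hl hc)

theorem Prog.timeLe_fold_pow {N a b : ℕ} (c : ℕ) (hN : 2 ≤ N) {l : List ι} {x : σ}
    {f : σ → ι → Prog n (GaloisField 2 m) σ} (hl : l.length ≤ N ^ b)
    (h : ∀ y, ∀ i ∈ l, (f y i).TimeLe G (N ^ a)) (hc : a + b < c := by norm_num) :
    (fold l x f).TimeLe G (N ^ c) :=
  (timeLe_fold h x).mono (loop_le_pow hN hl hc)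

/-- `W` and `W'` carry the factors `2 ^ r`, `2 ^ s` and `T`, which must stay separate from the
powers of `N`. -/
theorem loop_le_mul_pow {N L W W' a c : ℕ} (hN : 2 ≤ N) (hW : 1 ≤ W) (hL : L ≤ W') (hc : a < c) :
    L * (W * N ^ a + 1) ≤ W' * W * N ^ c := by
  have h₁ : N ^ a + 1 ≤ N ^ c := pow_add_pow_le_pow (b := 0) hN hc (by omega)
  calc L * (W * N ^ a + 1) ≤ W' * (W * (N ^ a + 1)) := by
        refine Nat.mul_le_mul hL ?_
        rw [mul_add, mul_one]
        omega
    _ ≤ W' * (W * N ^ c) := by gcongr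
    _ = _ := by ring

/-- A sequence of a polynomially bounded and a more expensive part. -/
theorem Prog.TimeLe.bind_mul_pow {N W a b : ℕ} (c : ℕ) (hN : 2 ≤ N) (hW : 1 ≤ W)
    {p : Prog n (GaloisField 2 m) α} {f : α → Prog n (GaloisField 2 m) β}
    (hp : p.TimeLe G (N ^ a)) (hf : ∀ x, (f x).TimeLe G (W * N ^ b))
    (ha : a < c := by norm_num) (hb : b < c := by norm_num) :
    (p >>= f).TimeLe G (W * N ^ c) := by
  refine (hp.bind hf).mono ?_
  calc N ^ a + W * N ^ b ≤ W * N ^ a + W * N ^ b :=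
        Nat.add_le_add_right (Nat.le_mul_of_pos_left _ hW) _
    _ = W * (N ^ a + N ^ b) := by ring
    _ ≤ _ := Nat.mul_le_mul_left _ (pow_add_pow_le_pow hN ha hb)

/-- `N` dominates all parameters. -/
structure Dominates (N n m k r s : ℕ) : Prop where
  large : 16 ≤ N
  n_le : n ≤ N
  m_lt : m < N
  k_lt : k < N
  r_lt : r < N
  s_lt : s < N

variable {N : ℕ}

theorem Dominates.two_le (h : Dominates N n m k r s) : 2 ≤ N := le_trans (by norm_num) h.large

theorem Dominates.one_le_pow (h : Dominates N n m k r s) (a : ℕ) : 1 ≤ N ^ a :=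
  Nat.one_le_pow _ _ (by have := h.two_le; omega)

theorem Dominates.length_finRange (h : Dominates N n m k r s) :
    (List.finRange n).length ≤ N ^ 1 := by simpa using h.n_le

theorem Dominates.length_pairs (h : Dominates N n m k r s) : (pairs n).length ≤ N ^ 2 := by
  rw [pairs, List.length_sym2, List.length_finRange, Nat.choose_two_right, Nat.add_sub_cancel]
  refine Nat.div_le_of_le_mul ?_
  calc (n + 1) * n ≤ (2 * N) * N := Nat.mul_le_mul (by have := h.n_le; have := h.large; omega) h.n_le
    _ = 2 * N ^ 2 := by ring

/-! ### Cost and size of the circuit -/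

theorem timeLe_emit (g : Gate n) : (emit (F := GaloisField 2 m) g).TimeLe G 1 :=
  (timeLe_tick.bind fun _ => timeLe_pure _ 0).mono le_rfl

theorem timeLe_adj (u v : Fin n) :
    (exec (.adj u v : Instr n (GaloisField 2 m) Bool)).TimeLe G 1 := timeLe_exec le_rfl

theorem timeLe_sumGates (ν : Node n) (j r s : ℕ) (u : Fin n) (ok : Fin n → Bool) :
    (sumGates (F := GaloisField 2 m) ν j r s u ok).TimeLe G (3 * n + 1) := by
  refine ((timeLe_emit _).bind fun _ => (timeLe_collect (B := 2) (fun w => ?_) _).bind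
    fun _ => timeLe_pure _ 0).mono ?_
  · refine ((timeLe_adj u w).bind (B' := 1) fun e => ?_).mono le_rfl
    split_ifs
    · exact timeLe_emit _
    · exact timeLe_pure _ _
  · rw [List.length_finRange]; omega

theorem timeLe_pathGates (v₀ : Fin n) (V₁ : Fin n → Bool) (j r s : ℕ) (u₁ u₂ : Fin n) :
    (pathGates (F := GaloisField 2 m) v₀ V₁ j r s u₁ u₂).TimeLe G (3 * n + 4) := by
  refine ((timeLe_adj u₁ u₂).bind (B' := 3 * n + 3) fun e => ?_).mono (by omega)
  have hc : ∀ ν : Node n, (clear (F := GaloisField 2 m) ν).TimeLe G (3 * n + 3) :=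
    fun ν => (timeLe_emit _).mono (by omega)
  have hm : ∀ (ν : Node n) (v : Var n), (mulVar (F := GaloisField 2 m) ν v).TimeLe G 1 :=
    fun ν v => timeLe_emit _
  split_ifs
  · exact (timeLe_emit _).mono (by omega)
  · exact ((timeLe_emit _).bind fun _ => (hm _ _).bind fun _ => timeLe_pure _ 0).mono (by omega)
  · exact hc _
  · cases r with
    | zero => exact hc _
    | succ r => exact ((timeLe_sumGates _ _ _ _ _ _).bind fun _ => (hm _ _).bind fun _ =>
        (hm _ _).bind fun _ => timeLe_pure _ 0).mono (by omega)
  · exact ((timeLe_sumGates _ _ _ _ _ _).bind fun _ => (hm _ _).bind fun _ =>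
      timeLe_pure _ 0).mono (by omega)
  · cases s with
    | zero => exact hc _
    | succ s => exact ((timeLe_sumGates _ _ _ _ _ _).bind fun _ => (hm _ _).bind fun _ =>
        (hm _ _).bind fun _ => timeLe_pure _ 0).mono (by omega)
  · exact hc _

/-- The number of gates is bounded separately, because it determines the cost of each evaluation. -/
theorem ensures_emit_length (g : Gate n) :
    (emit (F := GaloisField 2 m) g).Ensures G fun C => C.length ≤ 1 :=
  ensures_tick.bind fun _ _ => ensures_pure le_rfl

theorem ensures_sumGates_length (ν : Node n) (j r s : ℕ) (u : Fin n) (ok : Fin n → Bool) :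
    (sumGates (F := GaloisField 2 m) ν j r s u ok).Ensures G fun C => C.length ≤ n + 1 := by
  refine (ensures_emit_length _).bind fun C hC =>
    (ensures_collect_length (L := 1) (fun w => ?_) _).bind fun D hD => ensures_pure ?_
  · refine (ensures_true _).bind fun e _ => ?_
    split_ifs
    · exact ensures_emit_length _
    · exact ensures_pure (by simp)
  · rw [List.length_finRange] at hD
    rw [List.length_append]
    omega

theorem ensures_pathGates_length (v₀ : Fin n) (V₁ : Fin n → Bool) (j r s : ℕ) (u₁ u₂ : Fin n) :
    (pathGates (F := GaloisField 2 m) v₀ V₁ j r s u₁ u₂).Ensures G fun C => C.length ≤ n + 3 := by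
  refine (ensures_true _).bind fun e _ => ?_
  have hc : ∀ ν : Node n, (clear (F := GaloisField 2 m) ν).Ensures G fun C => C.length ≤ n + 3 :=
    fun ν => (ensures_emit_length _).mono fun _ _ => by omega
  have hm : ∀ (ν : Node n) (v : Var n),
      (mulVar (F := GaloisField 2 m) ν v).Ensures G fun C => C.length ≤ 1 :=
    fun ν v => ensures_emit_length _
  split_ifs
  · exact (ensures_emit_length _).mono fun _ _ => by omega
  · exact (ensures_emit_length _).bind fun _ _ => (hm _ _).bind fun _ _ =>
      ensures_pure (by rw [List.length_append]; omega)
  · exact hc _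
  · cases r with
    | zero => exact hc _
    | succ r => exact (ensures_sumGates_length _ _ _ _ _ _).bind fun _ _ => (hm _ _).bind fun _ _ =>
        (hm _ _).bind fun _ _ => ensures_pure (by simp only [List.length_append]; omega)
  · exact (ensures_sumGates_length _ _ _ _ _ _).bind fun _ _ => (hm _ _).bind fun _ _ =>
      ensures_pure (by simp only [List.length_append]; omega)
  · cases s with
    | zero => exact hc _
    | succ s => exact (ensures_sumGates_length _ _ _ _ _ _).bind fun _ _ => (hm _ _).bind fun _ _ =>
        (hm _ _).bind fun _ _ => ensures_pure (by simp only [List.length_append]; omega)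
  · exact hc _

theorem Dominates.timeLe_buildCircuit (h : Dominates N n m k r s) (v₀ : Fin n)
    (V₁ : Fin n → Bool) :
    (buildCircuit (F := GaloisField 2 m) k r s v₀ V₁).TimeLe G (N ^ 14) := by
  have h2 := h.two_le
  have hp : 3 * n + 4 ≤ N ^ 2 := by
    have := h.n_le; have := h.large; nlinarith
  have hL := h.length_finRange
  refine (timeLe_collect_pow 12 h2 (b := 1) ?_ fun j => timeLe_collect_pow 10 h2 (b := 1) ?_
    fun r' => timeLe_collect_pow 8 h2 (b := 1) ?_ fun s' => timeLe_collect_pow 6 h2 hL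
    fun u₁ => timeLe_collect_pow 4 h2 hL fun u₂ =>
      (timeLe_pathGates v₀ V₁ j r' s' u₁ u₂).mono hp).bind_pow 14 h2
    (fun _ => ((timeLe_emit _).mono (h.one_le_pow 0)).bind_pow 13 h2 fun _ =>
      (timeLe_collect_pow 4 h2 hL fun u₁ => timeLe_collect_pow 2 h2 hL fun u₂ =>
        (timeLe_emit _).mono (h.one_le_pow 0)).bind_pow (b := 0) 5 h2 fun _ => timeLe_pure _ _)
  · simpa using h.k_lt.le
  · simpa using h.r_lt
  · simpa using h.s_lt

theorem Dominates.ensures_buildCircuit_length (h : Dominates N n m k r s) (v₀ : Fin n)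
    (V₁ : Fin n → Bool) :
    (buildCircuit (F := GaloisField 2 m) k r s v₀ V₁).Ensures G fun C => C.length ≤ N ^ 8 := by
  refine (ensures_collect_length (fun j => ensures_collect_length (fun r' =>
    ensures_collect_length (fun s' => ensures_collect_length (fun u₁ =>
    ensures_collect_length (fun u₂ => ensures_pathGates_length v₀ V₁ j r' s' u₁ u₂) _) _) _) _)
      _).bind fun C hC => (ensures_emit_length _).bind fun D hD =>
        (ensures_collect_length (fun u₁ => ensures_collect_length (fun u₂ =>
          ensures_emit_length _) _) _).bind fun E hE => ensures_pure ?_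
  simp only [List.length_finRange, List.length_range, List.length_range', mul_one] at hC hE
  simp only [List.length_append]
  have h₁ : n + 3 ≤ N ^ 2 := by
    have := h.n_le; have := h.large; nlinarith
  have h₂ : C.length ≤ N ^ 7 := by
    calc C.length ≤ k * ((r + 1) * ((s + 1) * (n * (n * (n + 3))))) := hC
      _ ≤ N * (N * (N * (N * (N * N ^ 2)))) :=
        Nat.mul_le_mul h.k_lt.le (Nat.mul_le_mul h.r_lt (Nat.mul_le_mul h.s_lt
          (Nat.mul_le_mul h.n_le (Nat.mul_le_mul h.n_le h₁))))
      _ = N ^ 7 := by ring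
  have h₃ : E.length ≤ N ^ 2 := by
    calc E.length ≤ n * n := hE
      _ ≤ N * N := Nat.mul_le_mul h.n_le h.n_le
      _ = N ^ 2 := by ring
  have h₄ := pow_add_pow_le_pow (a := 2) (b := 0) (c := 3) h.two_le (by norm_num) (by norm_num)
  have h₅ := pow_add_pow_le_pow (a := 7) (b := 3) (c := 8) h.two_le (by norm_num) (by norm_num)
  rw [pow_zero] at h₄
  omega

theorem Dominates.timeLe_evalCircuit (h : Dominates N n m k r s) {C : Circuit n}
    (hC : C.length ≤ N ^ 8) (ρ : Var n → GaloisField 2 m) :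
    (evalCircuit C ρ).TimeLe G (N ^ 13) := by
  have h2 := h.two_le
  refine (timeLe_fold_pow (a := 3) 12 h2 hC fun t g _ => ?_).bind_pow 13 h2 (b := 0)
    fun _ => timeLe_pure _ _
  refine TimeLe.bind_pow (a := 2) (b := 0) 3 h2 ?_ fun _ => timeLe_pure _ _
  have hm := h.m_lt
  rcases g with ⟨d, op, x, y⟩
  cases op
  · exact timeLe_exec (by simp only [Instr.cost]; nlinarith)
  · exact timeLe_exec (by simp only [Instr.cost]; exact Nat.pow_le_pow_left hm 2)

theorem Dominates.timeLe_sumArray (h : Dominates N n m k r s) [DecidableEq ι] {q : ℕ} {l : List ι}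
    (hl : l.length ≤ N ^ 2) (Y : Fin q → ι → GaloisField 2 m) {L : List (Fin q)}
    (hL : L.length ≤ N ^ 1) : (sumArray l Y L).TimeLe G (N ^ 6) := by
  have h2 := h.two_le
  refine timeLe_tabulate_pow 6 h2 hl fun a => timeLe_fold_pow (a := 1) 3 h2 hL fun c i _ => ?_
  exact timeLe_exec (by simp only [Instr.cost, pow_one]; exact h.m_lt)

theorem Dominates.timeLe_rand (h : Dominates N n m k r s) :
    (exec (.rand : Instr n (GaloisField 2 m) _)).TimeLe G (N ^ 1) :=
  timeLe_exec (by simp only [Instr.cost, pow_one]; exact h.m_lt)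

/-- The loops over the subsets of the `s` and of the `r` labels are the only exponential part of a
round. -/
theorem Dominates.timeLe_phiEval (h : Dominates N n m k r s) {C : Circuit n}
    (hC : C.length ≤ N ^ 8) (x : Sym2 (Fin n) → GaloisField 2 m)
    (Y : Fin r → Fin n → GaloisField 2 m) (Z : Fin s → Sym2 (Fin n) → GaloisField 2 m) :
    (phiEval C x Y Z).TimeLe G (2 ^ (r + s) * N ^ 20) := by
  have h2 := h.two_le
  have hlen : ∀ {q : ℕ} {L : List (Fin q)}, q < N → L ∈ (List.finRange q).sublists →
      L.length ≤ N ^ 1 := by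
    intro q L hq hL
    have := (List.mem_sublists.1 hL).length_le
    rw [List.length_finRange] at this
    rw [pow_one]
    omega
  have h1 : ∀ j, 1 ≤ 2 ^ j := fun j => Nat.one_le_two_pow
  have hn : (List.finRange n).length ≤ N ^ 2 :=
    h.length_finRange.trans (Nat.pow_le_pow_right (by omega) (by norm_num))
  have hinner : ∀ (acc : GaloisField 2 m) (S : List (Fin s)), S ∈ (List.finRange s).sublists →
      (sumArray (pairs n) Z S >>= fun z => fold (List.finRange r).sublists acc fun acc R => do
        let y ← sumArray (List.finRange n) Y R
        let a ← evalCircuit C (assign x y z)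
        exec (.fadd acc a)).TimeLe G (2 ^ r * N ^ 17) := by
    intro acc S hS
    refine (h.timeLe_sumArray h.length_pairs Z (hlen h.s_lt hS)).bind_mul_pow (b := 16) 17 h2 (h1 r)
      fun z => ?_
    have hloop := loop_le_mul_pow (N := N) (W := 1) (a := 15) (c := 16)
      (L := (List.finRange r).sublists.length) (W' := 2 ^ r) h2 le_rfl (by simp) (by norm_num)
    rw [mul_one, one_mul] at hloop
    refine (timeLe_fold (B := N ^ 15) (fun acc R hR => ?_) acc).mono hloop
    refine (h.timeLe_sumArray hn Y (hlen h.r_lt hR)).bind_pow (b := 14) 15 h2 fun y =>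
      (h.timeLe_evalCircuit hC _).bind_pow (b := 1) 14 h2 fun a => timeLe_exec ?_
    simp only [Instr.cost, pow_one]
    exact h.m_lt
  refine ((timeLe_fold hinner 0).bind (B' := N ^ 2) fun total => ?_).mono (B := _ + N ^ 2) ?_
  · refine TimeLe.bind_pow (a := 1) (b := 0) 2 h2 (timeLe_exec ?_) fun _ => timeLe_pure _ _
    simp only [Instr.cost, pow_one]
    exact h.m_lt
  · have h₁ := loop_le_mul_pow (N := N) (W := 2 ^ r) (a := 17) (c := 18)
        (L := (List.finRange s).sublists.length) (W' := 2 ^ s) h2 (h1 r) (by simp) (by norm_num)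
    have h₂ := pow_add_pow_le_pow (N := N) (a := 18) (b := 2) (c := 20) h2 (by norm_num)
      (by norm_num)
    calc _ ≤ 2 ^ s * 2 ^ r * N ^ 18 + N ^ 2 := Nat.add_le_add_right h₁ _
      _ = 2 ^ (r + s) * N ^ 18 + 1 * N ^ 2 := by ring
      _ ≤ 2 ^ (r + s) * N ^ 18 + 2 ^ (r + s) * N ^ 2 :=
        Nat.add_le_add_left (Nat.mul_le_mul_right _ (h1 _)) _
      _ = 2 ^ (r + s) * (N ^ 18 + N ^ 2) := by ring
      _ ≤ _ := Nat.mul_le_mul_left _ h₂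

theorem Dominates.timeLe_phiTest (h : Dominates N n m k r s) {C : Circuit n}
    (hC : C.length ≤ N ^ 8) :
    (phiTest (F := GaloisField 2 m) r s C).TimeLe G (2 ^ (r + s) * N ^ 23) := by
  have h2 := h.two_le
  have h1 : 1 ≤ 2 ^ (r + s) := Nat.one_le_two_pow
  rw [phiTest_eq]
  refine (timeLe_tabulate_pow 4 h2 h.length_pairs fun _ => h.timeLe_rand).bind_mul_pow (b := 22)
    23 h2 h1 fun x => (timeLe_tabulate_pow (b := 1) 6 h2 ?_ fun _ =>
      timeLe_tabulate_pow 3 h2 h.length_finRange fun _ => h.timeLe_rand).bind_mul_pow (b := 21)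
    22 h2 h1 fun Y => (timeLe_tabulate_pow (b := 1) 6 h2 ?_ fun _ =>
      timeLe_tabulate_pow 4 h2 h.length_pairs fun _ => h.timeLe_rand).bind_mul_pow
    21 h2 h1 fun Z => h.timeLe_phiEval hC x Y Z
  · simpa using h.r_lt.le
  · simpa using h.s_lt.le

theorem Dominates.timeLe_trial (h : Dominates N n m k r s) (v₀ : Fin n) :
    (trial (F := GaloisField 2 m) k r s v₀).TimeLe G (2 ^ (r + s) * N ^ 25) := by
  have h2 := h.two_le
  have h1 : 1 ≤ 2 ^ (r + s) := Nat.one_le_two_pow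
  refine (timeLe_tabulate_pow (a := 0) 2 h2 h.length_finRange fun v => ?_).bind_mul_pow (b := 24)
    25 h2 h1 fun V₁ => ?_
  · split_ifs
    · exact timeLe_pure _ _
    · exact timeLe_exec (by simp [Instr.cost])
  · refine ((h.timeLe_buildCircuit v₀ V₁).bind_of_ensures (h.ensures_buildCircuit_length v₀ V₁)
      fun C hC => h.timeLe_phiTest hC).mono ?_
    calc N ^ 14 + 2 ^ (r + s) * N ^ 23 ≤ 2 ^ (r + s) * N ^ 14 + 2 ^ (r + s) * N ^ 23 :=
          Nat.add_le_add_right (Nat.le_mul_of_pos_left _ h1) _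
      _ = 2 ^ (r + s) * (N ^ 14 + N ^ 23) := by ring
      _ ≤ _ := Nat.mul_le_mul_left _ (pow_add_pow_le_pow h2 (by norm_num) (by norm_num))

/-! ### Cost of computing the number of rounds -/

theorem Dominates.timeLe_arith (h : Dominates N n m k r s) {op : ArithOp} {a b : ℕ}
    (ha : a < 2 ^ (2 * N)) (hb : b < 2 ^ (2 * N)) :
    (exec (.arith op a b : Instr n (GaloisField 2 m) ℕ)).TimeLe G (N ^ 3) := by
  refine timeLe_exec ?_
  simp only [Instr.cost]
  -- Operands of at most `2 * N` bits are charged at most `(2 * N + 1) ^ 2`, which is below `N ^ 3`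
  -- since `N ≥ 16`.
  calc _ ≤ (2 * N + 1) * (2 * N + 1) := Nat.mul_le_mul (Nat.succ_le_succ (Nat.size_le.2 ha))
        (Nat.succ_le_succ (Nat.size_le.2 hb))
    _ ≤ N ^ 3 := by have := h.large; nlinarith

theorem Dominates.timeLe_powTwo (h : Dominates N n m k r s) {e : ℕ} (he : e ≤ N) :
    (powTwo e : Prog n (GaloisField 2 m) ℕ).TimeLe G (N ^ 5) := by
  have hN := h.two_le
  have hlt : ∀ a, a ≤ 2 ^ e → a < 2 ^ (2 * N) := fun a ha =>
    ha.trans_lt (Nat.pow_lt_pow_right (by norm_num) (by omega))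
  -- One doubling is still to come for each remaining index, so the invariant bounds the current
  -- value by `2 ^ e`.
  refine (timeLe_fold_of_invariant (B := N ^ 3) (fun l a => a * 2 ^ l.length ≤ 2 ^ e) _ _ (by simp)
    (fun i l a ha => (ensures_arith _ _ _).mono fun b hb => ?_) fun i l a ha =>
      h.timeLe_arith ?_ ?_).mono
    (loop_le_pow (b := 1) hN (by simpa using he) (by norm_num))
  · rw [hb]
    simp only [ArithOp.eval, List.length_cons, pow_succ] at ha ⊢
    linarith
  · calc 2 = 2 ^ 1 := rfl
      _ < _ := Nat.pow_lt_pow_right (by norm_num) (by omega)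
  · exact hlt a ((Nat.le_mul_of_pos_right _ (by positivity)).trans ha)

theorem Dominates.timeLe_binomial (h : Dominates N n m k r s) {a b : ℕ} (ha : a < N) (hb : b ≤ N) :
    (binomial a b : Prog n (GaloisField 2 m) ℕ).TimeLe G (N ^ 8) := by
  have hN := h.two_le
  have hself : ∀ x, x ≤ N → x < 2 ^ (2 * N) := fun x hx =>
    (hx.trans_lt Nat.lt_two_pow_self).trans_le (Nat.pow_le_pow_right (by norm_num) (by omega))
  have hch : ∀ i, a.choose i ≤ 2 ^ N := fun i =>
    (Nat.choose_le_two_pow a i).trans (Nat.pow_le_pow_right (by norm_num) ha.le)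
  rw [binomial, List.range_eq_range']
  -- The invariant recovers the loop index `i` from the remaining list and identifies the current
  -- value as `a choose i ≤ 2 ^ N`. The product with `a - i` then stays below `2 ^ (2 * N)`.
  refine (timeLe_fold_of_invariant (B := N ^ 6) (fun l c => ∃ i, i + l.length = b ∧
    l = List.range' i l.length ∧ c = a.choose i) _ _ ⟨0, by simp⟩ ?_ ?_).mono
    (loop_le_pow (b := 1) hN (by simpa using hb) (by norm_num))
  · rintro i l c ⟨i', h₁, h₂, h₃⟩
    rw [List.length_cons, List.range'_succ, List.cons.injEq] at h₂
    obtain ⟨rfl, h₂⟩ := h₂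
    refine (ensures_arith _ _ _).bind fun d hd => (ensures_arith _ _ _).bind fun p hp =>
      (ensures_arith _ _ _).bind fun i' hi => (ensures_arith _ _ _).mono fun c' hc =>
        ⟨i + 1, by rw [List.length_cons] at h₁; omega, h₂, ?_⟩
    rw [hc, hi, hp, hd, h₃]
    simp only [ArithOp.eval]
    rw [← Nat.choose_succ_right_eq, Nat.mul_div_cancel _ (Nat.succ_pos i)]
  · rintro i l c ⟨i', h₁, h₂, h₃⟩
    rw [List.length_cons, List.range'_succ, List.cons.injEq] at h₂
    obtain ⟨rfl, h₂⟩ := h₂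
    rw [List.length_cons] at h₁
    have hc : c ≤ 2 ^ N := h₃ ▸ hch i
    refine ((h.timeLe_arith (hself a ha.le) (hself i (by omega))).bind_of_ensures
      (ensures_arith _ _ _) fun d hd => (h.timeLe_arith ?_ (hself d ?_)).bind_of_ensures
      (ensures_arith _ _ _) fun p hp => (h.timeLe_arith (hself i (by omega))
        (hself 1 (by omega))).bind_of_ensures (ensures_arith _ _ _) fun i' hi =>
      h.timeLe_arith (a := p) (b := i') ?_ (hself i' ?_)).mono ?_
    · exact hc.trans_lt (Nat.pow_lt_pow_right (by norm_num) (by omega))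
    · rw [hd]; simp only [ArithOp.eval]; omega
    · rw [hp, hd]
      simp only [ArithOp.eval]
      calc c * (a - i) ≤ 2 ^ N * (a - i) := Nat.mul_le_mul_right _ hc
        _ < 2 ^ N * 2 ^ N := Nat.mul_lt_mul_of_pos_left
          (lt_of_le_of_lt (by omega) (Nat.lt_two_pow_self (n := N))) (by positivity)
        _ = 2 ^ (2 * N) := by rw [← pow_add]; congr 1; ring
    · rw [hi]; simp only [ArithOp.eval]; omega
    · have h₁ := pow_add_pow_le_pow (a := 3) (b := 3) (c := 4) hN (by norm_num) (by norm_num)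
      have h₂ := pow_add_pow_le_pow (a := 4) (b := 4) (c := 6) hN (by norm_num) (by norm_num)
      omega

theorem Dominates.timeLe_rounds (h : Dominates N n m k r s) :
    (rounds k r s : Prog n (GaloisField 2 m) ℕ).TimeLe G (N ^ 17) := by
  have hN := h.two_le
  have hk := h.k_lt
  have hr := h.r_lt
  have hs := h.s_lt
  have hself : ∀ x, x ≤ N → x < 2 ^ (2 * N) := fun x hx =>
    (hx.trans_lt Nat.lt_two_pow_self).trans_le (Nat.pow_le_pow_right (by norm_num) (by omega))
  have hch : ∀ a i, a < N → a.choose i < 2 ^ N := fun a i ha =>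
    (Nat.choose_le_two_pow a i).trans_lt (Nat.pow_lt_pow_right (by norm_num) ha)
  have hsq : 2 ^ N * 2 ^ N = 2 ^ (2 * N) := by rw [← pow_add]; congr 1; ring
  have hlt : (2 : ℕ) ^ N < 2 ^ (2 * N) := Nat.pow_lt_pow_right (by norm_num) (by omega)
  have hseq : ∀ {α β : Type} {p : Prog n (GaloisField 2 m) α} {f : α → Prog n (GaloisField 2 m) β}
      {Q : α → Prop} {a b c : ℕ}, p.TimeLe G (N ^ a) → p.Ensures G Q →
      (∀ x, Q x → (f x).TimeLe G (N ^ b)) → a < c → b < c → (p >>= f).TimeLe G (N ^ c) :=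
    fun hp hQ hf ha hb => (hp.bind_of_ensures hQ hf).mono (pow_add_pow_le_pow hN ha hb)
  refine hseq (b := 16) (h.timeLe_arith (hself k hk.le) (hself 1 (by omega))) (ensures_arith _ _ _)
    (fun k' hk' => ?_) (by norm_num) (by norm_num)
  replace hk' : k' = k + 1 := hk'
  refine hseq (b := 15) (h.timeLe_powTwo (by omega)) (ensures_powTwo _) (fun p hp => ?_)
    (by norm_num) (by norm_num)
  refine hseq (b := 14) (h.timeLe_arith (hself k' (by omega)) (hself r hr.le)) (ensures_arith _ _ _)
    (fun d hd => ?_) (by norm_num) (by norm_num)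
  replace hd : d = k' - r := hd
  refine hseq (b := 13) (h.timeLe_arith (hself d (by omega)) (hself s hs.le)) (ensures_arith _ _ _)
    (fun t ht => ?_) (by norm_num) (by norm_num)
  replace ht : t = d - s := ht
  refine hseq (b := 12) (h.timeLe_binomial hr (by omega)) (ensures_binomial _ _) (fun b₁ hb₁ => ?_)
    (by norm_num) (by norm_num)
  refine hseq (b := 11) (h.timeLe_arith (hself k (by omega)) (hself r hr.le)) (ensures_arith _ _ _)
    (fun d' hd' => ?_) (by norm_num) (by norm_num)
  replace hd' : d' = k - r := hd'
  refine hseq (b := 10) (h.timeLe_binomial (by omega) hs.le) (ensures_binomial _ _)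
    (fun b₂ hb₂ => ?_) (by norm_num) (by norm_num)
  have h₁ : b₁ < 2 ^ N := hb₁ ▸ hch _ _ hr
  have h₂ : b₂ < 2 ^ N := hb₂ ▸ hch _ _ (by omega)
  refine hseq (b := 3) (h.timeLe_arith (h₁.trans hlt) (h₂.trans hlt)) (ensures_arith _ _ _)
    (fun b hb => ?_) (by norm_num) (by norm_num)
  replace hb : b = b₁ * b₂ := hb
  refine h.timeLe_arith ?_ ?_
  · rw [hp]
    exact Nat.pow_lt_pow_right (by norm_num) (by omega)
  · rw [hb, ← hsq]
    exact Nat.mul_lt_mul'' h₁ h₂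

/-- Since the bit length is minimal, the field has at most twice `4 * (2 * k + 1)` elements. The
search for an irreducible polynomial is therefore polynomial in `k`. -/
theorem four_pow_fieldBits_le (k : ℕ) : 4 ^ fieldBits k ≤ (8 * (2 * k + 1)) ^ 2 := by
  have h₁ : fieldBits k ≠ 0 := fun h => by
    have := Nat.size_eq_zero.1 h
    omega
  obtain ⟨d, hd⟩ : ∃ d, fieldBits k = d + 1 := ⟨fieldBits k - 1, by omega⟩
  have h₂ : 2 ^ d ≤ 4 * (2 * k + 1) := by
    refine Nat.lt_size.1 ?_
    unfold fieldBits at hd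
    omega
  have h₃ : 2 ^ fieldBits k ≤ 8 * (2 * k + 1) := by
    rw [hd, pow_succ]
    omega
  calc 4 ^ fieldBits k = (2 ^ 2) ^ fieldBits k := by norm_num
    _ = (2 ^ fieldBits k) ^ 2 := by rw [← pow_mul, ← pow_mul, mul_comm]
    _ ≤ _ := Nat.pow_le_pow_left h₃ 2

theorem Dominates.timeLe_hamiltonian (h : Dominates N n (fieldBits k) k r s)
    (hA : Admissible k r s) :
    (hamiltonian (F := GaloisField 2 (fieldBits k)) n k r s).TimeLe G
      (2 ^ (k + 1) / (r.choose (k + 1 - r - s) * (k - r).choose s) * 2 ^ (r + s) * N ^ 31) := by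
  have hN := h.two_le
  set B := r.choose (k + 1 - r - s) * (k - r).choose s
  set T := 2 ^ (k + 1) / B with hT
  -- Since at least one round is run, the setup and the computation of `T` can be absorbed into the
  -- bound for the rounds.
  have hT1 : 1 ≤ T := by
    rw [hT, Nat.one_le_div_iff hA.mul_choose_pos]
    exact hA.mul_choose_le.trans (Nat.pow_le_pow_right (by norm_num) (by omega))
  have h1 : 1 ≤ 2 ^ (r + s) := Nat.one_le_two_pow
  have hW : 1 ≤ T * 2 ^ (r + s) := Nat.mul_pos hT1 h1
  refine TimeLe.bind_mul_pow (a := 8) (b := 30) 31 hN hW (timeLe_exec ?_) fun _ => ?_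
  · simp only [Instr.cost]
    calc _ ≤ (8 * (2 * k + 1)) ^ 2 * N ^ 2 :=
          Nat.mul_le_mul (four_pow_fieldBits_le k) (Nat.pow_le_pow_left h.m_lt 2)
      _ ≤ (N ^ 2) ^ 2 * N ^ 2 := by
          have := h.k_lt
          have := h.large
          gcongr
          nlinarith
      _ = N ^ 6 := by ring
      _ ≤ N ^ 8 := Nat.pow_le_pow_right (by omega) (by norm_num)
  · refine (h.timeLe_rounds.bind_of_ensures (ensures_rounds k r s)
      (B' := n * (T * (2 ^ (r + s) * N ^ 25 + 1) + 1)) fun T' hT' => ?_).mono ?_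
    · have := timeLe_anyOf (G := G) (fun v₀ => timeLe_anyOf (fun _ => h.timeLe_trial v₀)
        (List.range T')) (List.finRange n)
      rw [List.length_finRange, List.length_range, show T' = T from hT'] at this
      rw [show T' = T from hT']
      exact this
    have h₁ := loop_le_mul_pow (N := N) (W := 2 ^ (r + s)) (a := 25) (c := 26) (L := T) (W' := T)
      hN h1 le_rfl (by norm_num)
    have h₂ := loop_le_mul_pow (N := N) (W := T * 2 ^ (r + s)) (a := 26) (c := 27) (L := n) (W' := N)
      hN hW h.n_le (by norm_num)
    have h₃ := pow_add_pow_le_pow (N := N) (a := 17) (b := 28) (c := 30) hN (by norm_num)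
      (by norm_num)
    calc _ ≤ N ^ 17 + n * (T * 2 ^ (r + s) * N ^ 26 + 1) := by gcongr
      _ ≤ N ^ 17 + N * (T * 2 ^ (r + s)) * N ^ 27 := by gcongr
      _ = 1 * N ^ 17 + T * 2 ^ (r + s) * N ^ 28 := by ring
      _ ≤ T * 2 ^ (r + s) * N ^ 17 + T * 2 ^ (r + s) * N ^ 28 := by gcongr
      _ = T * 2 ^ (r + s) * (N ^ 17 + N ^ 28) := by ring
      _ ≤ _ := by gcongr

/-- The factor `20` covers the constant `16` and the crude bound `8 * k + 4` for the bit length of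
field elements. -/
theorem dominates (hk : k ≤ n) (hr : r ≤ k + 1) (hs : s ≤ k + 1) :
    Dominates (20 * (n + 1)) n (fieldBits k) k r s := by
  refine ⟨by omega, by omega, ?_, by omega, by omega, by omega⟩
  have : fieldBits k ≤ 4 * (2 * k + 1) := Nat.size_le.2 Nat.lt_two_pow_self
  omega

theorem timeLe_hamiltonian_real (hk : k ≤ n) (hA : Admissible k r s) :
    ∃ B : ℕ, (hamiltonian (F := GaloisField 2 (fieldBits k)) n k r s).TimeLe G B ∧
      (B : ℝ) ≤ 2 * 20 ^ 31 * ((n : ℝ) + 1) ^ 31 * (2 ^ (r + s + k) /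
        ((r.choose (k + 1 - r - s) : ℝ) * ((k - r).choose s : ℝ))) := by
  have h₁ := hA.1
  refine ⟨_, (dominates hk (by omega) (by omega)).timeLe_hamiltonian hA, ?_⟩
  have hB : (0 : ℝ) < (r.choose (k + 1 - r - s) : ℝ) * ((k - r).choose s : ℝ) := by
    exact_mod_cast hA.mul_choose_pos
  have hT : ((2 ^ (k + 1) / (r.choose (k + 1 - r - s) * (k - r).choose s) : ℕ) : ℝ) ≤
      2 ^ (k + 1) / ((r.choose (k + 1 - r - s) : ℝ) * ((k - r).choose s : ℝ)) := by
    refine Nat.cast_div_le.trans ?_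
    push_cast
    rfl
  push_cast at hT ⊢
  calc _ ≤ 2 ^ (k + 1) / ((r.choose (k + 1 - r - s) : ℝ) * ((k - r).choose s : ℝ)) *
        2 ^ (r + s) * (20 * ((n : ℝ) + 1)) ^ 31 := by gcongr
    _ = _ := by rw [mul_pow, pow_add 2 (r + s) k, pow_succ]; ring

theorem exists_runsInTime_hamiltonian : ∃ C c : ℕ, ∀ (n : ℕ) (G : SimpleGraph (Fin n))
    (k r s : ℕ), 1 ≤ k → k ≤ n → Admissible k r s → RunsInTime (runHamiltonian G k r s)
      (C * ((2 : ℝ) ^ (r + s + k) * (n : ℝ) ^ c /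
        ((r.choose (k + 1 - r - s) : ℝ) * ((k - r).choose s : ℝ)))) := by
  -- Here `n ≥ k ≥ 1`, so `n + 1 ≤ 2 * n`, and `20 ^ 31 * 2 ^ 31 = 40 ^ 31`.
  refine ⟨2 * 40 ^ 31, 31, fun n G k r s hk hkn hA o ho => ?_⟩
  obtain ⟨B, hB, hB'⟩ := timeLe_hamiltonian_real (G := G) hkn hA
  have h₁ : (o.2 : ℝ) ≤ B := by exact_mod_cast hB o ho
  refine (h₁.trans hB').trans ?_
  have hn : (1 : ℝ) ≤ n := by exact_mod_cast hk.trans hkn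
  have h₂ : ((n : ℝ) + 1) ^ 31 ≤ (2 * n) ^ 31 := by gcongr; linarith
  calc _ ≤ 2 * 20 ^ 31 * (2 * (n : ℝ)) ^ 31 * (2 ^ (r + s + k) /
        ((r.choose (k + 1 - r - s) : ℝ) * ((k - r).choose s : ℝ))) := by gcongr
    _ = _ := by
      push_cast
      ring

end Time

/-! ## The exponent for `r = ⌊0.5 k⌋` and `s = ⌊0.208 k⌋` -/

section Exponent

-- The quotient `b ^ j / j !` is largest at `j = b`.
open Nat in
theorem factorial_mul_pow_le (b j : ℕ) : b ! * b ^ j ≤ j ! * b ^ b := by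
  rcases Nat.le_total j b with h | h
  · have h₁ : b ! = j ! * b.descFactorial (b - j) := by
      have := Nat.factorial_mul_descFactorial (Nat.sub_le b j)
      rw [Nat.sub_sub_self h] at this
      exact this.symm
    calc b ! * b ^ j ≤ j ! * b ^ (b - j) * b ^ j := by
          rw [h₁]; gcongr; exact Nat.descFactorial_le_pow _ _
      _ = j ! * b ^ b := by rw [mul_assoc, ← pow_add, Nat.sub_add_cancel h]
  · calc b ! * b ^ j = b ! * b ^ (j - b) * b ^ b := by
          rw [mul_assoc, ← pow_add, Nat.sub_add_cancel h]
      _ ≤ j ! * b ^ b := by gcongr; exact Nat.factorial_mul_pow_sub_le_factorial h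

-- The binomial expansion of the left side has `b + c + 1` terms. The largest is the one with `j =
-- b`, by `factorial_mul_pow_le` applied to both exponents.
open Nat in
theorem add_pow_self_le (b c : ℕ) :
    (b + c) ^ (b + c) ≤ (b + c + 1) * ((b + c).choose b * (b ^ b * c ^ c)) := by
  rw [add_pow b c (b + c)]
  refine (Finset.sum_le_card_nsmul _ _ ((b + c).choose b * (b ^ b * c ^ c)) fun j hj => ?_).trans
    (by simp)
  have hj : j ≤ b + c := Nat.lt_succ_iff.1 (Finset.mem_range.1 hj)
  obtain ⟨i, hi⟩ := Nat.exists_eq_add_of_le hj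
  rw [hi, Nat.add_sub_cancel_left, ← hi]
  have h₁ : (b + c).choose j * (j ! * i !) = (b + c).choose b * (b ! * c !) := by
    have e₁ := Nat.choose_mul_factorial_mul_factorial hj
    have e₂ := Nat.choose_mul_factorial_mul_factorial (Nat.le_add_right b c)
    rw [hi, Nat.add_sub_cancel_left, ← hi] at e₁
    rw [Nat.add_sub_cancel_left] at e₂
    rw [← mul_assoc, e₁, ← mul_assoc, e₂]
  rw [Nat.cast_id]
  refine le_of_mul_le_mul_left (a := b ! * c !) ?_
    (Nat.mul_pos (Nat.factorial_pos b) (Nat.factorial_pos c))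
  calc b ! * c ! * (b ^ j * c ^ i * (b + c).choose j)
      = (b + c).choose j * ((b ! * b ^ j) * (c ! * c ^ i)) := by ring
    _ ≤ (b + c).choose j * ((j ! * b ^ b) * (i ! * c ^ c)) :=
        Nat.mul_le_mul_left _ (Nat.mul_le_mul (factorial_mul_pow_le b j) (factorial_mul_pow_le c i))
    _ = ((b + c).choose j * (j ! * i !)) * (b ^ b * c ^ c) := by ring
    _ = _ := by rw [h₁]; ring

/-- From `t ≤ exp (t - 1)` with `t = x / y`. It replaces true frequencies by prescribed ones, at an
exponential cost that stays bounded when the two are close. -/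
theorem div_pow_le_exp {x y : ℝ} (hx : 0 ≤ x) (hy : 0 < y) (b : ℕ) :
    x ^ b ≤ y ^ b * Real.exp (b * (x / y - 1)) := by
  have h : x / y ≤ Real.exp (x / y - 1) := by
    have := Real.add_one_le_exp (x / y - 1)
    linarith
  calc x ^ b = y ^ b * (x / y) ^ b := by rw [div_pow]; field_simp
    _ ≤ y ^ b * Real.exp (x / y - 1) ^ b := by gcongr
    _ = _ := by rw [← Real.exp_nat_mul]

/-- Lower bound for binomial coefficients: `D` bounds the distance of `b` from `β * (b + c)`. -/
theorem one_le_choose_mul {β γ D : ℝ} (hβ : 0 < β) (hγ : 0 < γ) (hβγ : β + γ = 1) {b c : ℕ}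
    (ha : 0 < b + c) (hD : ((b : ℝ) - β * (b + c)) ^ 2 / (β * γ * (b + c)) ≤ D) :
    1 ≤ ((b + c : ℕ) + 1 : ℝ) * (b + c).choose b * (β ^ b * γ ^ c) * Real.exp D := by
  have ha' : (0 : ℝ) < b + c := by exact_mod_cast ha
  have h₁ : ((b : ℝ) + c) ^ (b + c) ≤ ((b + c : ℕ) + 1 : ℝ) * ((b + c).choose b *
      ((b : ℝ) ^ b * (c : ℝ) ^ c)) := by exact_mod_cast add_pow_self_le b c
  have h₂ := div_pow_le_exp (x := b) (y := β * (b + c)) (by positivity) (by positivity) b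
  have h₃ := div_pow_le_exp (x := c) (y := γ * (b + c)) (by positivity) (by positivity) c
  -- The first-order terms in the deviation `b - β * (b + c)` cancel, as `c` deviates by the
  -- opposite amount, and only the quadratic term is left.
  have h₄ : (b : ℝ) * (b / (β * (b + c)) - 1) + c * (c / (γ * (b + c)) - 1) =
      ((b : ℝ) - β * (b + c)) ^ 2 / (β * γ * (b + c)) := by
    obtain rfl : γ = 1 - β := by linarith
    field_simp
    ring
  have h₅ : (b : ℝ) ^ b * (c : ℝ) ^ c ≤
      (β ^ b * γ ^ c) * ((b : ℝ) + c) ^ (b + c) * Real.exp D := by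
    calc (b : ℝ) ^ b * (c : ℝ) ^ c ≤ ((β * (b + c)) ^ b * Real.exp (b * (b / (β * (b + c)) - 1))) *
          ((γ * (b + c)) ^ c * Real.exp (c * (c / (γ * (b + c)) - 1))) := by gcongr
      _ = (β ^ b * γ ^ c) * ((b : ℝ) + c) ^ (b + c) *
          Real.exp (b * (b / (β * (b + c)) - 1) + c * (c / (γ * (b + c)) - 1)) := by
        rw [Real.exp_add, mul_pow, mul_pow, pow_add]; ring
      _ ≤ _ := by rw [h₄]; gcongr
  have hpos : (0 : ℝ) < ((b : ℝ) + c) ^ (b + c) := by positivity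
  refine le_of_mul_le_mul_left ?_ hpos
  calc ((b : ℝ) + c) ^ (b + c) * 1 ≤ ((b + c : ℕ) + 1 : ℝ) * ((b + c).choose b *
        ((β ^ b * γ ^ c) * ((b : ℝ) + c) ^ (b + c) * Real.exp D)) := by
          rw [mul_one]
          refine h₁.trans ?_
          gcongr
    _ = _ := by ring

/-- The three exponents are multiples of `1 / 250`, so the 250th power turns this into an inequality
between rational numbers. The exponent `1.708` is `0.5 + 0.208 + 1`, the rate of `r + s + k`. -/
theorem base_le : (2 : ℝ) ^ (1.708 : ℝ) * 0.416 ^ (0.416 : ℝ) * 0.584 ^ (0.584 : ℝ) ≤ 1.657 := by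
  refine (pow_le_pow_iff_left₀ (by positivity) (by norm_num) (n := 250) (by norm_num)).1 ?_
  rw [mul_pow, mul_pow, ← Real.rpow_mul_natCast (by norm_num), ← Real.rpow_mul_natCast (by norm_num),
    ← Real.rpow_mul_natCast (by norm_num)]
  have e₁ : (1.708 : ℝ) * (250 : ℕ) = (427 : ℕ) := by norm_num
  have e₂ : (0.416 : ℝ) * (250 : ℕ) = (104 : ℕ) := by norm_num
  have e₃ : (0.584 : ℝ) * (250 : ℕ) = (146 : ℕ) := by norm_num
  rw [e₁, e₂, e₃, Real.rpow_natCast, Real.rpow_natCast, Real.rpow_natCast,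
    show 427 = 104 + 146 + 177 by norm_num, pow_add, pow_add]
  norm_num

/-- For odd `k` one has `2 * r = k - 1`, and the first coefficient is nonzero only if `s ≥ 2`. This
is what `k ≥ 10` provides. -/
theorem admissible_half {k : ℕ} (hk : 10 ≤ k) : Admissible k (k / 2) (208 * k / 1000) := by
  refine ⟨by omega, (Nat.choose_pos (by omega)).ne', (Nat.choose_pos (by omega)).ne'⟩

theorem admissible_succ (k : ℕ) : Admissible k (k + 1) 0 := by
  simp [Admissible]

/-- With `b₁ = r - (k + 1 - r - s)`, the quotients `b₁ / r` and `s / (k - r)` are both close to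
`0.416`, so the same entropy bound serves both coefficients. The total exponents of `0.416` and
`0.584` are then about `0.416 k` and `0.584 k`, as in `base_le`. Rounding costs only a constant
factor. -/
theorem pow_div_choose_le {k r s : ℕ} (hk : 10 ≤ k) (hr : r = k / 2) (hs : s = 208 * k / 1000) :
    (2 : ℝ) ^ (r + s + k) / ((r.choose (k + 1 - r - s) : ℝ) * ((k - r).choose s : ℝ)) ≤
      Real.exp 18 * (0.416⁻¹) ^ 4 * ((k : ℝ) + 1) ^ 2 * 1.657 ^ k := by
  obtain ⟨b₁, hb₁⟩ : ∃ b₁, 2 * r + s = b₁ + k + 1 := ⟨2 * r + s - k - 1, by omega⟩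
  obtain ⟨c₁, hc₁⟩ : ∃ c₁, k + 1 = r + s + c₁ := ⟨k + 1 - r - s, by omega⟩
  obtain ⟨c₂, hc₂⟩ : ∃ c₂, k = r + s + c₂ := ⟨k - r - s, by omega⟩
  have hrR : (r : ℝ) ≤ k / 2 ∧ (k : ℝ) / 2 - 1 / 2 ≤ r := by
    have h₁ : 2 * r ≤ k := by omega
    have h₂ : k ≤ 2 * r + 1 := by omega
    have h₁' : 2 * (r : ℝ) ≤ k := by exact_mod_cast h₁
    have h₂' : (k : ℝ) ≤ 2 * r + 1 := by exact_mod_cast h₂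
    constructor <;> linarith
  have hsR : (s : ℝ) ≤ 0.208 * k ∧ 0.208 * (k : ℝ) - 1 ≤ s := by
    have h₁ : 1000 * s ≤ 208 * k := by omega
    have h₂ : 208 * k ≤ 1000 * s + 1000 := by omega
    have h₁' : 1000 * (s : ℝ) ≤ 208 * k := by exact_mod_cast h₁
    have h₂' : 208 * (k : ℝ) ≤ 1000 * s + 1000 := by exact_mod_cast h₂
    constructor <;> linarith
  have hb₁R : 2 * (r : ℝ) + s = b₁ + k + 1 := by exact_mod_cast hb₁
  have hc₁R : (k : ℝ) + 1 = r + s + c₁ := by exact_mod_cast hc₁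
  have hc₂R : (k : ℝ) = r + s + c₂ := by exact_mod_cast hc₂
  have hkR : (10 : ℝ) ≤ k := by exact_mod_cast hk
  -- Rounding moves `b₁` and `s` by less than `3` from their ideal values, and `0.416 * 0.584 * 5 >
  -- 1`. So `D = 9` is enough for each coefficient, and `exp 9` occurs twice.
  have hquot : ∀ x y : ℝ, -3 ≤ x → x ≤ 3 → 5 ≤ y → x ^ 2 / (0.416 * 0.584 * y) ≤ 9 := by
    intro x y h₁ h₂ h₃
    rw [div_le_iff₀ (by linarith)]
    nlinarith
  have hr5 : 5 ≤ r := by omega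
  have h₁ := one_le_choose_mul (β := 0.416) (γ := 0.584) (D := 9) (by norm_num) (by norm_num)
    (by norm_num) (b := b₁) (c := c₁) (by omega)
    (hquot _ _ (by linarith) (by linarith) (by
      have : (5 : ℝ) ≤ r := by exact_mod_cast hr5
      linarith))
  have h₂ := one_le_choose_mul (β := 0.416) (γ := 0.584) (D := 9) (by norm_num) (by norm_num)
    (by norm_num) (b := s) (c := c₂) (by omega)
    (hquot _ _ (by linarith) (by linarith) (by linarith))
  have hch₁ : (b₁ + c₁).choose b₁ = r.choose (k + 1 - r - s) := by
    rw [show b₁ + c₁ = r by omega, ← Nat.choose_symm (show b₁ ≤ r by omega)]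
    congr 1
    omega
  rw [hch₁] at h₁
  rw [show s + c₂ = k - r by omega] at h₂
  set A := r.choose (k + 1 - r - s)
  set A' := (k - r).choose s
  have hA : (0 : ℝ) < (A : ℝ) * A' := by
    have := (admissible_half hk).mul_choose_pos
    rw [← hr, ← hs] at this
    exact_mod_cast this
  have hpow₁ : (2 : ℝ) ^ (r + s + k) ≤ 2 ^ (1.708 * (k : ℝ)) := by
    rw [← Real.rpow_natCast]
    refine Real.rpow_le_rpow_of_exponent_le (by norm_num) ?_
    push_cast
    linarith
  -- `b₁ + s = 2 * r + 2 * s - k - 1 ≥ 0.416 * k - 4`, which accounts for the fourth power.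
  have hpow₂ : (0.416 : ℝ) ^ (b₁ + s) ≤ 0.416⁻¹ ^ 4 * 0.416 ^ (0.416 * (k : ℝ)) := by
    rw [← Real.rpow_natCast]
    have : (0.416 : ℝ)⁻¹ ^ 4 * 0.416 ^ (0.416 * (k : ℝ)) = 0.416 ^ (0.416 * (k : ℝ) - 4) := by
      rw [Real.rpow_sub (by norm_num), div_eq_mul_inv, mul_comm]
      norm_num
    rw [this]
    refine Real.rpow_le_rpow_of_exponent_ge (by norm_num) (by norm_num) ?_
    push_cast
    linarith
  -- Here nothing is lost: `c₁ + c₂ = 2 * k + 1 - 2 * r - 2 * s` exceeds `0.584 * k`.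
  have hpow₃ : (0.584 : ℝ) ^ (c₁ + c₂) ≤ 0.584 ^ (0.584 * (k : ℝ)) := by
    rw [← Real.rpow_natCast]
    refine Real.rpow_le_rpow_of_exponent_ge (by norm_num) (by norm_num) ?_
    push_cast
    linarith
  have hbase : (2 : ℝ) ^ (1.708 * (k : ℝ)) * 0.416 ^ (0.416 * (k : ℝ)) * 0.584 ^ (0.584 * (k : ℝ)) ≤
      1.657 ^ k := by
    rw [Real.rpow_mul_natCast (by norm_num), Real.rpow_mul_natCast (by norm_num),
      Real.rpow_mul_natCast (by norm_num), ← mul_pow, ← mul_pow]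
    exact pow_le_pow_left₀ (by positivity) base_le k
  have hd₁ : ((b₁ + c₁ : ℕ) : ℝ) + 1 ≤ k + 1 := by
    have : b₁ + c₁ ≤ k := by omega
    have : ((b₁ + c₁ : ℕ) : ℝ) ≤ k := by exact_mod_cast this
    linarith
  have hd₂ : ((k - r : ℕ) : ℝ) + 1 ≤ k + 1 := by
    have : ((k - r : ℕ) : ℝ) ≤ k := by exact_mod_cast Nat.sub_le k r
    linarith
  have hone : (1 : ℝ) ≤ ((k : ℝ) + 1) ^ 2 * (A * A') * (0.416 ^ (b₁ + s) * 0.584 ^ (c₁ + c₂)) *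
      Real.exp 18 := by
    calc (1 : ℝ) = 1 * 1 := by norm_num
      _ ≤ (((b₁ + c₁ : ℕ) + 1 : ℝ) * A * (0.416 ^ b₁ * 0.584 ^ c₁) * Real.exp 9) *
          (((k - r : ℕ) + 1 : ℝ) * A' * (0.416 ^ s * 0.584 ^ c₂) * Real.exp 9) :=
        mul_le_mul h₁ h₂ (by norm_num) (by positivity)
      _ ≤ (((k : ℝ) + 1) * A * (0.416 ^ b₁ * 0.584 ^ c₁) * Real.exp 9) *
          (((k : ℝ) + 1) * A' * (0.416 ^ s * 0.584 ^ c₂) * Real.exp 9) := by gcongr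
      _ = _ := by
        rw [show (18 : ℝ) = 9 + 9 by norm_num, Real.exp_add, pow_add, pow_add]
        ring
  rw [div_le_iff₀ hA]
  calc (2 : ℝ) ^ (r + s + k) = 2 ^ (r + s + k) * 1 := by ring
    _ ≤ 2 ^ (1.708 * (k : ℝ)) * (((k : ℝ) + 1) ^ 2 * (A * A') *
        ((0.416⁻¹ ^ 4 * 0.416 ^ (0.416 * (k : ℝ))) * 0.584 ^ (0.584 * (k : ℝ))) * Real.exp 18) := by
      refine mul_le_mul hpow₁ (hone.trans ?_) (by norm_num) (by positivity)
      gcongr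
    _ = Real.exp 18 * 0.416⁻¹ ^ 4 * ((k : ℝ) + 1) ^ 2 * (2 ^ (1.708 * (k : ℝ)) *
        0.416 ^ (0.416 * (k : ℝ)) * 0.584 ^ (0.584 * (k : ℝ))) * (A * A') := by ring
    _ ≤ _ := by gcongr

end Exponent

/-! ## The algorithm for the undirected `k`-path problem -/

section KPathAlgorithm

open Prog

variable {n k : ℕ} {G : SimpleGraph (Fin n)}

theorem kPath_eq {F : Type} [Zero F] : kPath (F := F) n k =
    exec (.arith .lt k n) >>= fun b => if b = 0 then pure false
      else if k < 10 then hamiltonian n k (k + 1) 0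
      else hamiltonian n k (k / 2) (208 * k / 1000) := rfl

theorem ensures_lt {m : ℕ} : (exec (.arith .lt k n) : Prog n (GaloisField 2 m) ℕ).Ensures G
    fun b => b = 0 ↔ n ≤ k :=
  (ensures_arith _ _ _).mono fun b hb => by
    rw [hb]
    simp [ArithOp.eval]

theorem HasSimplePath.lt (h : HasSimplePath G k) : k < n := by
  obtain ⟨p, hp, -⟩ := hasSimplePath_iff.1 h
  simpa using Fintype.card_le_of_injective p hp

theorem half_le_answerProb_kPath (hk : 1 ≤ k) (h : HasSimplePath G k) :
    1 / 2 ≤ answerProb (runKPath G k) true := by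
  change 1 / 2 ≤ (kPath (F := GaloisField 2 (fieldBits k)) n k).dist G true
  rw [kPath_eq]
  refine le_dist_bind ensures_lt fun b hb => ?_
  rw [if_neg fun h' => absurd (hb.1 h') (not_le.2 h.lt)]
  split_ifs with h10
  · exact half_le_answerProb hk (admissible_succ k) h
  · exact half_le_answerProb hk (admissible_half (not_lt.1 h10)) h

theorem answerProb_kPath_eq_one (hk : 1 ≤ k) (h : ¬ HasSimplePath G k) :
    answerProb (runKPath G k) false = 1 := by
  have : (kPath (F := GaloisField 2 (fieldBits k)) n k).Ensures G fun b => b = false := by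
    rw [kPath_eq]
    refine (ensures_true _).bind fun b _ => ?_
    split_ifs
    · exact ensures_pure rfl
    · exact ensures_hamiltonian_false hk h
    · exact ensures_hamiltonian_false hk h
  change (kPath (F := GaloisField 2 (fieldBits k)) n k).dist G false = 1
  rw [this.dist_eq, PMF.pure_apply_self]

theorem exists_runsInTime_kPath : ∃ C c : ℕ, ∀ (n : ℕ) (G : SimpleGraph (Fin n)) (k : ℕ), 1 ≤ k →
    RunsInTime (runKPath G k) (C * ((n : ℝ) + 1) ^ c * (1.657 : ℝ) ^ k) := by
  -- `2 ^ 19` bounds `2 ^ (2 * k + 1)` for `k < 10`, and the other summand is the constant of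
  -- `pow_div_choose_le`. Its factor `(k + 1) ^ 2` raises the exponent from `31` to `33`.
  obtain ⟨K, hK⟩ := exists_nat_ge (2 ^ 19 + Real.exp 18 * (0.416⁻¹) ^ 4)
  refine ⟨2 + 2 * 20 ^ 31 * K, 33, fun n G k hk o ho => ?_⟩
  have hpow : (1 : ℝ) ≤ 1.657 ^ k := one_le_pow₀ (by norm_num)
  have hn : (1 : ℝ) ≤ (n : ℝ) + 1 := by linarith [Nat.cast_nonneg (α := ℝ) n]
  have hquot : ∀ r s : ℕ, k < n → (k < 10 ∧ r = k + 1 ∧ s = 0 ∨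
      10 ≤ k ∧ r = k / 2 ∧ s = 208 * k / 1000) → (2 : ℝ) ^ (r + s + k) /
        ((r.choose (k + 1 - r - s) : ℝ) * ((k - r).choose s : ℝ)) ≤
          K * ((n : ℝ) + 1) ^ 2 * 1.657 ^ k := by
    rintro r s hkn (⟨h10, rfl, rfl⟩ | ⟨h10, hr, hs⟩)
    · have h₁ : (2 : ℝ) ^ (k + 1 + 0 + k) ≤ 2 ^ 19 :=
        pow_le_pow_right₀ (by norm_num) (by omega)
      have h₂ : (2 : ℝ) ^ 19 ≤ K := le_trans (le_add_of_nonneg_right (by positivity)) hK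
      have h₃ : (1 : ℝ) ≤ ((n : ℝ) + 1) ^ 2 := one_le_pow₀ hn
      simp only [Nat.sub_self, Nat.choose_zero_right, Nat.cast_one, mul_one, div_one]
      calc (2 : ℝ) ^ (k + 1 + 0 + k) ≤ K * 1 * 1 := by linarith
        _ ≤ _ := by gcongr
    · refine (pow_div_choose_le h10 hr hs).trans ?_
      have h₁ : (k : ℝ) ≤ n := by exact_mod_cast hkn.le
      have h₂ : Real.exp 18 * (0.416⁻¹) ^ 4 ≤ K :=
        le_trans (le_add_of_nonneg_left (by positivity)) hK
      gcongr
  have hfirst : (((Nat.size k + 1) * (Nat.size n + 1) : ℕ) : ℝ) ≤ 2 * ((n : ℝ) + 1) * 1.657 ^ k := by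
    have h₁ : (Nat.size k + 1) * (Nat.size n + 1) ≤ (k + 1) * (n + 1) :=
      Nat.mul_le_mul (Nat.succ_le_succ (Nat.size_le.2 Nat.lt_two_pow_self))
        (Nat.succ_le_succ (Nat.size_le.2 Nat.lt_two_pow_self))
    have h₂ : (((Nat.size k + 1) * (Nat.size n + 1) : ℕ) : ℝ) ≤ ((k : ℝ) + 1) * ((n : ℝ) + 1) := by
      exact_mod_cast h₁
    -- The comparison of `k` with `n` is also charged when `k` is much larger than `n`. Its cost is
    -- then absorbed by the exponential factor, through Bernoulli's inequality `1 + 0.657 * k ≤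
    -- 1.657 ^ k`.
    have h₃ := one_add_mul_le_pow (show (-2 : ℝ) ≤ 0.657 by norm_num) k
    have h₄ : (k : ℝ) + 1 ≤ 2 * 1.657 ^ k := by
      norm_num at h₃ ⊢
      linarith [Nat.cast_nonneg (α := ℝ) k]
    nlinarith
  have hn1 : ((n : ℝ) + 1) ≤ ((n : ℝ) + 1) ^ 33 := le_self_pow₀ hn (by norm_num)
  have hham : ∀ r s : ℕ, k < n → (k < 10 ∧ r = k + 1 ∧ s = 0 ∨
      10 ≤ k ∧ r = k / 2 ∧ s = 208 * k / 1000) → Admissible k r s →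
      ∃ B : ℕ, (hamiltonian (F := GaloisField 2 (fieldBits k)) n k r s).TimeLe G B ∧
        (B : ℝ) ≤ 2 * 20 ^ 31 * K * ((n : ℝ) + 1) ^ 33 * 1.657 ^ k := by
    intro r s hkn hrs hA
    obtain ⟨B, hB, hB'⟩ := timeLe_hamiltonian_real (G := G) hkn.le hA
    refine ⟨B, hB, hB'.trans ?_⟩
    calc _ ≤ 2 * 20 ^ 31 * ((n : ℝ) + 1) ^ 31 * (K * ((n : ℝ) + 1) ^ 2 * 1.657 ^ k) := by
          gcongr
          exact hquot r s hkn hrs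
      _ = _ := by ring
  have hmain : ∃ B : ℕ, (kPath (F := GaloisField 2 (fieldBits k)) n k).TimeLe G B ∧
      (B : ℝ) ≤ 2 * ((n : ℝ) + 1) * 1.657 ^ k + 2 * 20 ^ 31 * K * ((n : ℝ) + 1) ^ 33 * 1.657 ^ k := by
    obtain ⟨B, hB, hB'⟩ : ∃ B : ℕ, (∀ b : ℕ, (b = 0 ↔ n ≤ k) →
        (if b = 0 then (pure false : Prog n (GaloisField 2 (fieldBits k)) Bool)
          else if k < 10 then hamiltonian n k (k + 1) 0
          else hamiltonian n k (k / 2) (208 * k / 1000)).TimeLe G B) ∧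
        (B : ℝ) ≤ 2 * 20 ^ 31 * K * ((n : ℝ) + 1) ^ 33 * 1.657 ^ k := by
      rcases Nat.lt_or_ge k n with hkn | hkn
      · rcases Nat.lt_or_ge k 10 with h10 | h10
        · obtain ⟨B, hB, hB'⟩ := hham _ _ hkn (Or.inl ⟨h10, rfl, rfl⟩) (admissible_succ k)
          refine ⟨B, fun b hb => ?_, hB'⟩
          rwa [if_neg fun h => absurd (hb.1 h) (not_le.2 hkn), if_pos h10]
        · obtain ⟨B, hB, hB'⟩ := hham _ _ hkn (Or.inr ⟨h10, rfl, rfl⟩) (admissible_half h10)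
          refine ⟨B, fun b hb => ?_, hB'⟩
          rwa [if_neg fun h => absurd (hb.1 h) (not_le.2 hkn), if_neg (not_lt.2 h10)]
      · refine ⟨0, fun b hb => ?_, ?_⟩
        · rw [if_pos (hb.2 hkn)]
          exact timeLe_pure _ _
        · rw [Nat.cast_zero]
          positivity
    refine ⟨(Nat.size k + 1) * (Nat.size n + 1) + B, ?_, ?_⟩
    · rw [kPath_eq]
      exact (timeLe_exec le_rfl).bind_of_ensures ensures_lt hB
    · rw [Nat.cast_add]
      exact add_le_add hfirst hB'
  obtain ⟨B, hB, hB'⟩ := hmain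
  have h₁ : (o.2 : ℝ) ≤ B := by exact_mod_cast hB o ho
  refine (h₁.trans hB').trans ?_
  push_cast
  calc _ ≤ 2 * ((n : ℝ) + 1) ^ 33 * 1.657 ^ k +
        2 * 20 ^ 31 * K * ((n : ℝ) + 1) ^ 33 * 1.657 ^ k := by gcongr
    _ = _ := by ring

end KPathAlgorithm

end KPath

theorem mainTheorem2 :
    (∃ C c : ℕ, ∀ (n : ℕ) (G : SimpleGraph (Fin n)) (k r s : ℕ), 1 ≤ k → k ≤ n →
      KPath.Admissible k r s →
      KPath.RunsInTime (KPath.runHamiltonian G k r s)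
        (C * ((2 : ℝ) ^ (r + s + k) * (n : ℝ) ^ c /
          ((r.choose (k + 1 - r - s) : ℝ) * ((k - r).choose s : ℝ))))) ∧
    (∀ (n : ℕ) (G : SimpleGraph (Fin n)) (k r s : ℕ), 1 ≤ k → KPath.Admissible k r s →
      KPath.HasSimplePath G k → 1 / 2 ≤ KPath.answerProb (KPath.runHamiltonian G k r s) true) ∧
    (∀ (n : ℕ) (G : SimpleGraph (Fin n)) (k r s : ℕ), 1 ≤ k →
      ¬ KPath.HasSimplePath G k → KPath.answerProb (KPath.runHamiltonian G k r s) false = 1) ∧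
    ((∃ C c : ℕ, ∀ (n : ℕ) (G : SimpleGraph (Fin n)) (k : ℕ), 1 ≤ k →
      KPath.RunsInTime (KPath.runKPath G k) (C * ((n : ℝ) + 1) ^ c * (1.657 : ℝ) ^ k)) ∧
    (∀ (n : ℕ) (G : SimpleGraph (Fin n)) (k : ℕ), 1 ≤ k →
      KPath.HasSimplePath G k → 1 / 2 ≤ KPath.answerProb (KPath.runKPath G k) true) ∧
    (∀ (n : ℕ) (G : SimpleGraph (Fin n)) (k : ℕ), 1 ≤ k →
      ¬ KPath.HasSimplePath G k → KPath.answerProb (KPath.runKPath G k) false = 1)) :=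
  ⟨KPath.exists_runsInTime_hamiltonian,
    fun _ _ _ _ _ => KPath.half_le_answerProb, fun _ _ _ _ _ => KPath.answerProb_eq_one,
    KPath.exists_runsInTime_kPath, fun _ _ _ => KPath.half_le_answerProb_kPath,
    fun _ _ _ => KPath.answerProb_kPath_eq_one⟩
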